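/- **BAF job scheduling.** An instance $\Psi=(J,M,p,c)$ consists of a finite set $J$ of $n$ jobs with processing times $p_j>0$ and a finite nonempty set $M$ of $m$ machines with base operation times $c_q>0$. A schedule is a map $\sigma\colon J\to M$, of cost $T(\sigma)=\sum_{q\in M}\max\{c_q,\sum_{j\in\sigma^{-1}(q)}p_j\}$. It is $\rho$-approximate if $T(\sigma)\le\rho\,T(\tau)$ for every schedule $\tau$. **Algorithm PTAS-Approx$(\Psi,\varepsilon)$**, for $0<\varepsilon\le 1/2$. Let $K=\lceil 1/\varepsilon\rceil$ and $p_{\max}=\max_j p_j$. For $i\ge 0$ let the layer $I(i)$ be the set of jobs $j$ with $\varepsilon^{i+1}<p_j/p_{\max}\le\varepsilon^i$, and for $0\le i<K$ let $G_i$ be the union of the layers whose index is congruent to $i$ modulo $K$. Choose $0\le t<K$ that minimizes $\sum_{j\in G_t}p_j$. The remaining jobs form the blocks $B_0=\bigcup_{0\le i'<t}I(i')$ and $B_i=\bigcup_{0<i'<K}I((i-1)K+i'+t)$ for $i>0$. For the jobs $j$ of a nonempty block $B_i$ put $\hat p_j=p_{\min}(B_i)(1+\varepsilon)^{k_j}$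 with $k_j=\lfloor\log_{1+\varepsilon}(p_j/p_{\min}(B_i))\rfloor$ and $p_{\min}(B_i)=\min_{j\in B_i}p_j$. Go through the nonempty blocks in increasing order of $i$; for each, assign its jobs by a map $\sigma_i\colon B_i\to M$ that minimizes $\sum_{q\in M}\max\{\hat c_q,\sum_{j\in\sigma_i^{-1}(q)}\hat p_j\}$, where $\hat c_q=\max\{c_q-\sum\hat p_j,0\}$ and the sum is over the jobs of earlier blocks that were assigned to $q$. Finally put all the jobs of $G_t$ on one arbitrary machine. The map $\sigma_i$ is computed by the dynamic program over machines and job-type counts: if $a_1,\dots,a_k$ are the distinct values of $\hat p$ on $B_i$ and $n_l$ is the number of jobs of $B_i$ with $\hat p_j=a_l$, then for integer vectors $0\le x\le(n_1,\dots,n_k)$ one computes $W(0,0)=0$, $W(0,x)=\infty$ for $x\ne 0$, and $W(s,x)=\min_{0\le y\le x}\bigl(W(s-1,x-y)+\max\{\sum_l y_l a_l,\hat c_s\}\bigr)$, where $s=1,\dots,m$ runs through the machines. Running time is the number of steps of an explicit implementation of this algorithm on real numbers, natural numbers and linked lists, in which each arithmetic operation, comparison, ceiling, floor of a logarithm and elementary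 list operation costs one step. **Theorem.** There is an absolute constant $C>0$ such that for every $0<\varepsilon\le 1/2$ and every instance with $n\ge 0$ jobs and $m\ge 1$ machines: 1. however the choices that the algorithm leaves open are made, the schedule that PTAS-Approx produces is $(1+5\varepsilon)$-approximate; 2. the implementation outputs a schedule that PTAS-Approx can produce, which is thus $(1+5\varepsilon)$-approximate, after at most $m\cdot\max\{n,2\}^{\,C\cdot\frac1\varepsilon\log_{1+\varepsilon}\frac1\varepsilon}$ steps. Consequently the problem admits a PTAS: for every $\delta>0$ there are $\varepsilon\in(0,1/2]$ and $d\in\mathbb N$ such that on every instance with $m\ge1$ the implementation, run with the parameter $\varepsilon$, outputs a $(1+\delta)$-approximate schedule after at most $m\cdot\max\{n,2\}^d$ steps. -/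

import Mathlib

noncomputable section

namespace BAF

/-! ## The problem -/

/-- An instance `(J, M, p, c)` of base-and-additional-fee job scheduling: processing times `p`
of the jobs and base operation times (capacities) `c` of the machines, all positive. -/
structure Problem (J M : Type) where
  p : J → ℝ
  c : M → ℝ
  p_pos : ∀ j, 0 < p j
  c_pos : ∀ q, 0 < c q

section Problem

variable {J M : Type} [Fintype J] [Fintype M] [DecidableEq M]

/-- Total working time of the schedule `σ` when only the jobs in `S` are scheduled, with
processing times `p` and base operation times `c`. -/
def workingTime (S : Finset J) (p : J → ℝ) (c : M → ℝ) (σ : J → M) : ℝ :=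
  ∑ q, max (∑ j ∈ S with σ j = q, p j) (c q)

/-- The objective `T_Ψ(σ)`. -/
def Problem.cost (Ψ : Problem J M) (σ : J → M) : ℝ :=
  workingTime Finset.univ Ψ.p Ψ.c σ

/-- `σ` is a `ρ`-approximate schedule: its cost is at most `ρ` times that of every schedule. -/
def Problem.IsApprox (Ψ : Problem J M) (ρ : ℝ) (σ : J → M) : Prop :=
  ∀ τ : J → M, Ψ.cost σ ≤ ρ * Ψ.cost τ

/-! ## PTAS-Approx as a (nondeterministic) algorithm

The lines of the algorithm that leave a choice (a minimizing class, an optimal schedule of a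
rounded block, the machine that receives the discarded jobs) are left open here: a schedule is a
possible output if it results from some way of making these choices. -/

/-- `p_max`, the scale of the layers (they are stated for instances normalized to `p_max = 1`). -/
def pmax (Ψ : Problem J M) : ℝ := sSup (Set.range Ψ.p)

/-- Job `j` belongs to the layer `I(i)`: `ε ^ (i + 1) < p j / p_max ≤ ε ^ i`. -/
def InLayer (Ψ : Problem J M) (ε : ℝ) (i : ℕ) (j : J) : Prop :=
  ε ^ (i + 1) < Ψ.p j / pmax Ψ ∧ Ψ.p j / pmax Ψ ≤ ε ^ i

/-- `K = ⌈1 / ε⌉`. -/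
def numClasses (ε : ℝ) : ℕ := ⌈1 / ε⌉₊

open Classical in
/-- The jobs of the class `G_i`, the union of the layers whose index is `i` modulo `K`. -/
def classJobs (Ψ : Problem J M) (ε : ℝ) (i : ℕ) : Finset J :=
  {j | ∃ l, l ≡ i [MOD numClasses ε] ∧ InLayer Ψ ε l j}

open Classical in
/-- The block `B_i` for the gap class `t`: the layers `0, …, t - 1` for `i = 0`, and the layers
`(i - 1) * K + i' + t` with `0 < i' < K` for `i > 0`. -/
def block (Ψ : Problem J M) (ε : ℝ) (t : ℕ) : ℕ → Finset J
  | 0 => {j | ∃ l < t, InLayer Ψ ε l j}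
  | i + 1 => {j | ∃ l, 0 < l ∧ l < numClasses ε ∧ InLayer Ψ ε (i * numClasses ε + l + t) j}

/-- The smallest processing time in `S`. -/
def pmin (p : J → ℝ) (S : Finset J) : ℝ := sInf (p '' (S : Set J))

/-- The processing times rounded down to `p_min(S) * (1 + ε) ^ k` with
`k = ⌊log_{1+ε} (p j / p_min(S))⌋`, for the jobs of `S`. -/
def rounded (p : J → ℝ) (ε : ℝ) (S : Finset J) (j : J) : ℝ :=
  pmin p S * (1 + ε) ^ ⌊Real.logb (1 + ε) (p j / pmin p S)⌋₊

/-- The residual capacity of machine `q` before block `i` is scheduled, when the earlier blocks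
are scheduled as in `σ`. -/
def residual (Ψ : Problem J M) (ε : ℝ) (t : ℕ) (σ : J → M) (i : ℕ) (q : M) : ℝ :=
  max (Ψ.c q - ∑ k ∈ Finset.range i,
    ∑ j ∈ block Ψ ε t k with σ j = q, rounded Ψ.p ε (block Ψ ε t k) j) 0

/-- `σ` is a possible output of PTAS-Approx: for a lightest class `G_t`, each block is scheduled
optimally with respect to its rounded processing times and the residual capacities left by the
earlier blocks, and all the jobs of `G_t` are put on a single machine. -/
def IsPTASOutput (Ψ : Problem J M) (ε : ℝ) (σ : J → M) : Prop :=
  ∃ t < numClasses ε,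
    (∀ i < numClasses ε, ∑ j ∈ classJobs Ψ ε t, Ψ.p j ≤ ∑ j ∈ classJobs Ψ ε i, Ψ.p j) ∧
    (∀ (i : ℕ) (τ : J → M),
      workingTime (block Ψ ε t i) (rounded Ψ.p ε (block Ψ ε t i)) (residual Ψ ε t σ i) σ ≤
      workingTime (block Ψ ε t i) (rounded Ψ.p ε (block Ψ ε t i)) (residual Ψ ε t σ i) τ) ∧
    ∃ q, ∀ j ∈ classJobs Ψ ε t, σ j = q

end Problem

/-! ## Computations with a step count

Unit-cost model on real and natural numbers and linked lists: one step is charged for each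
arithmetic operation, comparison, floor of a logarithm, ceiling, and conversion, and at least one
for each recursive call and for each cell visited or created in a traversal of a list. Job and
machine labels are opaque and are only copied. -/

/-- The result of a computation together with the number of elementary steps it takes. -/
structure Timed (α : Type) where
  val : α
  steps : ℕ

instance : Monad Timed where
  pure a := ⟨a, 0⟩
  bind x f := ⟨(f x.val).val, x.steps + (f x.val).steps⟩

/-- One elementary step with result `a`. -/
def step {α : Type} (a : α) : Timed α := ⟨a, 1⟩

/-! ### Elementary operations -/

def addR (x y : ℝ) : Timed ℝ := step (x + y)
def subR (x y : ℝ) : Timed ℝ := step (x - y)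
def mulR (x y : ℝ) : Timed ℝ := step (x * y)
def divR (x y : ℝ) : Timed ℝ := step (x / y)
def leR (x y : ℝ) : Timed Bool := step (decide (x ≤ y))
def eqR (x y : ℝ) : Timed Bool := step (decide (x = y))
def floorLog (b x : ℝ) : Timed ℕ := step ⌊Real.logb b x⌋₊
def ceilR (x : ℝ) : Timed ℕ := step ⌈x⌉₊
def castN (k : ℕ) : Timed ℝ := step (k : ℝ)
def addN (a b : ℕ) : Timed ℕ := step (a + b)
def subN (a b : ℕ) : Timed ℕ := step (a - b)
def divN (a b : ℕ) : Timed ℕ := step (a / b)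
def modN (a b : ℕ) : Timed ℕ := step (a % b)
def leN (a b : ℕ) : Timed Bool := step (decide (a ≤ b))
def eqN (a b : ℕ) : Timed Bool := step (decide (a = b))

/-! ### Derived operations -/

def maxR (x y : ℝ) : Timed ℝ := do
  if ← leR x y then step y else step x

def minR (x y : ℝ) : Timed ℝ := do
  if ← leR x y then step x else step y

/-- `x ^ k` by repeated multiplication. -/
def powR (x : ℝ) : ℕ → Timed ℝ
  | 0 => step 1
  | k + 1 => do
    let y ← powR x k
    mulR y x

/-- The list `[k - 1, …, 1, 0]`. -/
def rangeT : ℕ → Timed (List ℕ)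
  | 0 => step []
  | k + 1 => do
    let l ← rangeT k
    step (k :: l)

def foldT {α β : Type} (f : α → β → Timed β) (b : β) : List α → Timed β
  | [] => step b
  | a :: l => do
    let r ← foldT f b l
    let s ← f a r
    step s

def mapT {α β : Type} (f : α → Timed β) : List α → Timed (List β)
  | [] => step []
  | a :: l => do
    let b ← f a
    let r ← mapT f l
    step (b :: r)

def appendT {α : Type} : List α → List α → Timed (List α)
  | [], l₂ => step l₂
  | a :: l₁, l₂ => do
    let r ← appendT l₁ l₂
    step (a :: r)

def lengthT {α : Type} : List α → Timed ℕ
  | [] => step 0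
  | _ :: l => do
    let k ← lengthT l
    addN k 1

/-- The first `k` elements of a list, and the others. -/
def splitT {α : Type} : ℕ → List α → Timed (List α × List α)
  | k + 1, a :: l => do
    let r ← splitT k l
    step (a :: r.1, r.2)
  | _, l => step ([], l)

/-! ## The rounding procedure RD -/

section Algorithm

variable {J M : Type}

/-- RD: jobs are given with their processing times, and returned with the rounded ones. -/
def roundDown (ε : ℝ) : List (J × ℝ) → Timed (List (J × ℝ))
  | [] => step []
  | a :: l => do
    let m ← foldT (fun b r => minR b.2 r) a.2 l
    let base ← addR 1 ε
    mapT (fun b => do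
      let x ← divR b.2 m
      let k ← floorLog base x
      let y ← powR base k
      let z ← mulR m y
      step (b.1, z)) (a :: l)

/-! ## The dynamic program DP

A configuration is a list `q` of numbers, the number of jobs of each type. -/

/-- Adds a job to the list of types, each given by its processing time and its jobs. -/
def insertType (a : J × ℝ) : List (ℝ × List J) → Timed (List (ℝ × List J))
  | [] => step [(a.2, [a.1])]
  | g :: gs => do
    if ← eqR a.2 g.1 then
      step ((g.1, a.1 :: g.2) :: gs)
    else
      let r ← insertType a gs
      step (g :: r)

/-- All the configurations bounded by the given numbers. -/
def configs : List ℕ → Timed (List (List ℕ))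
  | [] => step [[]]
  | k :: ks => do
    let Q ← configs ks
    let k₁ ← addN k 1
    let range ← rangeT k₁
    foldT (fun x acc => do
      let l ← mapT (fun q => step (x :: q)) Q
      appendT l acc) [] range

def isZeroConfig : List ℕ → Timed Bool
  | [] => step true
  | a :: l => do
    if ← eqN a 0 then isZeroConfig l else step false

def eqConfig : List ℕ → List ℕ → Timed Bool
  | [], [] => step true
  | a :: l₁, b :: l₂ => do
    if ← eqN a b then eqConfig l₁ l₂ else step false
  | _, _ => step false

def leConfig : List ℕ → List ℕ → Timed Bool
  | a :: l₁, b :: l₂ => do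
    if ← leN a b then leConfig l₁ l₂ else step false
  | _, _ => step true

def subConfig : List ℕ → List ℕ → Timed (List ℕ)
  | a :: l₁, b :: l₂ => do
    let d ← subN a b
    let r ← subConfig l₁ l₂
    step (d :: r)
  | _, _ => step []

/-- The total processing time `∑ q_l * a_l` of a configuration. -/
def loadConfig : List ℕ → List ℝ → Timed ℝ
  | k :: q, a :: as => do
    let x ← castN k
    let y ← mulR x a
    let r ← loadConfig q as
    addR y r
  | _, _ => step 0

/-- A row `W(i, ·)` of the table. The entry of a configuration is `none` for the value `∞`, and
otherwise consists of the value and of the configurations that the machines receive. -/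
abbrev Row : Type := List (List ℕ × Option (ℝ × List (List ℕ)))

def lookupRow (q : List ℕ) : Row → Timed (Option (ℝ × List (List ℕ)))
  | [] => step none
  | e :: row => do
    if ← eqConfig q e.1 then step e.2 else lookupRow q row

/-- `W(0, ·)`. -/
def firstRow (Q : List (List ℕ)) : Timed Row :=
  mapT (fun q => do
    if ← isZeroConfig q then step (q, some (0, [])) else step (q, none)) Q

/-- The row `W(i, ·)` from the row `W(i - 1, ·)`, for a machine of capacity `c`:
`W(i, q) = min_{r ≤ q} W(i - 1, q - r) + max (∑ r_l * a_l) c`. -/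
def nextRow (Q : List (List ℕ)) (as : List ℝ) (c : ℝ) (prev : Row) : Timed Row :=
  mapT (fun q => do
    let best ← foldT (fun r best => do
      if ← leConfig r q then
        let d ← subConfig q r
        let w ← lookupRow d prev
        match w, best with
        | none, best => step best
        | some w, none => do
          let x ← loadConfig r as
          let y ← maxR x c
          let z ← addR w.1 y
          step (some (z, r :: w.2))
        | some w, some b => do
          let x ← loadConfig r as
          let y ← maxR x c
          let z ← addR w.1 y
          if ← leR z b.1 then step (some (z, r :: w.2)) else step (some b)
      else step best) none Q
    step (q, best)) Q

/-- The last row of the table for a list of machine capacities. -/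
def lastRow (Q : List (List ℕ)) (as : List ℝ) : List ℝ → Timed Row
  | [] => firstRow Q
  | c :: cs => do
    let prev ← lastRow Q as cs
    nextRow Q as c prev

/-- Picks the jobs of a configuration; returns them, and the types with the other jobs. -/
def takeConfig : List ℕ → List (ℝ × List J) → Timed (List (J × ℝ) × List (ℝ × List J))
  | k :: q, g :: gs => do
    let s ← splitT k g.2
    let l ← mapT (fun j => step (j, g.1)) s.1
    let r ← takeConfig q gs
    let l₁ ← appendT l r.1
    step (l₁, (g.1, s.2) :: r.2)
  | _, gs => step ([], gs)

/-- The jobs of every machine, from the configurations of the machines. -/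
def distribute : List (List ℕ) → List (ℝ × List J) → Timed (List (List (J × ℝ)))
  | [], _ => step []
  | q :: qs, gs => do
    let r ← takeConfig q gs
    let l ← distribute qs r.2
    step (r.1 :: l)

/-- DP: from the jobs with their processing times and the list of machine capacities, the list of
the jobs of every machine in an optimal schedule. -/
def dynProg (jobs : List (J × ℝ)) (caps : List ℝ) : Timed (List (List (J × ℝ))) := do
  let types ← foldT insertType [] jobs
  let as ← mapT (fun g => step g.1) types
  let counts ← mapT (fun g => lengthT g.2) types
  let Q ← configs counts
  let row ← lastRow Q as caps
  let w ← lookupRow counts row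
  match w with
  | none => step []
  | some w => distribute w.2 types

/-! ## Almost-QPTAS and PTAS-Approx -/

/-- Almost-QPTAS; the jobs are returned with their rounded processing times. -/
def almostQPTAS (ε : ℝ) (jobs : List (J × ℝ)) (caps : List ℝ) :
    Timed (List (List (J × ℝ))) := do
  let rd ← roundDown ε jobs
  dynProg rd caps

/-- The working schedule: the machines with their capacities and with the jobs assigned so far,
together with the rounded processing times of these. -/
abbrev WorkingSchedule (J M : Type) : Type := List (M × ℝ × List (J × ℝ))

/-- The residual capacity of a machine. -/
def residualCap (s : M × ℝ × List (J × ℝ)) : Timed ℝ := do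
  let x ← foldT (fun a r => addR a.2 r) 0 s.2.2
  let d ← subR s.2.1 x
  maxR d 0

/-- Adds newly assigned jobs to the working schedule. -/
def mergeT : List (List (J × ℝ)) → WorkingSchedule J M → Timed (WorkingSchedule J M)
  | l :: ls, s :: σ => do
    let js ← appendT l s.2.2
    let r ← mergeT ls σ
    step ((s.1, s.2.1, js) :: r)
  | _, σ => step σ

/-- The main loop over the nonempty blocks, given in increasing order of their indices. -/
def scheduleBlocks (ε : ℝ) :
    List (ℕ × List (J × ℝ)) → WorkingSchedule J M → Timed (WorkingSchedule J M)
  | [], σ => step σ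
  | b :: bs, σ => do
    let caps ← mapT residualCap σ
    let new ← almostQPTAS ε b.2 caps
    let σ₁ ← mergeT new σ
    scheduleBlocks ε bs σ₁

/-- The total processing time of the class `G_i`, for jobs given with the index of their layer. -/
def classWeight (K : ℕ) (jobs : List (ℕ × J × ℝ)) (i : ℕ) : Timed ℝ :=
  foldT (fun a r => do
    let x ← modN a.1 K
    if ← eqN x i then addR a.2.2 r else step r) 0 jobs

/-- An index `i < K` of a class of minimum total processing time. -/
def lightestClass (K : ℕ) (jobs : List (ℕ × J × ℝ)) : Timed ℕ := do
  let range ← rangeT K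
  let best ← foldT (fun i (best : Option (ℕ × ℝ)) => do
    let w ← classWeight K jobs i
    match best with
    | none => step (some (i, w))
    | some b => do
      if ← leR w b.2 then step (some (i, w)) else step (some b)) none range
  match best with
  | none => step 0
  | some b => step b.1

/-- The index of the block that contains the layer `l`, for `l` not congruent to `t` modulo `K`. -/
def blockIndex (K t l : ℕ) : Timed ℕ := do
  if ← leN t l then
    let x ← subN l t
    let y ← divN x K
    addN y 1
  else step 0

/-- Adds a job to block `i` in the ordered list of the nonempty blocks. -/
def insertBlock (i : ℕ) (a : J × ℝ) :
    List (ℕ × List (J × ℝ)) → Timed (List (ℕ × List (J × ℝ)))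
  | [] => step [(i, [a])]
  | b :: bs => do
    if ← eqN i b.1 then
      step ((b.1, a :: b.2) :: bs)
    else if ← leN i b.1 then
      step ((i, [a]) :: b :: bs)
    else
      let r ← insertBlock i a bs
      step (b :: r)

/-- Splits the jobs into the discarded class `G_t` and the nonempty blocks. -/
def splitJobs (K t : ℕ) (jobs : List (ℕ × J × ℝ)) :
    Timed (List (J × ℝ) × List (ℕ × List (J × ℝ))) :=
  foldT (fun a r => do
    let x ← modN a.1 K
    if ← eqN x t then
      step (a.2 :: r.1, r.2)
    else
      let i ← blockIndex K t a.1
      let bs ← insertBlock i a.2 r.2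
      step (r.1, bs)) ([], []) jobs

/-- Puts the given jobs on the first machine. -/
def placeOnFirst (jobs : List (J × ℝ)) : WorkingSchedule J M → Timed (WorkingSchedule J M)
  | [] => step []
  | s :: σ => do
    let js ← appendT jobs s.2.2
    step ((s.1, s.2.1, js) :: σ)

/-- The list of the pairs of a job and its machine. -/
def listPairs (σ : WorkingSchedule J M) : Timed (List (J × M)) :=
  foldT (fun s acc => do
    let l ← mapT (fun a => step (a.1, s.1)) s.2.2
    appendT l acc) [] σ

/-- PTAS-Approx, for the list of the jobs with their processing times and the list of the machines
with their capacities. -/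
def ptasApprox (ε : ℝ) (jobs : List (J × ℝ)) (machines : List (M × ℝ)) :
    Timed (List (J × M)) := do
  let top ← foldT (fun a r => maxR a.2 r) 0 jobs
  let inv ← divR 1 ε
  let K ← ceilR inv
  let layered ← mapT (fun a => do
    let x ← divR a.2 top
    let l ← floorLog ε x
    step (l, a)) jobs
  let t ← lightestClass K layered
  let parts ← splitJobs K t layered
  let σ₀ ← mapT (fun q => step (q.1, q.2, [])) machines
  let σ₁ ← scheduleBlocks ε parts.2 σ₀
  let σ₂ ← placeOnFirst parts.1 σ₁
  listPairs σ₂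

end Algorithm

/-- The run of PTAS-Approx on an instance with jobs `0, …, n - 1` and machines `0, …, m - 1`. -/
def runPTAS {n m : ℕ} (Ψ : Problem (Fin n) (Fin m)) (ε : ℝ) : Timed (List (Fin n × Fin m)) :=
  ptasApprox ε (List.ofFn fun j => (j, Ψ.p j)) (List.ofFn fun q => (q, Ψ.c q))

/-- The list `out` is the table of the schedule `σ`: it lists each job `j` once, with `σ j`. -/
def IsTableOf {n m : ℕ} (out : List (Fin n × Fin m)) (σ : Fin n → Fin m) : Prop :=
  out.Perm (List.ofFn fun j => (j, σ j))

end BAF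

end

namespace BAF

/-! Approximation. Compare the output `σ` with an arbitrary `τ`. The classes partition the jobs and
there are at least `1 / ε` of them, so the lightest one carries at most an `ε`-fraction of the total
processing time, which is a lower bound for every cost (`sum_classJobs_le`, `sum_p_le_cost`).
Rounding costs a factor `1 + ε`. What remains is the price of scheduling the blocks greedily, and it
is paid by an exchange argument (`exists_exchange`, iterated in `exists_agree_on_firstBlocks`): `τ`
is made to agree with `σ` block by block. Because of the residual capacities, an optimal schedule of
a block `B` is an optimal extension of what is already fixed (`workingTime_union_le`). Replacing `τ`
by `σ` on `B` affects at most `2 * |B|` machines. The later jobs on these machines are list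
scheduled anew: either every machine exceeds its residual capacity by at most one job, or all of
them are filled and the cost there is just the unchanged total load. The discarded layer between
blocks makes a later job at most `ε` times the shortest job of `B`, so the loss is at most `2 * ε`
times the rounded length of `B`, and over all blocks `2 * ε` times the cost of `τ`. Altogether `(1 +
ε) * (1 + 2 * ε) + ε ≤ 1 + 5 * ε`.

Running time. A block spans fewer than `K` layers, so its times differ by a factor of at most `(1 /
ε) ^ (K - 1)` and round to at most `P + 1` values, where `P` is the floor of `1 / ε * log_{1+ε} (1 /
ε)`. Hence there are at most `(n + 1) ^ (P + 1)` configurations (`prod_typesOf_le`), and the dynamic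
program is polynomial in this number (`dynProg_steps_le`).

Implementation. The dynamic program is correct by the Bellman recursion (`isEntry_cons`,
`exists_lastRow_eq`, `dynProg_spec`). The loop over the blocks keeps a working schedule that
represents a map from jobs to machines (`scheduleBlocks_spec`), and `runPTAS_spec_of_bound`
identifies the lists of the program with the sets in the definition of the algorithm. -/

lemma sum_sub_sum_of_eq_off {M : Type} [Fintype M] {f g : M → ℝ} {D : Finset M} (h : ∀ q ∉ D, f q = g q) :
    ∑ q, f q - ∑ q, g q = ∑ q ∈ D, f q - ∑ q ∈ D, g q := by
  classical
  rw [← Finset.sum_sub_distrib, ← Finset.sum_sub_distrib]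
  exact (Finset.sum_subset (Finset.subset_univ D) fun q _ hq => by rw [h q hq, sub_self]).symm

/-! ### Loads of machines and the exchange argument. -/

section Load

variable {J M : Type} [DecidableEq M]

/-- The total processing time that `σ` puts on machine `q`, among the jobs of `S`. -/
def load (S : Finset J) (p : J → ℝ) (σ : J → M) (q : M) : ℝ :=
  ∑ j ∈ S with σ j = q, p j

lemma load_congr {S : Finset J} {p : J → ℝ} {σ τ : J → M} (h : ∀ j ∈ S, σ j = τ j) (q : M) :
    load S p σ q = load S p τ q := by
  unfold load
  rw [Finset.filter_congr fun j hj => by rw [h j hj]]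

lemma load_congr_time {S : Finset J} {p p' : J → ℝ} (σ : J → M) (h : ∀ j ∈ S, p j = p' j)
    (q : M) : load S p σ q = load S p' σ q :=
  Finset.sum_congr rfl fun j hj => h j (Finset.mem_filter.1 hj).1

lemma load_nonneg {S : Finset J} {p : J → ℝ} (hp : ∀ j ∈ S, 0 ≤ p j) (σ : J → M) (q : M) :
    0 ≤ load S p σ q :=
  Finset.sum_nonneg fun j hj => hp j (Finset.mem_filter.1 hj).1

lemma load_union [DecidableEq J] {A B : Finset J} (h : Disjoint A B) (p : J → ℝ) (σ : J → M)
    (q : M) : load (A ∪ B) p σ q = load A p σ q + load B p σ q := by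
  unfold load
  rw [Finset.filter_union, Finset.sum_union (Finset.disjoint_filter_filter h)]

lemma load_eq_zero {S : Finset J} (p : J → ℝ) {σ : J → M} {q : M} (h : ∀ j ∈ S, σ j ≠ q) :
    load S p σ q = 0 := by
  unfold load
  rw [Finset.filter_false_of_mem h, Finset.sum_empty]

lemma sum_load_of_maps_to {S : Finset J} (p : J → ℝ) {σ : J → M} {D : Finset M}
    (h : ∀ j ∈ S, σ j ∈ D) : ∑ q ∈ D, load S p σ q = ∑ j ∈ S, p j :=
  Finset.sum_fiberwise_of_maps_to h p

lemma load_insert [DecidableEq J] {S : Finset J} {a : J} (ha : a ∉ S) (p : J → ℝ) (σ : J → M)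
    (q : M) : load (insert a S) p σ q = (if σ a = q then p a else 0) + load S p σ q := by
  unfold load
  rw [Finset.sum_filter, Finset.sum_insert ha, Finset.sum_filter]

/-- List scheduling of jobs of size at most `δ` on the machines of `D` with capacities `r`. -/
lemma exists_list_schedule {D : Finset M} (hD : D.Nonempty) (S : Finset J) {p : J → ℝ} {δ : ℝ}
    (hδ₀ : 0 ≤ δ) (hp : ∀ j ∈ S, 0 ≤ p j) (hδ : ∀ j ∈ S, p j ≤ δ) (r : M → ℝ)
    (hr : ∀ q, 0 ≤ r q) :
    ∃ ρ : J → M, (∀ j, ρ j ∈ D) ∧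
      ((∀ q ∈ D, load S p ρ q ≤ r q + δ) ∨ ∀ q ∈ D, r q ≤ load S p ρ q) := by
  classical
  induction S using Finset.induction_on with
  | empty =>
    obtain ⟨q, hq⟩ := hD
    refine ⟨fun _ => q, fun _ => hq, Or.inl fun q' _ => ?_⟩
    have := hr q'
    simp only [load, Finset.filter_empty, Finset.sum_empty]
    linarith
  | insert a S ha ih =>
    obtain ⟨ρ, hρ, h⟩ := ih (fun j hj => hp j (Finset.mem_insert_of_mem hj))
      (fun j hj => hδ j (Finset.mem_insert_of_mem hj))
    have hpa := hp a (Finset.mem_insert_self _ _)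
    have hδa := hδ a (Finset.mem_insert_self _ _)
    have upd : ∀ (x q : M), load S p (Function.update ρ a x) q = load S p ρ q := by
      refine fun x q => load_congr (σ := Function.update ρ a x) (fun j hj => ?_) q
      exact Function.update_of_ne (ne_of_mem_of_not_mem hj ha) _ _
    -- Once all capacities are reached they stay reached, wherever the new job goes. Otherwise it
    -- goes to a machine still below its capacity, which ends at most `δ` above.
    by_cases hall : ∀ q ∈ D, r q ≤ load S p ρ q
    · refine ⟨ρ, hρ, Or.inr fun q hq => ?_⟩
      rw [load_insert ha]
      have := hall q hq
      split_ifs <;> linarith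
    · have h₁ := h.resolve_right hall
      push Not at hall
      obtain ⟨x, hx, hlt⟩ := hall
      refine ⟨Function.update ρ a x, fun j => ?_, Or.inl fun q hq => ?_⟩
      · by_cases hj : j = a
        · subst hj; simpa using hx
        · simpa [hj] using hρ j
      · rw [load_insert ha, upd, Function.update_self]
        have := h₁ q hq
        split_ifs with hxq
        · subst hxq; linarith
        · linarith

/-- This lemma and the next read off the working time from the two alternatives of
`exists_list_schedule`, with `a` the fixed load, `b` the load of the later jobs and `c` the
capacity. -/
lemma max_add_le_of_le_residual {a b c d : ℝ} (h : b ≤ max (c - a) 0 + d) :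
    max (a + b) c ≤ max a c + max d 0 := by
  grind

lemma le_add_of_residual_le {a b c : ℝ} (h : max (c - a) 0 ≤ b) : c ≤ a + b := by
  linarith [le_max_left (c - a) 0]

/-- This is why residual capacities are the right ones: the working time of old and new jobs
together is the objective of the new block plus a constant, the old load. -/
lemma max_add_residual {a b c : ℝ} (hb : 0 ≤ b) :
    max (a + b) c = a + max b (max (c - a) 0) := by
  grind

variable [Fintype M]

lemma workingTime_eq (S : Finset J) (p : J → ℝ) (c : M → ℝ) (σ : J → M) :
    workingTime S p c σ = ∑ q, max (load S p σ q) (c q) := rfl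

lemma workingTime_congr_time {S : Finset J} {p p' : J → ℝ} (c : M → ℝ) (σ : J → M)
    (h : ∀ j ∈ S, p j = p' j) : workingTime S p c σ = workingTime S p' c σ := by
  simp only [workingTime_eq, load_congr_time σ h]

lemma workingTime_congr {S : Finset J} (p : J → ℝ) (c : M → ℝ) {σ τ : J → M}
    (h : ∀ j ∈ S, σ j = τ j) : workingTime S p c σ = workingTime S p c τ := by
  simp only [workingTime_eq, load_congr h]

/-- An optimal schedule of `B` for the capacities left by `A` is an optimal extension. -/
lemma workingTime_union_le [DecidableEq J] {A B : Finset J} (hAB : Disjoint A B) {p : J → ℝ}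
    (hp : ∀ j, 0 ≤ p j) {c : M → ℝ} {σ τ : J → M} (hτ : ∀ j ∈ A, τ j = σ j)
    (h : workingTime B p (fun q => max (c q - load A p σ q) 0) σ ≤
      workingTime B p (fun q => max (c q - load A p σ q) 0) τ) :
    workingTime (A ∪ B) p c σ ≤ workingTime (A ∪ B) p c τ := by
  simp only [workingTime_eq] at h ⊢
  have e₁ : ∀ q, max (load (A ∪ B) p σ q) (c q) = load A p σ q +
      max (load B p σ q) (max (c q - load A p σ q) 0) := fun q => by
    rw [load_union hAB, max_add_residual (load_nonneg (fun j _ => hp j) _ _)]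
  have e₂ : ∀ q, max (load (A ∪ B) p τ q) (c q) = load A p σ q +
      max (load B p τ q) (max (c q - load A p σ q) 0) := fun q => by
    rw [load_union hAB, load_congr hτ, max_add_residual (load_nonneg (fun j _ => hp j) _ _)]
  simp only [e₁, e₂, Finset.sum_add_distrib]
  linarith

/-- If `σ` and `τ` agree on `A`, and `σ` is at least as good as `τ` on `A ∪ B`, then `τ` can be
made to agree with `σ` on `A ∪ B` at the price of `2 * |B|` times the largest later job. -/
lemma exists_exchange [DecidableEq J] {A B C : Finset J} (hAB : Disjoint A B)
    (hC : Disjoint (A ∪ B) C) (hB : B.Nonempty) {p : J → ℝ} (hp : ∀ j, 0 ≤ p j) {δ : ℝ}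
    (hδ₀ : 0 ≤ δ) (hδ : ∀ j ∈ C, p j ≤ δ) {c : M → ℝ} {σ τ : J → M} (hτ : ∀ j ∈ A, τ j = σ j)
    (h : workingTime (A ∪ B) p c σ ≤ workingTime (A ∪ B) p c τ) :
    ∃ τ' : J → M, (∀ j ∈ A ∪ B, τ' j = σ j) ∧
      workingTime (A ∪ B ∪ C) p c τ' ≤ workingTime (A ∪ B ∪ C) p c τ + 2 * B.card * δ := by
  -- The machines that receive a job of `B` in either schedule; on all others the loads of `A ∪ B`
  -- agree.
  set D : Finset M := B.image σ ∪ B.image τ with hDdef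
  have hD : D.Nonempty := (hB.image σ).mono Finset.subset_union_left
  have hcard : (D.card : ℝ) ≤ 2 * B.card := by
    have h₁ : D.card ≤ B.card + B.card := (Finset.card_union_le _ _).trans
      (Nat.add_le_add Finset.card_image_le Finset.card_image_le)
    have h₂ : (D.card : ℝ) ≤ B.card + B.card := by exact_mod_cast h₁
    linarith
  obtain ⟨ρ, hρD, hρ⟩ := exists_list_schedule hD (C.filter fun j => τ j ∈ D) hδ₀
    (fun j _ => hp j) (fun j hj => hδ j (Finset.mem_filter.1 hj).1)
    (fun q => max (c q - load (A ∪ B) p σ q) 0) (fun q => le_max_right _ _)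
  -- Later jobs that `τ` puts outside `D` stay there; those on `D` are list scheduled again within
  -- `D`.
  let τ' : J → M := fun j => if j ∈ A ∪ B then σ j else if τ j ∈ D then ρ j else τ j
  have hτ'AB : ∀ j ∈ A ∪ B, τ' j = σ j := fun j hj => if_pos hj
  have hτ'C : ∀ j ∈ C, τ' j = if τ j ∈ D then ρ j else τ j := fun j hj =>
    if_neg fun hj' => Finset.disjoint_left.1 hC hj' hj
  refine ⟨τ', hτ'AB, ?_⟩
  have hoffL : ∀ q ∉ D, load (A ∪ B) p σ q = load (A ∪ B) p τ q := fun q hq => by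
    rw [load_union hAB, load_union hAB, load_congr hτ, load_eq_zero p (S := B) (σ := σ),
      load_eq_zero p (S := B) (σ := τ)]
    · rintro j hj rfl
      exact hq (Finset.mem_union_right _ (Finset.mem_image_of_mem _ hj))
    · rintro j hj rfl
      exact hq (Finset.mem_union_left _ (Finset.mem_image_of_mem _ hj))
  have hoffY : ∀ q ∉ D, load C p τ' q = load C p τ q := fun q hq => by
    unfold load
    refine Finset.sum_congr (Finset.filter_congr fun j hj => ?_) fun _ _ => rfl
    rw [hτ'C j hj]
    split_ifs with hjD
    · exact ⟨fun e => absurd (hρD j) (e ▸ hq), fun e => absurd hjD (e ▸ hq)⟩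
    · rfl
  have honY : ∀ q ∈ D, load C p τ' q = load (C.filter fun j => τ j ∈ D) p ρ q := fun q hq => by
    unfold load
    rw [Finset.filter_filter]
    refine Finset.sum_congr (Finset.filter_congr fun j hj => ?_) fun _ _ => rfl
    rw [hτ'C j hj]
    split_ifs with hjD
    · simp [hjD]
    · exact ⟨fun e => absurd hq (e ▸ hjD), fun e => absurd e.1 hjD⟩
  have honY₂ : ∀ q ∈ D, load C p τ q = load (C.filter fun j => τ j ∈ D) p τ q := fun q hq => by
    unfold load
    rw [Finset.filter_filter]
    exact Finset.sum_congr (Finset.filter_congr fun j hj => ⟨fun e => ⟨e ▸ hq, e⟩, fun e => e.2⟩)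
      fun _ _ => rfl
  have hsumY : ∑ q ∈ D, load C p τ' q = ∑ q ∈ D, load C p τ q := by
    rw [Finset.sum_congr rfl honY, Finset.sum_congr rfl honY₂,
      sum_load_of_maps_to p fun j _ => hρD j,
      sum_load_of_maps_to p fun j hj => (Finset.mem_filter.1 hj).2]
  -- Both schedules distribute the same total of `A ∪ B` and agree off `D`, so the totals on `D`
  -- agree as well.
  have hsumL : ∑ q ∈ D, load (A ∪ B) p σ q = ∑ q ∈ D, load (A ∪ B) p τ q := by
    have e : ∑ q, load (A ∪ B) p σ q = ∑ q, load (A ∪ B) p τ q := by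
      rw [sum_load_of_maps_to p fun j _ => Finset.mem_univ _,
        sum_load_of_maps_to p fun j _ => Finset.mem_univ _]
    linarith [sum_sub_sum_of_eq_off hoffL]
  have hopt : ∑ q ∈ D, max (load (A ∪ B) p σ q) (c q) ≤
      ∑ q ∈ D, max (load (A ∪ B) p τ q) (c q) := by
    rw [workingTime_eq, workingTime_eq] at h
    linarith [sum_sub_sum_of_eq_off (D := D) (f := fun q => max (load (A ∪ B) p σ q) (c q))
      (g := fun q => max (load (A ∪ B) p τ q) (c q)) fun q hq => by rw [hoffL q hq]]
  have hY₀ : ∀ q, 0 ≤ load C p τ q := load_nonneg (fun j _ => hp j) τ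
  have hon : ∑ q ∈ D, max (load (A ∪ B) p σ q + load C p τ' q) (c q) ≤
      ∑ q ∈ D, max (load (A ∪ B) p τ q + load C p τ q) (c q) + D.card * δ := by
    -- In the first alternative each machine of `D` pays at most `δ` beyond its working time for `A
    -- ∪ B`, and there `σ` is at least as good as `τ`. In the second no machine of `D` idles, so its
    -- cost is the total load, which is the same as under `τ`.
    rcases hρ with hρ | hρ
    · calc _ ≤ ∑ q ∈ D, (max (load (A ∪ B) p σ q) (c q) + δ) := by
            refine Finset.sum_le_sum fun q hq => ?_
            have := max_add_le_of_le_residual (hρ q hq)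
            rwa [← honY q hq, max_eq_left hδ₀] at this
        _ = ∑ q ∈ D, max (load (A ∪ B) p σ q) (c q) + D.card * δ := by
            rw [Finset.sum_add_distrib, Finset.sum_const, nsmul_eq_mul]
        _ ≤ ∑ q ∈ D, max (load (A ∪ B) p τ q) (c q) + D.card * δ := by gcongr
        _ ≤ _ := by
            gcongr with q hq
            linarith [hY₀ q]
    · calc _ = ∑ q ∈ D, (load (A ∪ B) p σ q + load C p τ' q) := by
            refine Finset.sum_congr rfl fun q hq => max_eq_left ?_
            have := hρ q hq
            rw [← honY q hq] at this
            exact le_add_of_residual_le this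
        _ = ∑ q ∈ D, (load (A ∪ B) p τ q + load C p τ q) := by
            rw [Finset.sum_add_distrib, hsumL, hsumY, Finset.sum_add_distrib]
        _ ≤ ∑ q ∈ D, max (load (A ∪ B) p τ q + load C p τ q) (c q) :=
            Finset.sum_le_sum fun q _ => le_max_left _ _
        _ ≤ _ := le_add_of_nonneg_right (by positivity)
  calc workingTime (A ∪ B ∪ C) p c τ'
      = ∑ q, max (load (A ∪ B) p σ q + load C p τ' q) (c q) := by
        rw [workingTime_eq]
        exact Finset.sum_congr rfl fun q _ => by rw [load_union hC, load_congr hτ'AB]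
    _ ≤ ∑ q, max (load (A ∪ B) p τ q + load C p τ q) (c q) + D.card * δ := by
        linarith [sum_sub_sum_of_eq_off (D := D)
          (f := fun q => max (load (A ∪ B) p σ q + load C p τ' q) (c q))
          (g := fun q => max (load (A ∪ B) p τ q + load C p τ q) (c q))
          fun q hq => by rw [hoffL q hq, hoffY q hq]]
    _ ≤ workingTime (A ∪ B ∪ C) p c τ + 2 * B.card * δ := by
        rw [workingTime_eq]
        simp only [load_union hC]
        gcongr

end Load

/-! ### Layers, classes and blocks. -/

section Blocks

variable {J M : Type}

/-- The index of the layer of job `j`. -/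
noncomputable def layer (Ψ : Problem J M) (ε : ℝ) (j : J) : ℕ := ⌊Real.logb ε (Ψ.p j / pmax Ψ)⌋₊

/-- The index of the block of the layer `l`, for the gap class `t`. -/
def blockOf (K t l : ℕ) : ℕ := if t ≤ l then (l - t) / K + 1 else 0

lemma blockOf_eq_zero_iff {K t l : ℕ} : blockOf K t l = 0 ↔ l < t := by
  unfold blockOf
  split_ifs with h <;> simp <;> omega

/-- The offset `x` is the remainder of `l - t` modulo `K`; as `t < K`, it vanishes exactly for the
layers of the gap class. -/
lemma blockOf_eq_succ_iff {K t l i : ℕ} (ht : t < K) :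
    (l % K ≠ t ∧ blockOf K t l = i + 1) ↔ ∃ x, 0 < x ∧ x < K ∧ l = i * K + x + t := by
  have hK : 0 < K := by omega
  unfold blockOf
  constructor
  · rintro ⟨hl, h⟩
    split_ifs at h with htl
    have h₁ : (l - t) / K = i := by omega
    have h₂ := Nat.div_add_mod (l - t) K
    have h₃ := Nat.mod_lt (l - t) hK
    rw [h₁] at h₂
    refine ⟨(l - t) % K, Nat.pos_of_ne_zero fun h₀ => hl ?_, h₃, ?_⟩
    · have : l = t + K * i := by omega
      rw [this, Nat.add_mul_mod_self_left, Nat.mod_eq_of_lt ht]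
    · rw [mul_comm]; omega
  · rintro ⟨x, hx₀, hxK, rfl⟩
    constructor
    · rw [show i * K + x + t = (x + t) + i * K by ring, Nat.add_mul_mod_self_right]
      intro h
      rcases Nat.lt_or_ge (x + t) K with h' | h'
      · rw [Nat.mod_eq_of_lt h'] at h; omega
      · rw [Nat.mod_eq_sub_mod h', Nat.mod_eq_of_lt (by omega)] at h; omega
    · rw [if_pos (by omega), show i * K + x + t - t = x + i * K by omega,
        Nat.add_mul_div_right _ _ hK, Nat.div_eq_of_lt hxK, zero_add]

/-- Layers of different blocks are separated by a layer of the gap class. -/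
lemma add_two_le_of_blockOf_lt {K t l l' : ℕ} (ht : t < K) (hl : l % K ≠ t) (hl' : l' % K ≠ t)
    (h : blockOf K t l < blockOf K t l') : l + 2 ≤ l' := by
  obtain ⟨i', hi'⟩ : ∃ i', blockOf K t l' = i' + 1 := ⟨_, (Nat.succ_pred (by omega)).symm⟩
  obtain ⟨x', hx₀', hxK', e'⟩ := (blockOf_eq_succ_iff ht).1 ⟨hl', hi'⟩
  -- A block of positive index starts at offset 1 after a gap layer, and earlier blocks end before
  -- that layer. Hence the distance 2 rather than 1, also when the earlier block has index 0.
  rcases Nat.eq_zero_or_pos (blockOf K t l) with h₀ | h₀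
  · have := (blockOf_eq_zero_iff).1 h₀
    omega
  · obtain ⟨i, hi⟩ : ∃ i, blockOf K t l = i + 1 := ⟨_, (Nat.succ_pred (by omega)).symm⟩
    obtain ⟨x, hx₀, hxK, e⟩ := (blockOf_eq_succ_iff ht).1 ⟨hl, hi⟩
    have : (i + 1) * K ≤ i' * K := Nat.mul_le_mul_right _ (by omega)
    have e₂ : (i + 1) * K = i * K + K := by ring
    omega

/-- Layers of the same block are less than `K` apart. -/
lemma lt_add_of_blockOf_eq {K t l l' : ℕ} (ht : t < K) (hl : l % K ≠ t) (hl' : l' % K ≠ t)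
    (h : blockOf K t l = blockOf K t l') : l' + 1 < l + K := by
  rcases Nat.eq_zero_or_pos (blockOf K t l) with h₀ | h₀
  · have h₁ := (blockOf_eq_zero_iff).1 h₀
    have h₂ := (blockOf_eq_zero_iff).1 (h ▸ h₀)
    omega
  · obtain ⟨i, hi⟩ : ∃ i, blockOf K t l = i + 1 := ⟨_, (Nat.succ_pred (by omega)).symm⟩
    obtain ⟨x, hx₀, hxK, e⟩ := (blockOf_eq_succ_iff ht).1 ⟨hl, hi⟩
    obtain ⟨x', hx₀', hxK', e'⟩ := (blockOf_eq_succ_iff ht).1 ⟨hl', h ▸ hi⟩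
    omega

variable [Fintype J]

lemma p_le_pmax (Ψ : Problem J M) (j : J) : Ψ.p j ≤ pmax Ψ :=
  le_csSup (Set.finite_range Ψ.p).bddAbove ⟨j, rfl⟩

lemma pmax_pos (Ψ : Problem J M) (j : J) : 0 < pmax Ψ := (Ψ.p_pos j).trans_le (p_le_pmax Ψ j)

/-- The logarithm to a base below 1 is decreasing, which turns `k ≤ log < k + 1` into the interval
of the layer. Division by `pmax` keeps the logarithm nonnegative, so the natural floor truncates
nothing and each job has exactly one layer. -/
lemma inLayer_iff (Ψ : Problem J M) {ε : ℝ} (hε₀ : 0 < ε) (hε₁ : ε < 1) (l : ℕ) (j : J) :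
    InLayer Ψ ε l j ↔ layer Ψ ε j = l := by
  have hx : 0 < Ψ.p j / pmax Ψ := div_pos (Ψ.p_pos j) (pmax_pos Ψ j)
  have hx₁ : Ψ.p j / pmax Ψ ≤ 1 := (div_le_one (pmax_pos Ψ j)).2 (p_le_pmax Ψ j)
  rw [layer, Nat.floor_eq_iff (Real.logb_nonneg_of_base_lt_one hε₀ hε₁ hx hx₁),
    Real.le_logb_iff_rpow_le_of_base_lt_one hε₀ hε₁ hx,
    Real.logb_lt_iff_lt_rpow_of_base_lt_one hε₀ hε₁ hx, InLayer, and_comm, Real.rpow_natCast,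
    ← Real.rpow_natCast ε (l + 1), Nat.cast_add_one]

lemma inLayer_layer (Ψ : Problem J M) {ε : ℝ} (hε₀ : 0 < ε) (hε₁ : ε < 1) (j : J) :
    InLayer Ψ ε (layer Ψ ε j) j :=
  (inLayer_iff Ψ hε₀ hε₁ _ j).2 rfl

lemma mem_classJobs (Ψ : Problem J M) {ε : ℝ} (hε₀ : 0 < ε) (hε₁ : ε < 1) {i : ℕ}
    (hi : i < numClasses ε) (j : J) :
    j ∈ classJobs Ψ ε i ↔ layer Ψ ε j % numClasses ε = i := by
  classical
  rw [classJobs, Finset.mem_filter]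
  simp only [Finset.mem_univ, true_and, inLayer_iff Ψ hε₀ hε₁, Nat.ModEq, Nat.mod_eq_of_lt hi]
  exact ⟨by rintro ⟨l, h, rfl⟩; exact h, fun h => ⟨_, h, rfl⟩⟩

/-- With a unique layer per job, membership becomes arithmetic of the layer index, the form in which
the program computes it. -/
lemma mem_block (Ψ : Problem J M) {ε : ℝ} (hε₀ : 0 < ε) (hε₁ : ε < 1) {t : ℕ}
    (ht : t < numClasses ε) (i : ℕ) (j : J) :
    j ∈ block Ψ ε t i ↔ layer Ψ ε j % numClasses ε ≠ t ∧
      blockOf (numClasses ε) t (layer Ψ ε j) = i := by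
  cases i with
  | zero =>
    simp only [block, Finset.mem_filter, Finset.mem_univ, true_and, inLayer_iff Ψ hε₀ hε₁]
    constructor
    · rintro ⟨l, hl, rfl⟩
      have : layer Ψ ε j % numClasses ε ≠ t := by
        rw [Nat.mod_eq_of_lt (hl.trans ht)]; omega
      exact ⟨this, (blockOf_eq_zero_iff).2 hl⟩
    · rintro ⟨h₁, h₂⟩
      exact ⟨_, (blockOf_eq_zero_iff).1 h₂, rfl⟩
  | succ i =>
    rw [blockOf_eq_succ_iff ht]
    simp only [block, Finset.mem_filter, Finset.mem_univ, true_and, inLayer_iff Ψ hε₀ hε₁]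

lemma numClasses_pos {ε : ℝ} (hε₀ : 0 < ε) : 0 < numClasses ε :=
  Nat.ceil_pos.2 (one_div_pos.2 hε₀)

/-- Jobs of later blocks are smaller by a factor of `ε` than jobs of earlier ones. -/
lemma p_le_of_block_lt (Ψ : Problem J M) {ε : ℝ} (hε₀ : 0 < ε) (hε₁ : ε < 1) {t : ℕ}
    (ht : t < numClasses ε) {i i' : ℕ} (hi : i < i') {j j' : J} (hj : j ∈ block Ψ ε t i)
    (hj' : j' ∈ block Ψ ε t i') : Ψ.p j' ≤ ε * Ψ.p j := by
  rw [mem_block Ψ hε₀ hε₁ ht] at hj hj'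
  have hl := add_two_le_of_blockOf_lt ht hj.1 hj'.1 (by omega)
  have h₁ := (inLayer_layer Ψ hε₀ hε₁ j).1
  have h₂ := (inLayer_layer Ψ hε₀ hε₁ j').2
  have hP := pmax_pos Ψ j
  rw [lt_div_iff₀ hP] at h₁
  rw [div_le_iff₀ hP] at h₂
  -- The layers are two apart, but `j` is only known to lie above the lower end of its layer; this
  -- leaves one factor `ε`.
  calc Ψ.p j' ≤ ε ^ layer Ψ ε j' * pmax Ψ := h₂
    _ ≤ ε ^ (layer Ψ ε j + 2) * pmax Ψ :=
      mul_le_mul_of_nonneg_right (pow_le_pow_of_le_one hε₀.le hε₁.le hl) hP.le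
    _ = ε * (ε ^ (layer Ψ ε j + 1) * pmax Ψ) := by ring
    _ ≤ ε * Ψ.p j := mul_le_mul_of_nonneg_left h₁.le hε₀.le

/-- Jobs of the same block differ by a factor of less than `(1 / ε) ^ (K - 1)`. -/
lemma p_div_le_of_block_eq (Ψ : Problem J M) {ε : ℝ} (hε₀ : 0 < ε) (hε₁ : ε < 1) {t : ℕ}
    (ht : t < numClasses ε) {i : ℕ} {j j' : J} (hj : j ∈ block Ψ ε t i)
    (hj' : j' ∈ block Ψ ε t i) : Ψ.p j' / Ψ.p j ≤ (1 / ε) ^ (numClasses ε - 1) := by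
  rw [mem_block Ψ hε₀ hε₁ ht] at hj hj'
  have hl := lt_add_of_blockOf_eq ht hj'.1 hj.1 (by omega)
  have h₁ := (inLayer_layer Ψ hε₀ hε₁ j).1
  have h₂ := (inLayer_layer Ψ hε₀ hε₁ j').2
  have hP := pmax_pos Ψ j
  rw [lt_div_iff₀ hP] at h₁
  rw [div_le_iff₀ hP] at h₂
  rw [div_le_iff₀ (Ψ.p_pos j), one_div, inv_pow, inv_mul_eq_div, le_div_iff₀ (by positivity)]
  calc Ψ.p j' * ε ^ (numClasses ε - 1)
      ≤ ε ^ layer Ψ ε j' * pmax Ψ * ε ^ (numClasses ε - 1) := by gcongr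
    _ = ε ^ (layer Ψ ε j' + (numClasses ε - 1)) * pmax Ψ := by ring
    _ ≤ ε ^ (layer Ψ ε j + 1) * pmax Ψ :=
      mul_le_mul_of_nonneg_right (pow_le_pow_of_le_one hε₀.le hε₁.le (by omega)) hP.le
    _ ≤ Ψ.p j := h₁.le

end Blocks

/-! ### Rounding down to a geometric progression. -/

section Rounding

variable {J : Type} {p : J → ℝ} {S : Finset J}

lemma pmin_le {j : J} (hj : j ∈ S) : pmin p S ≤ p j :=
  csInf_le ((S.finite_toSet.image p).bddBelow) ⟨j, hj, rfl⟩

lemma exists_eq_pmin (hS : S.Nonempty) : ∃ j ∈ S, p j = pmin p S :=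
  (Set.Nonempty.image p hS).csInf_mem (S.finite_toSet.image p)

lemma pmin_pos (hp : ∀ j, 0 < p j) (hS : S.Nonempty) : 0 < pmin p S := by
  obtain ⟨j, _, h⟩ := exists_eq_pmin (p := p) hS
  exact h ▸ hp j

/-- The floor of the logarithm brackets `p j / pmin p S` between consecutive powers of `1 + ε`. The
lower bound by `pmin p S` later lets the exchange loss be charged to the block itself. -/
lemma rounded_bounds {ε : ℝ} (hε₀ : 0 < ε) (hp : ∀ j, 0 < p j) {j : J} (hj : j ∈ S) : pmin p S ≤ rounded p ε S j ∧
    rounded p ε S j ≤ p j ∧ p j ≤ (1 + ε) * rounded p ε S j := by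
  have hm := pmin_pos hp ⟨j, hj⟩
  have hb : (1 : ℝ) < 1 + ε := by linarith
  have hx : 1 ≤ p j / pmin p S := (one_le_div hm).2 (pmin_le hj)
  have hx₀ := zero_lt_one.trans_le hx
  have hlog := Real.logb_nonneg hb hx
  have h₁ := Nat.floor_le hlog
  have h₂ := Nat.lt_floor_add_one (Real.logb (1 + ε) (p j / pmin p S))
  rw [Real.le_logb_iff_rpow_le hb hx₀, Real.rpow_natCast, le_div_iff₀' hm] at h₁
  rw [Real.logb_lt_iff_lt_rpow hb hx₀, ← Nat.cast_add_one, Real.rpow_natCast, div_lt_iff₀' hm] at h₂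
  refine ⟨le_mul_of_one_le_right hm.le (one_le_pow₀ hb.le), h₁, h₂.le.trans (le_of_eq ?_)⟩
  rw [rounded]
  ring

end Rounding

/-! ### The approximation guarantee. -/

section Approximation

variable {J M : Type} [Fintype J]

/-- The rounded processing time of a job, with respect to its block. -/
noncomputable def roundedTime (Ψ : Problem J M) (ε : ℝ) (t : ℕ) (j : J) : ℝ :=
  rounded Ψ.p ε (block Ψ ε t (blockOf (numClasses ε) t (layer Ψ ε j))) j

/-- The jobs of the first `i` blocks. -/
noncomputable def firstBlocks (Ψ : Problem J M) (ε : ℝ) (t i : ℕ) : Finset J :=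
  {j | layer Ψ ε j % numClasses ε ≠ t ∧ blockOf (numClasses ε) t (layer Ψ ε j) < i}

/-- The jobs of all the blocks. -/
noncomputable def blockJobs (Ψ : Problem J M) (ε : ℝ) (t : ℕ) : Finset J :=
  {j | layer Ψ ε j % numClasses ε ≠ t}

/-- The jobs of the blocks after block `i`. -/
noncomputable def laterBlocks (Ψ : Problem J M) (ε : ℝ) (t i : ℕ) : Finset J :=
  {j | layer Ψ ε j % numClasses ε ≠ t ∧ i < blockOf (numClasses ε) t (layer Ψ ε j)}

variable (Ψ : Problem J M) {ε : ℝ} {t : ℕ}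

/-- The exchange argument wants nonnegative times for all jobs, including those of the gap class,
whose rounded time has no meaning. -/
lemma roundedTime_nonneg (hε₀ : 0 < ε) (j : J) : 0 ≤ roundedTime Ψ ε t j :=
  mul_nonneg (Real.sInf_nonneg (by rintro _ ⟨j, _, rfl⟩; exact (Ψ.p_pos j).le))
    (pow_nonneg (by linarith) _)

lemma roundedTime_eq (hε₀ : 0 < ε) (hε₁ : ε < 1) (ht : t < numClasses ε) {i : ℕ} {j : J}
    (hj : j ∈ block Ψ ε t i) : roundedTime Ψ ε t j = rounded Ψ.p ε (block Ψ ε t i) j := by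
  rw [roundedTime, ((mem_block Ψ hε₀ hε₁ ht i j).1 hj).2]

lemma roundedTime_bounds (hε₀ : 0 < ε) (hε₁ : ε < 1) (ht : t < numClasses ε) {j : J}
    (hj : j ∈ blockJobs Ψ ε t) :
    roundedTime Ψ ε t j ≤ Ψ.p j ∧ Ψ.p j ≤ (1 + ε) * roundedTime Ψ ε t j := by
  have h := (mem_block Ψ hε₀ hε₁ ht _ j).2 ⟨(Finset.mem_filter.1 hj).2, rfl⟩
  exact (rounded_bounds hε₀ Ψ.p_pos h).2

lemma firstBlocks_succ [DecidableEq J] (hε₀ : 0 < ε) (hε₁ : ε < 1) (ht : t < numClasses ε)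
    (i : ℕ) : firstBlocks Ψ ε t (i + 1) = firstBlocks Ψ ε t i ∪ block Ψ ε t i := by
  ext j
  simp only [firstBlocks, Finset.mem_union, mem_block Ψ hε₀ hε₁ ht, Finset.mem_filter,
    Finset.mem_univ, true_and]
  rw [← and_or_left, Nat.lt_succ_iff_lt_or_eq]

lemma disjoint_firstBlocks_block (hε₀ : 0 < ε) (hε₁ : ε < 1) (ht : t < numClasses ε)
    (i : ℕ) : Disjoint (firstBlocks Ψ ε t i) (block Ψ ε t i) := by
  rw [Finset.disjoint_left]
  intro j hj hj'
  rw [mem_block Ψ hε₀ hε₁ ht] at hj'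
  have := (Finset.mem_filter.1 hj).2.2
  omega

lemma disjoint_firstBlocks_laterBlocks (i : ℕ) :
    Disjoint (firstBlocks Ψ ε t (i + 1)) (laterBlocks Ψ ε t i) := by
  rw [Finset.disjoint_left]
  intro j hj hj'
  have h₁ := (Finset.mem_filter.1 hj).2.2
  have h₂ := (Finset.mem_filter.1 hj').2.2
  omega

lemma firstBlocks_union_laterBlocks [DecidableEq J] (i : ℕ) :
    firstBlocks Ψ ε t (i + 1) ∪ laterBlocks Ψ ε t i = blockJobs Ψ ε t := by
  ext j
  simp only [firstBlocks, laterBlocks, blockJobs, Finset.mem_union, Finset.mem_filter,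
    Finset.mem_univ, true_and, ← and_or_left]
  exact and_iff_left (by omega)

/-- The lightest class has at most an `ε`-fraction of the total processing time. -/
lemma sum_classJobs_le (hε₀ : 0 < ε) (hε₁ : ε < 1)
    (hmin : ∀ i < numClasses ε,
      ∑ j ∈ classJobs Ψ ε t, Ψ.p j ≤ ∑ j ∈ classJobs Ψ ε i, Ψ.p j) :
    ∑ j ∈ classJobs Ψ ε t, Ψ.p j ≤ ε * ∑ j, Ψ.p j := by
  have hK := numClasses_pos hε₀
  have h₁ : ∑ i ∈ Finset.range (numClasses ε), ∑ j ∈ classJobs Ψ ε i, Ψ.p j = ∑ j, Ψ.p j := by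
    rw [← Finset.sum_fiberwise_of_maps_to (s := Finset.univ) (t := Finset.range (numClasses ε))
      (g := fun j => layer Ψ ε j % numClasses ε)
      fun j _ => Finset.mem_range.2 (Nat.mod_lt _ hK)]
    refine Finset.sum_congr rfl fun i hi => Finset.sum_congr ?_ fun _ _ => rfl
    ext j
    rw [mem_classJobs Ψ hε₀ hε₁ (Finset.mem_range.1 hi), Finset.mem_filter]
    simp
  have h₂ := Finset.card_nsmul_le_sum (Finset.range (numClasses ε))
    (fun i => ∑ j ∈ classJobs Ψ ε i, Ψ.p j) _ fun i hi => hmin i (Finset.mem_range.1 hi)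
  rw [h₁, Finset.card_range, nsmul_eq_mul] at h₂
  have h₃ : 1 / ε ≤ numClasses ε := Nat.le_ceil _
  have h₄ : 0 ≤ ∑ j ∈ classJobs Ψ ε t, Ψ.p j := Finset.sum_nonneg fun j _ => (Ψ.p_pos j).le
  calc _ = ε * (1 / ε * ∑ j ∈ classJobs Ψ ε t, Ψ.p j) := by field_simp
    _ ≤ ε * (numClasses ε * ∑ j ∈ classJobs Ψ ε t, Ψ.p j) := by gcongr
    _ ≤ _ := by gcongr

variable [DecidableEq M]

/-- The blocks are disjoint, so the double sum over earlier blocks is a single load for one common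
function of rounded times. The greedy rule thereby takes the form required by
`workingTime_union_le`. -/
lemma residual_eq (hε₀ : 0 < ε) (hε₁ : ε < 1) (ht : t < numClasses ε) (σ : J → M) (i : ℕ) :
    residual Ψ ε t σ i =
      fun q => max (Ψ.c q - load (firstBlocks Ψ ε t i) (roundedTime Ψ ε t) σ q) 0 := by
  classical
  funext q
  have : ∑ k ∈ Finset.range i, ∑ j ∈ block Ψ ε t k with σ j = q,
      rounded Ψ.p ε (block Ψ ε t k) j = load (firstBlocks Ψ ε t i) (roundedTime Ψ ε t) σ q := by
    induction i with
    | zero => simp [firstBlocks, load]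
    | succ i ih =>
      rw [Finset.sum_range_succ, ih, firstBlocks_succ Ψ hε₀ hε₁ ht,
        load_union (disjoint_firstBlocks_block Ψ hε₀ hε₁ ht i)]
      congr 1
      exact Finset.sum_congr rfl fun j hj =>
        (roundedTime_eq Ψ hε₀ hε₁ ht (Finset.mem_filter.1 hj).1).symm
  rw [residual, this]

variable [Fintype M]

/-- Scheduling the blocks greedily is `(1 + 2 * ε)`-approximate for the rounded times. -/
lemma exists_agree_on_firstBlocks (hε₀ : 0 < ε) (hε₁ : ε < 1) (ht : t < numClasses ε)
    {σ : J → M} (hσ : ∀ (i : ℕ) (τ : J → M),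
      workingTime (block Ψ ε t i) (rounded Ψ.p ε (block Ψ ε t i)) (residual Ψ ε t σ i) σ ≤
      workingTime (block Ψ ε t i) (rounded Ψ.p ε (block Ψ ε t i)) (residual Ψ ε t σ i) τ)
    (τ : J → M) (i : ℕ) :
    ∃ τ' : J → M, (∀ j ∈ firstBlocks Ψ ε t i, τ' j = σ j) ∧
      workingTime (blockJobs Ψ ε t) (roundedTime Ψ ε t) Ψ.c τ' ≤
        workingTime (blockJobs Ψ ε t) (roundedTime Ψ ε t) Ψ.c τ +
          2 * ε * ∑ j ∈ firstBlocks Ψ ε t i, roundedTime Ψ ε t j := by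
  classical
  induction i with
  | zero => exact ⟨τ, by simp [firstBlocks], by simp [firstBlocks]⟩
  | succ i ih =>
    obtain ⟨τ₁, h₁, hle⟩ := ih
    have hdisj := disjoint_firstBlocks_block Ψ hε₀ hε₁ ht i
    rw [firstBlocks_succ Ψ hε₀ hε₁ ht, Finset.sum_union hdisj]
    rcases Finset.eq_empty_or_nonempty (block Ψ ε t i) with hB | hB
    · rw [hB, Finset.union_empty, Finset.sum_empty, add_zero]
      exact ⟨τ₁, h₁, hle⟩
    · have hopt := hσ i τ₁
      rw [residual_eq Ψ hε₀ hε₁ ht, ← workingTime_congr_time _ _ fun j hj =>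
        roundedTime_eq Ψ hε₀ hε₁ ht hj, ← workingTime_congr_time _ _ fun j hj =>
        roundedTime_eq Ψ hε₀ hε₁ ht hj] at hopt
      have hm := pmin_pos Ψ.p_pos hB
      -- Comparing later jobs with the shortest job of the block gives the strongest bound, `ε`
      -- times the minimum.
      obtain ⟨j₀, hj₀, hj₀m⟩ := exists_eq_pmin (p := Ψ.p) hB
      obtain ⟨τ₂, h₂, hle₂⟩ := exists_exchange hdisj
        (C := laterBlocks Ψ ε t i) (δ := ε * pmin Ψ.p (block Ψ ε t i))
        (by rw [← firstBlocks_succ Ψ hε₀ hε₁ ht]; exact disjoint_firstBlocks_laterBlocks Ψ i) hB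
        (roundedTime_nonneg Ψ hε₀) (by positivity) (fun j hj => by
          have hj' := (Finset.mem_filter.1 hj).2
          refine (roundedTime_bounds Ψ hε₀ hε₁ ht (Finset.mem_filter.2
            ⟨Finset.mem_univ _, hj'.1⟩)).1.trans ?_
          rw [← hj₀m]
          exact p_le_of_block_lt Ψ hε₀ hε₁ ht hj'.2 hj₀
            ((mem_block Ψ hε₀ hε₁ ht _ j).2 ⟨hj'.1, rfl⟩)) h₁
        (workingTime_union_le hdisj (roundedTime_nonneg Ψ hε₀) (c := Ψ.c) h₁ hopt)
      rw [← firstBlocks_succ Ψ hε₀ hε₁ ht, firstBlocks_union_laterBlocks] at hle₂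
      refine ⟨τ₂, h₂, ?_⟩
      -- The loss of `2 * |B| * δ` is charged to the rounded times of the block, none of which is
      -- below the minimum.
      have hsum : (block Ψ ε t i).card * pmin Ψ.p (block Ψ ε t i) ≤
          ∑ j ∈ block Ψ ε t i, roundedTime Ψ ε t j := by
        rw [← nsmul_eq_mul]
        refine Finset.card_nsmul_le_sum _ _ _ fun j hj => ?_
        rw [roundedTime_eq Ψ hε₀ hε₁ ht hj]
        exact (rounded_bounds hε₀ Ψ.p_pos hj).1
      have := mul_le_mul_of_nonneg_left hsum (by positivity : 0 ≤ 2 * ε)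
      linarith

lemma sum_p_le_cost (τ : J → M) : ∑ j, Ψ.p j ≤ Ψ.cost τ := by
  rw [Problem.cost, workingTime_eq, ← sum_load_of_maps_to Ψ.p fun j _ => Finset.mem_univ (τ j)]
  exact Finset.sum_le_sum fun q _ => le_max_left _ _

/-- All three losses (gap class, rounding, greedy choice) are measured against the cost of the
competitor through the total processing time. -/
theorem IsPTASOutput.isApprox {Ψ : Problem J M} (hε₀ : 0 < ε) (hε : ε ≤ 1 / 2) {σ : J → M}
    (hσ : IsPTASOutput Ψ ε σ) : Ψ.IsApprox (1 + 5 * ε) σ := by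
  classical
  obtain ⟨t, ht, hmin, hopt, -⟩ := hσ
  have hε₁ : ε < 1 := by linarith
  intro τ
  -- Beyond the largest block index nothing is left, so agreement on the first `i` blocks is
  -- agreement on all of them.
  obtain ⟨i, hi⟩ : ∃ i, firstBlocks Ψ ε t i = blockJobs Ψ ε t := by
    refine ⟨Finset.univ.sup (fun j => blockOf (numClasses ε) t (layer Ψ ε j)) + 1, ?_⟩
    ext j
    simp only [firstBlocks, blockJobs, Finset.mem_filter, Finset.mem_univ, true_and]
    exact and_iff_left (Nat.lt_succ_of_le (Finset.le_sup
      (f := fun j => blockOf (numClasses ε) t (layer Ψ ε j)) (Finset.mem_univ j)))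
  obtain ⟨τ', hτ', hle⟩ := exists_agree_on_firstBlocks Ψ hε₀ hε₁ ht hopt τ i
  rw [hi] at hτ' hle
  rw [workingTime_congr _ _ hτ'] at hle
  set W := workingTime (blockJobs Ψ ε t) (roundedTime Ψ ε t) Ψ.c with hW
  have hp₀ : ∀ j, 0 ≤ Ψ.p j := fun j => (Ψ.p_pos j).le
  have hsum := sum_p_le_cost Ψ τ
  have hround : ∑ j ∈ blockJobs Ψ ε t, roundedTime Ψ ε t j ≤ Ψ.cost τ :=
    (Finset.sum_le_sum fun j hj => (roundedTime_bounds Ψ hε₀ hε₁ ht hj).1).trans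
      ((Finset.sum_le_univ_sum_of_nonneg hp₀).trans hsum)
  have hWτ : W τ ≤ Ψ.cost τ := by
    refine Finset.sum_le_sum fun q _ => max_le_max ?_ le_rfl
    refine (Finset.sum_le_sum fun j hj => (roundedTime_bounds Ψ hε₀ hε₁ ht
      (Finset.mem_filter.1 hj).1).1).trans ?_
    exact Finset.sum_le_sum_of_subset_of_nonneg
      (Finset.filter_subset_filter _ (Finset.subset_univ _)) fun j _ _ => hp₀ j
  have hclass := sum_classJobs_le Ψ hε₀ hε₁ hmin
  have hG : ∀ q, load Finset.univ Ψ.p σ q =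
      load (blockJobs Ψ ε t) Ψ.p σ q + load (classJobs Ψ ε t) Ψ.p σ q := fun q => by
    rw [← load_union]
    · congr 1
      ext j
      simp only [blockJobs, Finset.mem_union, Finset.mem_filter, Finset.mem_univ, true_and,
        mem_classJobs Ψ hε₀ hε₁ ht]
      tauto
    · rw [Finset.disjoint_left]
      intro j hj hj'
      exact (Finset.mem_filter.1 hj).2 ((mem_classJobs Ψ hε₀ hε₁ ht j).1 hj')
  -- On every machine the gap jobs raise the working time by at most their own length; the other
  -- load and the capacity are both below `1 + ε` times the rounded working time.
  have hcost : Ψ.cost σ ≤ (1 + ε) * W σ + ε * ∑ j, Ψ.p j := by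
    calc Ψ.cost σ ≤ ∑ q, ((1 + ε) * max (load (blockJobs Ψ ε t) (roundedTime Ψ ε t) σ q) (Ψ.c q) +
          load (classJobs Ψ ε t) Ψ.p σ q) := by
          refine Finset.sum_le_sum fun q _ => ?_
          have hc := Ψ.c_pos q
          have h₁ : load (blockJobs Ψ ε t) Ψ.p σ q ≤
              (1 + ε) * load (blockJobs Ψ ε t) (roundedTime Ψ ε t) σ q := by
            rw [load, load, Finset.mul_sum]
            exact Finset.sum_le_sum fun j hj => (roundedTime_bounds Ψ hε₀ hε₁ ht
              (Finset.mem_filter.1 hj).1).2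
          have h₂ : 0 ≤ load (classJobs Ψ ε t) Ψ.p σ q := load_nonneg (fun j _ => hp₀ j) _ _
          have h₃ := hG q
          have h₄ : (1 + ε) * load (blockJobs Ψ ε t) (roundedTime Ψ ε t) σ q ≤
              (1 + ε) * max (load (blockJobs Ψ ε t) (roundedTime Ψ ε t) σ q) (Ψ.c q) :=
            mul_le_mul_of_nonneg_left (le_max_left _ _) (by linarith)
          have h₅ : 1 * Ψ.c q ≤
              (1 + ε) * max (load (blockJobs Ψ ε t) (roundedTime Ψ ε t) σ q) (Ψ.c q) :=
            mul_le_mul (by linarith) (le_max_right _ _) hc.le (by linarith)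
          refine max_le ?_ ?_
          · change load Finset.univ Ψ.p σ q ≤ _
            linarith
          · linarith
      _ = (1 + ε) * W σ + ∑ j ∈ classJobs Ψ ε t, Ψ.p j := by
          rw [Finset.sum_add_distrib, ← Finset.mul_sum,
            sum_load_of_maps_to Ψ.p fun j _ => Finset.mem_univ _]
          rfl
      _ ≤ _ := by gcongr
  have hT : 0 ≤ Ψ.cost τ := (Finset.sum_nonneg fun j _ => hp₀ j).trans hsum
  have h₁ : W σ ≤ (1 + 2 * ε) * Ψ.cost τ := by
    have := mul_le_mul_of_nonneg_left hround (by positivity : 0 ≤ 2 * ε)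
    linarith
  have h₂ : (1 + ε) * W σ ≤ (1 + ε) * ((1 + 2 * ε) * Ψ.cost τ) := by gcongr
  have h₃ : ε * ∑ j, Ψ.p j ≤ ε * Ψ.cost τ := by gcongr
  -- The product of the factors is `1 + 4 * ε + 2 * ε ^ 2` with the gap class included; `ε ≤ 1 / 2`
  -- turns the square into the fifth `ε`.
  have h₄ : ε * ε * Ψ.cost τ ≤ 1 / 2 * ε * Ψ.cost τ := by gcongr
  linarith

end Approximation

/-! ### Values and step counts of the basic operations. -/

section Timed

variable {α β : Type}

@[simp] lemma bind_val (x : Timed α) (f : α → Timed β) : (x >>= f).val = (f x.val).val := rfl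

@[simp] lemma bind_steps (x : Timed α) (f : α → Timed β) :
    (x >>= f).steps = x.steps + (f x.val).steps := rfl

@[simp] lemma step_val (a : α) : (step a).val = a := rfl

@[simp] lemma step_steps (a : α) : (step a).steps = 1 := rfl

@[simp] lemma ite_val (c : Prop) [Decidable c] (x y : Timed α) :
    (if c then x else y).val = if c then x.val else y.val := apply_ite _ _ _ _

@[simp] lemma ite_steps (c : Prop) [Decidable c] (x y : Timed α) :
    (if c then x else y).steps = if c then x.steps else y.steps := apply_ite _ _ _ _

attribute [simp] addR subR mulR divR floorLog ceilR castN addN subN divN modN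

@[simp] lemma leR_val (x y : ℝ) : (leR x y).val = true ↔ x ≤ y := decide_eq_true_iff

@[simp] lemma leR_steps (x y : ℝ) : (leR x y).steps = 1 := rfl

@[simp] lemma eqR_val (x y : ℝ) : (eqR x y).val = true ↔ x = y := decide_eq_true_iff

@[simp] lemma eqR_steps (x y : ℝ) : (eqR x y).steps = 1 := rfl

@[simp] lemma leN_val (x y : ℕ) : (leN x y).val = true ↔ x ≤ y := decide_eq_true_iff

@[simp] lemma leN_steps (x y : ℕ) : (leN x y).steps = 1 := rfl

@[simp] lemma eqN_val (x y : ℕ) : (eqN x y).val = true ↔ x = y := decide_eq_true_iff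

@[simp] lemma eqN_steps (x y : ℕ) : (eqN x y).steps = 1 := rfl

@[simp] lemma maxR_val (x y : ℝ) : (maxR x y).val = max x y := by
  simp [maxR, max_def]

@[simp] lemma maxR_steps (x y : ℝ) : (maxR x y).steps = 2 := by
  simp [maxR]

@[simp] lemma minR_val (x y : ℝ) : (minR x y).val = min x y := by
  simp [minR, min_def]

@[simp] lemma minR_steps (x y : ℝ) : (minR x y).steps = 2 := by
  simp [minR]

@[simp] lemma powR_val (x : ℝ) (k : ℕ) : (powR x k).val = x ^ k := by
  induction k with
  | zero => simp [powR]
  | succ k ih => simp [powR, ih, pow_succ]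

@[simp] lemma powR_steps (x : ℝ) (k : ℕ) : (powR x k).steps = k + 1 := by
  induction k with
  | zero => simp [powR]
  | succ k ih => simp [powR, ih]

@[simp] lemma rangeT_val (k : ℕ) : (rangeT k).val = (List.range k).reverse := by
  induction k with
  | zero => simp [rangeT]
  | succ k ih => simp [rangeT, ih, List.range_succ]

@[simp] lemma rangeT_steps (k : ℕ) : (rangeT k).steps = k + 1 := by
  induction k with
  | zero => simp [rangeT]
  | succ k ih => simp [rangeT, ih]

lemma foldT_val (f : α → β → Timed β) (b : β) (l : List α) :
    (foldT f b l).val = l.foldr (fun a r => (f a r).val) b := by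
  induction l with
  | nil => simp [foldT]
  | cons a l ih => simp [foldT, ih]

@[simp] lemma foldT_nil_val (f : α → β → Timed β) (b : β) : (foldT f b []).val = b := rfl

@[simp] lemma foldT_cons_val (f : α → β → Timed β) (b : β) (a : α) (l : List α) :
    (foldT f b (a :: l)).val = (f a (foldT f b l).val).val := rfl

/-- The body need only be bounded on accumulators that really occur, namely the results of the fold
on suffixes. Insertion into a growing list needs this, since its cost depends on the accumulator. -/
lemma foldT_steps_le {f : α → β → Timed β} {b : β} {l : List α} {c : ℕ}
    (h : ∀ a l', a :: l' <:+ l → (f a (foldT f b l').val).steps ≤ c) :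
    (foldT f b l).steps ≤ l.length * (c + 1) + 1 := by
  induction l with
  | nil => simp [foldT]
  | cons a l ih =>
    have h₁ := ih fun a' l' h' => h a' l' (h'.trans (List.suffix_cons a l))
    have h₂ := h a l List.suffix_rfl
    simp only [foldT, bind_steps, step_steps, List.length_cons]
    linarith

/-- A bound for the folds whose steps do not depend on the accumulated value. -/
lemma foldT_steps_le_of_forall {f : α → β → Timed β} {b : β} {l : List α} {c : ℕ}
    (h : ∀ a ∈ l, ∀ r, (f a r).steps ≤ c) : (foldT f b l).steps ≤ l.length * (c + 1) + 1 :=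
  foldT_steps_le fun a _ hl => h a (hl.subset List.mem_cons_self) _

@[simp] lemma mapT_val (f : α → Timed β) (l : List α) :
    (mapT f l).val = l.map fun a => (f a).val := by
  induction l with
  | nil => simp [mapT]
  | cons a l ih => simp [mapT, ih]

lemma mapT_steps_le {f : α → Timed β} {l : List α} {c : ℕ} (h : ∀ a ∈ l, (f a).steps ≤ c) :
    (mapT f l).steps ≤ l.length * (c + 1) + 1 := by
  induction l with
  | nil => simp [mapT]
  | cons a l ih =>
    have h₁ := ih fun a' h' => h a' (List.mem_cons_of_mem _ h')
    have h₂ := h a List.mem_cons_self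
    simp only [mapT, bind_steps, step_steps, List.length_cons]
    linarith

@[simp] lemma appendT_val (l₁ l₂ : List α) : (appendT l₁ l₂).val = l₁ ++ l₂ := by
  induction l₁ with
  | nil => simp [appendT]
  | cons a l ih => simp [appendT, ih]

@[simp] lemma appendT_steps (l₁ l₂ : List α) : (appendT l₁ l₂).steps = l₁.length + 1 := by
  induction l₁ with
  | nil => simp [appendT]
  | cons a l ih => simp [appendT, ih]

@[simp] lemma lengthT_val (l : List α) : (lengthT l).val = l.length := by
  induction l with
  | nil => simp [lengthT]
  | cons a l ih => simp [lengthT, ih]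

@[simp] lemma lengthT_steps (l : List α) : (lengthT l).steps = l.length + 1 := by
  induction l with
  | nil => simp [lengthT]
  | cons a l ih => simp [lengthT, ih]

@[simp] lemma splitT_val (k : ℕ) (l : List α) : (splitT k l).val = (l.take k, l.drop k) := by
  induction k generalizing l with
  | zero => simp [splitT]
  | succ k ih => cases l <;> simp [splitT, ih]

lemma splitT_steps_le (k : ℕ) (l : List α) : (splitT k l).steps ≤ l.length + 1 := by
  induction k generalizing l with
  | zero => simp [splitT]
  | succ k ih =>
    cases l with
    | nil => simp [splitT]
    | cons a l => simpa [splitT] using ih l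

end Timed

/-! ### The rounding procedure. -/

section RoundDown

variable {J : Type}

/-- Described as a least element, the minimum can be identified with `pmin` by uniqueness. -/
lemma isLeast_foldT_minR (x : ℝ) (l : List (J × ℝ)) :
    IsLeast (insert x {y | ∃ b ∈ l, b.2 = y}) (foldT (fun b r => minR b.2 r) x l).val := by
  induction l with
  | nil => simp
  | cons a l ih =>
    have e : insert x {y | ∃ b ∈ a :: l, b.2 = y} =
        insert a.2 (insert x {y | ∃ b ∈ l, b.2 = y}) := by
      ext y
      simp only [List.mem_cons, exists_eq_or_imp, Set.mem_insert_iff, Set.mem_ofPred_eq]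
      grind
    rw [e, foldT_cons_val, minR_val]
    exact ih.insert a.2

lemma roundDown_val {ε m : ℝ} {l : List (J × ℝ)} (hm : IsLeast {y | ∃ b ∈ l, b.2 = y} m) :
    (roundDown ε l).val =
      l.map fun b => (b.1, m * (1 + ε) ^ ⌊Real.logb (1 + ε) (b.2 / m)⌋₊) := by
  cases l with
  | nil => simp [roundDown]
  | cons a l =>
    have e : (foldT (fun b r => minR b.2 r) a.2 l).val = m := by
      refine (isLeast_foldT_minR a.2 l).unique ?_
      have : insert a.2 {y | ∃ b ∈ l, b.2 = y} = {y | ∃ b ∈ a :: l, b.2 = y} := by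
        ext y
        simp [eq_comm]
      rwa [this]
    simp [roundDown, e]

/-- Powers are computed by repeated multiplication, so the exponents enter the cost. The minimum is
attained by a job, hence a bound over pairs of jobs suffices. -/
lemma roundDown_steps_le {ε : ℝ} {l : List (J × ℝ)} {P : ℕ}
    (hP : ∀ a ∈ l, ∀ b ∈ l, ⌊Real.logb (1 + ε) (b.2 / a.2)⌋₊ ≤ P) :
    (roundDown ε l).steps ≤ l.length * (P + 9) + 3 := by
  cases l with
  | nil => simp [roundDown]
  | cons a l =>
    obtain ⟨m, hm⟩ : ∃ m, m = (foldT (fun b r => minR b.2 r) a.2 l).val := ⟨_, rfl⟩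
    have hm' : ∃ b ∈ a :: l, b.2 = m := by
      have := (isLeast_foldT_minR a.2 l).1
      rw [← hm] at this
      simpa [eq_comm] using this
    obtain ⟨b, hb, hbm⟩ := hm'
    have h₁ : (foldT (fun b r => minR b.2 r) a.2 l).steps ≤ l.length * (2 + 1) + 1 :=
      foldT_steps_le_of_forall fun _ _ _ => by simp
    simp only [roundDown, bind_steps, addR, step_val, step_steps, ← hm]
    have h₂ := mapT_steps_le (l := a :: l) (c := P + 5) (f := fun b => do
      let x ← divR b.2 m
      let k ← floorLog (1 + ε) x
      let y ← powR (1 + ε) k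
      let z ← mulR m y
      step (b.1, z)) fun x hx => by
        have := hP b hb x hx
        rw [hbm] at this
        simp
        omega
    simp only [List.length_cons] at h₂ ⊢
    ring_nf at h₁ h₂ ⊢
    omega

end RoundDown

/-! ### Configurations and the table of the dynamic program. -/

section Configs

lemma isZeroConfig_val (q : List ℕ) : (isZeroConfig q).val = true ↔ ∀ a ∈ q, a = 0 := by
  induction q with
  | nil => simp [isZeroConfig]
  | cons a l ih => by_cases h : a = 0 <;> simp [isZeroConfig, h, ih]

lemma isZeroConfig_steps_le (q : List ℕ) : (isZeroConfig q).steps ≤ 2 * q.length + 1 := by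
  induction q with
  | nil => simp [isZeroConfig]
  | cons a l ih => by_cases h : a = 0 <;> simp [isZeroConfig, h] <;> omega

lemma eqConfig_val (q r : List ℕ) : (eqConfig q r).val = true ↔ q = r := by
  induction q generalizing r with
  | nil => cases r <;> simp [eqConfig]
  | cons a l ih =>
    cases r with
    | nil => simp [eqConfig]
    | cons b r => by_cases h : a = b <;> simp [eqConfig, h, ih]

lemma eqConfig_steps_le (q r : List ℕ) : (eqConfig q r).steps ≤ 2 * q.length + 1 := by
  induction q generalizing r with
  | nil => cases r <;> simp [eqConfig]
  | cons a l ih =>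
    cases r with
    | nil => simp [eqConfig]
    | cons b r =>
      have := ih r
      by_cases h : a = b <;> simp [eqConfig, h] <;> omega

/-- Equal lengths matter: the comparison answers `true` as soon as one of the lists ends. -/
lemma leConfig_val {q r : List ℕ} (h : q.length = r.length) :
    (leConfig q r).val = true ↔ List.Forall₂ (· ≤ ·) q r := by
  induction q generalizing r with
  | nil => cases r <;> simp_all [leConfig]
  | cons a l ih =>
    cases r with
    | nil => simp at h
    | cons b r => by_cases h' : a ≤ b <;> simp_all [leConfig]

lemma leConfig_steps_le (q r : List ℕ) : (leConfig q r).steps ≤ 2 * q.length + 1 := by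
  induction q generalizing r with
  | nil => cases r <;> simp [leConfig]
  | cons a l ih =>
    cases r with
    | nil => simp [leConfig]
    | cons b r =>
      have := ih r
      by_cases h : a ≤ b <;> simp [leConfig, h] <;> omega

@[simp] lemma subConfig_val (q r : List ℕ) : (subConfig q r).val = q.zipWith (· - ·) r := by
  induction q generalizing r with
  | nil => cases r <;> simp [subConfig]
  | cons a l ih => cases r <;> simp [subConfig, ih]

lemma subConfig_steps_le (q r : List ℕ) : (subConfig q r).steps ≤ 2 * q.length + 1 := by
  induction q generalizing r with
  | nil => cases r <;> simp [subConfig]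
  | cons a l ih =>
    cases r with
    | nil => simp [subConfig]
    | cons b r =>
      have := ih r
      simp [subConfig]
      omega

lemma loadConfig_steps_le (q : List ℕ) (as : List ℝ) :
    (loadConfig q as).steps ≤ 4 * q.length + 1 := by
  induction q generalizing as with
  | nil => cases as <;> simp [loadConfig]
  | cons a l ih =>
    cases as with
    | nil => simp [loadConfig]
    | cons b as =>
      have := ih as
      simp [loadConfig]
      omega

@[simp] lemma loadConfig_nil (as : List ℝ) : (loadConfig [] as).val = 0 := by
  cases as <;> simp [loadConfig]

@[simp] lemma loadConfig_cons (k : ℕ) (q : List ℕ) (a : ℝ) (as : List ℝ) :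
    (loadConfig (k :: q) (a :: as)).val = k * a + (loadConfig q as).val := by
  simp [loadConfig]

lemma foldr_append_map_cons (Q : List (List ℕ)) (R : List ℕ) :
    (foldT (fun x acc => do
      let l ← mapT (fun q => step (x :: q)) Q
      appendT l acc) [] R).val = R.flatMap fun x => Q.map (x :: ·) := by
  induction R with
  | nil => simp
  | cons x R ih => simp [ih]

lemma mem_configs {ks q : List ℕ} : q ∈ (configs ks).val ↔ List.Forall₂ (· ≤ ·) q ks := by
  induction ks generalizing q with
  | nil => simp [configs]
  | cons k ks ih =>
    simp only [configs, bind_val, addN, step_val, rangeT_val, foldr_append_map_cons,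
      List.mem_flatMap, List.mem_reverse, List.mem_range, List.mem_map, ih,
      List.forall₂_cons_right_iff]
    constructor
    · rintro ⟨x, hx, q, hq, rfl⟩
      exact ⟨x, q, by omega, hq, rfl⟩
    · rintro ⟨x, q, hx, hq, rfl⟩
      exact ⟨x, by omega, q, hq, rfl⟩

lemma length_configs (ks : List ℕ) : (configs ks).val.length = (ks.map (· + 1)).prod := by
  induction ks with
  | nil => simp [configs]
  | cons k ks ih =>
    simp only [configs, bind_val, addN, step_val, rangeT_val, foldr_append_map_cons,
      List.length_flatMap, List.length_map, ih, List.map_const', List.length_reverse,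
      List.length_range, List.sum_replicate, List.map_cons, List.prod_cons, smul_eq_mul]

lemma length_of_mem_configs {ks q : List ℕ} (h : q ∈ (configs ks).val) : q.length = ks.length :=
  (mem_configs.1 h).length_eq

lemma forall₂_le_trans {q r s : List ℕ} (h : List.Forall₂ (· ≤ ·) q r)
    (h' : List.Forall₂ (· ≤ ·) r s) : List.Forall₂ (· ≤ ·) q s := by
  induction h generalizing s with
  | nil => exact h'
  | cons h₁ _ ih =>
    obtain _ | ⟨h₂, h₃⟩ := h'
    exact .cons (h₁.trans h₂) (ih h₃)

lemma forall₂_zipWith_sub_le {q r : List ℕ} (h : q.length = r.length) :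
    List.Forall₂ (· ≤ ·) (q.zipWith (· - ·) r) q := by
  induction q generalizing r with
  | nil => simp
  | cons a q ih =>
    cases r with
    | nil => simp at h
    | cons b r => exact .cons (Nat.sub_le _ _) (ih (by simpa using h))

/-- Configurations for several machines that add up to `q`. -/
def IsSplit : List ℕ → List (List ℕ) → Prop
  | q, [] => ∀ a ∈ q, a = 0
  | q, r :: rs => List.Forall₂ (· ≤ ·) r q ∧ IsSplit (q.zipWith (· - ·) r) rs

/-- The working time of machines with capacities `cs` and configurations `rs`. -/
noncomputable def splitCost (as : List ℝ) (cs : List ℝ) (rs : List (List ℕ)) : ℝ :=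
  (cs.zipWith (fun c r => max (loadConfig r as).val c) rs).sum

/-- What an entry of the table should be. -/
def IsEntry (as cs : List ℝ) (q : List ℕ) : Option (ℝ × List (List ℕ)) → Prop
  | none => ∀ rs, rs.length = cs.length → ¬ IsSplit q rs
  | some w => (w.2.length = cs.length ∧ IsSplit q w.2 ∧ w.1 = splitCost as cs w.2) ∧
      ∀ rs, rs.length = cs.length → IsSplit q rs → w.1 ≤ splitCost as cs rs

/-- Rows are treated as graphs of functions `F` on the configurations, so that optimality can be
stated about `F` alone. -/
lemma lookupRow_val {Q : List (List ℕ)} {q : List ℕ} (hq : q ∈ Q)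
    (F : List ℕ → Option (ℝ × List (List ℕ))) :
    (lookupRow q (Q.map fun q => (q, F q))).val = F q := by
  induction Q with
  | nil => simp at hq
  | cons r Q ih =>
    by_cases h : q = r
    · subst h
      simp [lookupRow, (eqConfig_val q q).2 rfl]
    · have : (eqConfig q r).val = false := by
        rw [← Bool.not_eq_true, eqConfig_val]; exact h
      simpa [lookupRow, this] using ih (by simpa [h] using hq)

lemma lookupRow_steps_le (q : List ℕ) (row : Row) :
    (lookupRow q row).steps ≤ row.length * (2 * q.length + 2) + 1 := by
  induction row with
  | nil => simp [lookupRow]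
  | cons e row ih =>
    have := eqConfig_steps_le q e.1
    simp only [lookupRow, bind_steps, ite_steps, step_steps, List.length_cons]
    split_ifs <;> linarith

/-- The value of the body of the minimization loop. -/
noncomputable def candidate (as : List ℝ) (c : ℝ) (prev : List ℕ → Option (ℝ × List (List ℕ)))
    (q r : List ℕ) : Option (ℝ × List (List ℕ)) :=
  if (leConfig r q).val then
    (prev (q.zipWith (· - ·) r)).map fun w => (w.1 + max (loadConfig r as).val c, r :: w.2)
  else none

/-- The better one of two entries. -/
noncomputable def better : Option (ℝ × List (List ℕ)) → Option (ℝ × List (List ℕ)) →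
    Option (ℝ × List (List ℕ))
  | none, b => b
  | some a, none => some a
  | some a, some b => if a.1 ≤ b.1 then some a else some b

/-- The body of the minimization loop. -/
noncomputable def rowStep (as : List ℝ) (c : ℝ) (prev : Row) (q r : List ℕ)
    (best : Option (ℝ × List (List ℕ))) : Timed (Option (ℝ × List (List ℕ))) := do
  if ← leConfig r q then
    let d ← subConfig q r
    let w ← lookupRow d prev
    match w, best with
    | none, best => step best
    | some w, none => do
      let x ← loadConfig r as
      let y ← maxR x c
      let z ← addR w.1 y
      step (some (z, r :: w.2))
    | some w, some b => do
      let x ← loadConfig r as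
      let y ← maxR x c
      let z ← addR w.1 y
      if ← leR z b.1 then step (some (z, r :: w.2)) else step (some b)
  else step best

lemma nextRow_eq (Q : List (List ℕ)) (as : List ℝ) (c : ℝ) (prev : Row) :
    nextRow Q as c prev = mapT (fun q => do
      let best ← foldT (rowStep as c prev q) none Q
      step (q, best)) Q := rfl

lemma rowStep_val {Q : List (List ℕ)} {as : List ℝ} {c : ℝ}
    {F : List ℕ → Option (ℝ × List (List ℕ))} {q r : List ℕ} (hqr : q.zipWith (· - ·) r ∈ Q)
    (best : Option (ℝ × List (List ℕ))) :
    (rowStep as c (Q.map fun q => (q, F q)) q r best).val =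
      better (candidate as c F q r) best := by
  unfold rowStep candidate
  by_cases h : (leConfig r q).val
  · simp only [bind_val, subConfig_val, lookupRow_val hqr, h, if_true]
    cases hw : F (q.zipWith (· - ·) r) with
    | none => simp [better]
    | some w =>
      cases best with
      | none => simp [better]
      | some b => simp [better]
  · simp [h, better]

lemma rowStep_steps_le (as : List ℝ) (c : ℝ) (prev : Row) {q r : List ℕ} {T : ℕ}
    (hq : q.length ≤ T) (hr : r.length ≤ T) (best : Option (ℝ × List (List ℕ))) :
    (rowStep as c prev q r best).steps ≤ prev.length * (2 * T + 2) + 8 * T + 9 := by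
  have h₁ := leConfig_steps_le r q
  have h₂ := subConfig_steps_le q r
  have h₃ := lookupRow_steps_le (q.zipWith (· - ·) r) prev
  have h₄ := loadConfig_steps_le r as
  have h₅ : (q.zipWith (· - ·) r).length ≤ T := by simp; omega
  have h₆ : prev.length * (2 * (q.zipWith (· - ·) r).length + 2) ≤ prev.length * (2 * T + 2) := by
    gcongr
  unfold rowStep
  by_cases h : (leConfig r q).val
  · simp only [bind_steps, subConfig_val, h, if_true]
    cases (lookupRow (q.zipWith (· - ·) r) prev).val with
    | none => simp only [step_steps]; omega
    | some w =>
      cases best with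
      | none => simp; omega
      | some b => simp; omega
  · simp [h]
    omega

/-- `b` is the best of the entries `f r`, `r ∈ Q`. -/
lemma foldr_better (f : List ℕ → Option (ℝ × List (List ℕ))) (Q : List (List ℕ)) :
    match Q.foldr (fun r => better (f r)) none with
    | none => ∀ r ∈ Q, f r = none
    | some b => (∃ r ∈ Q, f r = some b) ∧ ∀ r ∈ Q, ∀ b', f r = some b' → b.1 ≤ b'.1 := by
  induction Q with
  | nil => simp
  | cons r Q ih =>
    rw [List.foldr_cons]
    cases hf : f r with
    | none =>
      simp only [better]
      cases hb : Q.foldr (fun r => better (f r)) none with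
      | none =>
        rw [hb] at ih
        simpa [hf] using ih
      | some b =>
        rw [hb] at ih
        simpa [hf] using ih
    | some a =>
      cases hb : Q.foldr (fun r => better (f r)) none with
      | none =>
        rw [hb] at ih
        simp only [better]
        refine ⟨⟨r, List.mem_cons_self, hf⟩, fun r' hr' b' hb' => ?_⟩
        rcases List.mem_cons.1 hr' with rfl | hr'
        · rw [hf, Option.some.injEq] at hb'
          rw [hb']
        · simp [ih r' hr'] at hb'
      | some b =>
        rw [hb] at ih
        obtain ⟨⟨r₁, hr₁, hfr₁⟩, hmin⟩ := ih
        simp only [better]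
        split_ifs with hab
        · refine ⟨⟨r, List.mem_cons_self, hf⟩, fun r' hr' b' hb' => ?_⟩
          rcases List.mem_cons.1 hr' with rfl | hr'
          · rw [hf, Option.some.injEq] at hb'
            rw [hb']
          · exact hab.trans (hmin r' hr' b' hb')
        · refine ⟨⟨r₁, List.mem_cons_of_mem _ hr₁, hfr₁⟩, fun r' hr' b' hb' => ?_⟩
          rcases List.mem_cons.1 hr' with rfl | hr'
          · rw [hf, Option.some.injEq] at hb'
            rw [← hb']
            exact (not_le.1 hab).le
          · exact hmin r' hr' b' hb'

/-- Bellman's principle: a split of `q` over `c :: cs` is a configuration `r ≤ q` for the first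
machine and a split of `q - r` over `cs`. The set of configurations is closed downwards, so all the
`r` and `q - r` that are needed occur in the table. -/
lemma isEntry_cons {ks : List ℕ} {as cs : List ℝ} {c : ℝ}
    {F : List ℕ → Option (ℝ × List (List ℕ))}
    (hF : ∀ q ∈ (configs ks).val, IsEntry as cs q (F q)) {q : List ℕ}
    (hq : q ∈ (configs ks).val) :
    IsEntry as (c :: cs) q
      ((configs ks).val.foldr (fun r => better (candidate as c F q r)) none) := by
  have hQ : ∀ r ∈ (configs ks).val, q.zipWith (· - ·) r ∈ (configs ks).val := fun r hr =>
    mem_configs.2 (forall₂_le_trans (forall₂_zipWith_sub_le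
      ((length_of_mem_configs hq).trans (length_of_mem_configs hr).symm)) (mem_configs.1 hq))
  have hle : ∀ r, List.Forall₂ (· ≤ ·) r q → r ∈ (configs ks).val := fun r hr =>
    mem_configs.2 (forall₂_le_trans hr (mem_configs.1 hq))
  have key := foldr_better (candidate as c F q) (configs ks).val
  cases hb : (configs ks).val.foldr (fun r => better (candidate as c F q r)) none with
  | none =>
    rw [hb] at key
    intro rs hlen hsplit
    cases rs with
    | nil => simp at hlen
    | cons r rs =>
      have hr := hle r hsplit.1
      have hc := key r hr
      rw [candidate, if_pos ((leConfig_val hsplit.1.length_eq).2 hsplit.1)] at hc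
      have hE := hF _ (hQ r hr)
      rw [Option.map_eq_none_iff.1 hc] at hE
      exact hE rs (by simpa using hlen) hsplit.2
  | some b =>
    rw [hb] at key
    obtain ⟨⟨r, hr, hrb⟩, hmin⟩ := key
    constructor
    · have hlen := (length_of_mem_configs hr).trans (length_of_mem_configs hq).symm
      unfold candidate at hrb
      split_ifs at hrb with hrq
      obtain ⟨w, hw, rfl⟩ := Option.map_eq_some_iff.1 hrb
      have hE := hF _ (hQ r hr)
      rw [hw] at hE
      obtain ⟨⟨h₁, h₂, h₃⟩, -⟩ := hE
      refine ⟨by simpa using h₁, ⟨(leConfig_val hlen).1 hrq, h₂⟩, ?_⟩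
      simp only [h₃, splitCost, List.zipWith_cons_cons, List.sum_cons]
      ring
    · intro rs hlen hsplit
      cases rs with
      | nil => simp at hlen
      | cons r' rs =>
        have hr' := hle r' hsplit.1
        have hE := hF _ (hQ r' hr')
        cases hw : F (q.zipWith (· - ·) r') with
        | none =>
          rw [hw] at hE
          exact absurd hsplit.2 (hE rs (by simpa using hlen))
        | some w =>
          rw [hw] at hE
          have h₁ := hE.2 rs (by simpa using hlen) hsplit.2
          have h₂ := hmin r' hr' (w.1 + max (loadConfig r' as).val c, r' :: w.2) (by
            rw [candidate, if_pos ((leConfig_val hsplit.1.length_eq).2 hsplit.1), hw]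
            rfl)
          simp only [splitCost, List.zipWith_cons_cons, List.sum_cons] at h₁ ⊢
          linarith

/-- The dynamic program computes optimal splits. -/
lemma exists_lastRow_eq (ks : List ℕ) (as cs : List ℝ) :
    ∃ F : List ℕ → Option (ℝ × List (List ℕ)),
      (lastRow (configs ks).val as cs).val = (configs ks).val.map (fun q => (q, F q)) ∧
      ∀ q ∈ (configs ks).val, IsEntry as cs q (F q) := by
  -- The row of the tail is the previous row, and the new machine's configuration is put in front.
  -- The recorded configurations thus come in the order of the capacities.
  induction cs with
  | nil =>
    refine ⟨fun q => if (isZeroConfig q).val then some (0, []) else none, ?_, fun q _ => ?_⟩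
    · simp only [lastRow, firstRow, mapT_val, bind_val, ite_val, step_val]
      exact List.map_congr_left fun q _ => by split_ifs <;> rfl
    · dsimp only
      split_ifs with h
      · refine ⟨⟨rfl, (isZeroConfig_val q).1 h, by simp [splitCost]⟩, fun rs _ _ => ?_⟩
        simp [splitCost]
      · intro rs hrs hsplit
        rw [List.length_nil, List.length_eq_zero_iff] at hrs
        subst hrs
        exact h ((isZeroConfig_val q).2 hsplit)
  | cons c cs ih =>
    obtain ⟨F, hF, hE⟩ := ih
    refine ⟨fun q => (configs ks).val.foldr (fun r => better (candidate as c F q r)) none, ?_,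
      fun q hq => isEntry_cons hE hq⟩
    rw [lastRow, bind_val, hF, nextRow_eq, mapT_val]
    refine List.map_congr_left fun q hq => ?_
    rw [bind_val, step_val, foldT_val]
    congr 1
    refine List.foldr_ext _ _ _ fun r hr b => ?_
    refine rowStep_val (mem_configs.2 (forall₂_le_trans (forall₂_zipWith_sub_le ?_)
      (mem_configs.1 hq))) b
    exact (length_of_mem_configs hq).trans (length_of_mem_configs hr).symm

end Configs

/-! ### From configurations back to jobs: correctness of the dynamic program. -/

section DynProg

variable {J : Type}

/-- The jobs of a list of types, with their processing times. -/
def typeJobs (gs : List (ℝ × List J)) : List (J × ℝ) := gs.flatMap fun g => g.2.map fun j => (j, g.1)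

@[simp] lemma typeJobs_nil : typeJobs ([] : List (ℝ × List J)) = [] := rfl

@[simp] lemma typeJobs_cons (g : ℝ × List J) (gs : List (ℝ × List J)) :
    typeJobs (g :: gs) = (g.2.map fun j => (j, g.1)) ++ typeJobs gs := rfl

lemma insertType_cons_val (a : J × ℝ) (g : ℝ × List J) (gs : List (ℝ × List J)) :
    (insertType a (g :: gs)).val =
      if a.2 = g.1 then (g.1, a.1 :: g.2) :: gs else g :: (insertType a gs).val := by
  simp [insertType]

lemma typeJobs_insertType (a : J × ℝ) (gs : List (ℝ × List J)) :
    (typeJobs (insertType a gs).val).Perm (a :: typeJobs gs) := by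
  induction gs with
  | nil => simp [insertType]
  | cons g gs ih =>
    rw [insertType_cons_val]
    split_ifs with h
    · simp [← h]
    · rw [typeJobs_cons, typeJobs_cons]
      exact (ih.append_left _).trans List.perm_middle

lemma mem_map_fst_insertType (a : J × ℝ) (gs : List (ℝ × List J)) (x : ℝ) :
    x ∈ (insertType a gs).val.map Prod.fst ↔ x = a.2 ∨ x ∈ gs.map Prod.fst := by
  induction gs with
  | nil => simp [insertType]
  | cons g gs ih =>
    rw [insertType_cons_val]
    split_ifs with h
    · simp only [List.map_cons, List.mem_cons, h]
      tauto
    · simp only [List.map_cons, List.mem_cons, ih]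
      tauto

lemma nodup_map_fst_insertType (a : J × ℝ) {gs : List (ℝ × List J)} (h : (gs.map Prod.fst).Nodup) :
    ((insertType a gs).val.map Prod.fst).Nodup := by
  induction gs with
  | nil => simp [insertType]
  | cons g gs ih =>
    rw [insertType_cons_val]
    rw [List.map_cons, List.nodup_cons] at h
    split_ifs with hag
    · simpa using h
    · rw [List.map_cons, List.nodup_cons, mem_map_fst_insertType]
      exact ⟨not_or.2 ⟨fun e => hag e.symm, h.1⟩, ih h.2⟩

lemma length_insertType_le (a : J × ℝ) (gs : List (ℝ × List J)) :
    (insertType a gs).val.length ≤ gs.length + 1 := by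
  induction gs with
  | nil => simp [insertType]
  | cons g gs ih =>
    rw [insertType_cons_val]
    split_ifs <;> simp [ih]

lemma insertType_steps_le (a : J × ℝ) (gs : List (ℝ × List J)) :
    (insertType a gs).steps ≤ 2 * gs.length + 1 := by
  induction gs with
  | nil => simp [insertType]
  | cons g gs ih =>
    simp only [insertType, bind_steps, ite_steps, step_steps, eqR_steps, List.length_cons]
    split_ifs <;> omega

/-- The list of types computed by the dynamic program. -/
noncomputable def typesOf (jobs : List (J × ℝ)) : List (ℝ × List J) := (foldT insertType [] jobs).val

lemma typeJobs_typesOf (jobs : List (J × ℝ)) : (typeJobs (typesOf jobs)).Perm jobs := by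
  induction jobs with
  | nil => exact List.Perm.refl _
  | cons a l ih => exact (typeJobs_insertType a _).trans (ih.cons a)

lemma mem_map_fst_typesOf (jobs : List (J × ℝ)) (x : ℝ) :
    x ∈ (typesOf jobs).map Prod.fst ↔ x ∈ jobs.map Prod.snd := by
  induction jobs with
  | nil => exact Iff.rfl
  | cons a l ih =>
    rw [typesOf, foldT_cons_val, mem_map_fst_insertType, List.map_cons, List.mem_cons]
    exact or_congr_right ih

lemma nodup_map_fst_typesOf (jobs : List (J × ℝ)) : ((typesOf jobs).map Prod.fst).Nodup := by
  induction jobs with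
  | nil => exact List.nodup_nil
  | cons a l ih => exact nodup_map_fst_insertType a ih

lemma length_typesOf_le (jobs : List (J × ℝ)) : (typesOf jobs).length ≤ jobs.length := by
  induction jobs with
  | nil => exact le_rfl
  | cons a l ih => exact (length_insertType_le a _).trans (Nat.succ_le_succ ih)

lemma length_snd_le_length_typeJobs {gs : List (ℝ × List J)} {g : ℝ × List J} (hg : g ∈ gs) :
    g.2.length ≤ (typeJobs gs).length := by
  induction gs with
  | nil => simp at hg
  | cons g' gs ih =>
    rw [typeJobs_cons, List.length_append, List.length_map]
    rcases List.mem_cons.1 hg with rfl | hg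
    · omega
    · have := ih hg
      omega

/-- The number of jobs of each of the types `ts`. -/
noncomputable def typeCounts (ts : List ℝ) (l : List (J × ℝ)) : List ℕ :=
  ts.map fun x => (l.map Prod.snd).count x

lemma typeCounts_perm (ts : List ℝ) {l l' : List (J × ℝ)} (h : l.Perm l') :
    typeCounts ts l = typeCounts ts l' :=
  List.map_congr_left fun _ _ => (h.map _).count_eq _

lemma forall₂_typeCounts_append (ts : List ℝ) (l l' : List (J × ℝ)) :
    List.Forall₂ (· ≤ ·) (typeCounts ts l) (typeCounts ts (l ++ l')) := by
  induction ts with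
  | nil => exact .nil
  | cons x ts ih => exact .cons (by simp) ih

lemma zipWith_sub_typeCounts_append (ts : List ℝ) (l l' : List (J × ℝ)) :
    (typeCounts ts (l ++ l')).zipWith (· - ·) (typeCounts ts l) = typeCounts ts l' := by
  induction ts with
  | nil => rfl
  | cons x ts ih =>
    simp only [typeCounts, List.map_cons, List.zipWith_cons_cons] at ih ⊢
    rw [ih]
    simp

/-- Every partition of the jobs gives a split of their counts; through this, optimality among splits
becomes optimality among partitions. -/
lemma isSplit_typeCounts (ts : List ℝ) (ls : List (List (J × ℝ))) :
    IsSplit (typeCounts ts ls.flatten) (ls.map (typeCounts ts)) := by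
  induction ls with
  | nil => simp [IsSplit, typeCounts]
  | cons l ls ih =>
    refine ⟨forall₂_typeCounts_append ts l _, ?_⟩
    rwa [List.flatten_cons, zipWith_sub_typeCounts_append]

/-- As the values of the types are distinct, a job is counted for its own type only. -/
lemma typeCounts_typeJobs {gs : List (ℝ × List J)} (h : (gs.map Prod.fst).Nodup) :
    typeCounts (gs.map Prod.fst) (typeJobs gs) = gs.map fun g => g.2.length := by
  have hcount : ∀ (gs : List (ℝ × List J)) (x : ℝ), x ∉ gs.map Prod.fst →
      ((typeJobs gs).map Prod.snd).count x = 0 := by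
    intro gs x hx
    rw [List.count_eq_zero]
    intro hmem
    simp only [typeJobs, List.mem_map, List.mem_flatMap] at hmem
    obtain ⟨_, ⟨g, hg, j, _, rfl⟩, rfl⟩ := hmem
    exact hx (List.mem_map_of_mem hg)
  have hself : ∀ g : ℝ × List J, ((g.2.map fun j => (j, g.1)).map Prod.snd).count g.1 =
      g.2.length := fun g => by
    rw [List.map_map, Function.comp_def, List.map_const', List.count_replicate_self]
  induction gs with
  | nil => rfl
  | cons g gs ih =>
    rw [List.map_cons, List.nodup_cons] at h
    rw [List.map_cons (f := fun g : ℝ × List J => g.2.length), ← ih h.2]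
    simp only [typeCounts, List.map_cons, typeJobs_cons, List.map_append, List.count_append,
      hself, hcount gs g.1 h.1, add_zero]
    congr 1
    refine List.map_congr_left fun x hx => ?_
    rw [List.count_eq_zero.2, zero_add]
    rw [List.map_map, List.mem_map]
    rintro ⟨_, _, rfl⟩
    exact h.1 hx

lemma loadConfig_map (ts : List ℝ) (f : ℝ → ℕ) :
    (loadConfig (ts.map f) ts).val = (ts.map fun x => (f x : ℝ) * x).sum := by
  induction ts with
  | nil => simp
  | cons x ts ih => simp [ih]

/-- Summation of the processing times by value. Types that do not occur in `l` contribute zero. -/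
lemma loadConfig_typeCounts {ts : List ℝ} (hts : ts.Nodup) {l : List (J × ℝ)}
    (hl : ∀ a ∈ l, a.2 ∈ ts) :
    (loadConfig (typeCounts ts l) ts).val = (l.map Prod.snd).sum := by
  rw [typeCounts, loadConfig_map, ← List.sum_toFinset _ hts]
  have := Finset.sum_list_map_count (l.map Prod.snd) (fun x : ℝ => x)
  rw [List.map_id'] at this
  rw [this]
  symm
  simp only [nsmul_eq_mul]
  refine Finset.sum_subset (fun x hx => ?_) fun x _ hx => ?_
  · rw [List.mem_toFinset, List.mem_map] at hx
    obtain ⟨a, ha, rfl⟩ := hx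
    exact List.mem_toFinset.2 (hl a ha)
  · rw [List.mem_toFinset] at hx
    rw [List.count_eq_zero.2 hx, Nat.cast_zero, zero_mul]

/-- The working time when the machines of capacities `cs` receive the jobs `ls`. -/
noncomputable def partCost (cs : List ℝ) (ls : List (List (J × ℝ))) : ℝ :=
  (cs.zipWith (fun c l => max (l.map Prod.snd).sum c) ls).sum

lemma splitCost_typeCounts {ts : List ℝ} (hts : ts.Nodup) (cs : List ℝ)
    {ls : List (List (J × ℝ))} (hls : ∀ l ∈ ls, ∀ a ∈ l, a.2 ∈ ts) :
    splitCost ts cs (ls.map (typeCounts ts)) = partCost cs ls := by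
  rw [splitCost, partCost]
  induction cs generalizing ls with
  | nil => rfl
  | cons c cs ih =>
    cases ls with
    | nil => rfl
    | cons l ls =>
      simp only [List.map_cons, List.zipWith_cons_cons, List.sum_cons,
        ih fun l hl => hls l (List.mem_cons_of_mem _ hl),
        loadConfig_typeCounts hts (hls l List.mem_cons_self)]

lemma takeConfig_cons_val (k : ℕ) (q : List ℕ) (g : ℝ × List J) (gs : List (ℝ × List J)) :
    (takeConfig (k :: q) (g :: gs)).val =
      (((g.2.take k).map fun j => (j, g.1)) ++ (takeConfig q gs).val.1,
        (g.1, g.2.drop k) :: (takeConfig q gs).val.2) := by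
  simp [takeConfig]

lemma takeConfig_perm (q : List ℕ) (gs : List (ℝ × List J)) :
    ((takeConfig q gs).val.1 ++ typeJobs (takeConfig q gs).val.2).Perm (typeJobs gs) := by
  induction q generalizing gs with
  | nil => cases gs <;> simp [takeConfig]
  | cons k q ih =>
    cases gs with
    | nil => simp [takeConfig]
    | cons g gs =>
      rw [takeConfig_cons_val, typeJobs_cons, typeJobs_cons]
      have h : (g.2.map fun j => (j, g.1)) = ((g.2.take k).map fun j => (j, g.1)) ++
          ((g.2.drop k).map fun j => (j, g.1)) := by
        rw [← List.map_append, List.take_append_drop]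
      rw [h, List.append_assoc, List.append_assoc]
      refine List.Perm.append_left _ ?_
      rw [← List.append_assoc]
      refine (List.perm_append_comm.append_right _).trans ?_
      rw [List.append_assoc]
      exact (ih gs).append_left _

lemma map_fst_takeConfig (q : List ℕ) (gs : List (ℝ × List J)) :
    (takeConfig q gs).val.2.map Prod.fst = gs.map Prod.fst := by
  induction q generalizing gs with
  | nil => cases gs <;> simp [takeConfig]
  | cons k q ih =>
    cases gs with
    | nil => simp [takeConfig]
    | cons g gs => rw [takeConfig_cons_val]; simp [ih]

lemma map_length_takeConfig {q : List ℕ} {gs : List (ℝ × List J)} (h : q.length = gs.length) :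
    ((takeConfig q gs).val.2.map fun g => g.2.length) =
      (gs.map fun g => g.2.length).zipWith (· - ·) q := by
  induction q generalizing gs with
  | nil => cases gs <;> simp_all [takeConfig]
  | cons k q ih =>
    cases gs with
    | nil => simp at h
    | cons g gs => rw [takeConfig_cons_val]; simp_all

/-- The bound on `q` guarantees that each type still has as many jobs as are to be taken. -/
lemma sum_takeConfig {q : List ℕ} {gs : List (ℝ × List J)}
    (h : List.Forall₂ (· ≤ ·) q (gs.map fun g => g.2.length)) :
    ((takeConfig q gs).val.1.map Prod.snd).sum = (loadConfig q (gs.map Prod.fst)).val := by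
  induction q generalizing gs with
  | nil => cases gs <;> simp [takeConfig]
  | cons k q ih =>
    cases gs with
    | nil => simp at h
    | cons g gs =>
      rw [List.map_cons, List.forall₂_cons] at h
      rw [takeConfig_cons_val]
      simp [ih h.2, Function.comp_def, List.map_const', h.1]

lemma distribute_cons_val (q : List ℕ) (qs : List (List ℕ)) (gs : List (ℝ × List J)) :
    (distribute (q :: qs) gs).val =
      (takeConfig q gs).val.1 :: (distribute qs (takeConfig q gs).val.2).val := by
  simp [distribute]

lemma length_distribute (qs : List (List ℕ)) (gs : List (ℝ × List J)) :
    (distribute qs gs).val.length = qs.length := by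
  induction qs generalizing gs with
  | nil => simp [distribute]
  | cons q qs ih => simp [distribute_cons_val, ih]

/-- Taking jobs subtracts the configuration from the counts. A split ends with zero counts, so no
job remains. -/
lemma flatten_distribute {qs : List (List ℕ)} {gs : List (ℝ × List J)}
    (h : IsSplit (gs.map fun g => g.2.length) qs) :
    (distribute qs gs).val.flatten.Perm (typeJobs gs) := by
  induction qs generalizing gs with
  | nil =>
    have : typeJobs gs = [] := by
      rw [typeJobs, List.flatMap_eq_nil_iff]
      intro g hg
      rw [List.map_eq_nil_iff, ← List.length_eq_zero_iff]
      exact h _ (List.mem_map_of_mem (f := fun g : ℝ × List J => g.2.length) hg)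
    simp [this, distribute]
  | cons q qs ih =>
    rw [distribute_cons_val, List.flatten_cons]
    refine List.Perm.trans (List.Perm.append_left _ (ih ?_)) (takeConfig_perm q gs)
    rw [map_length_takeConfig (by simpa using h.1.length_eq)]
    exact h.2

lemma partCost_distribute {qs : List (List ℕ)} {gs : List (ℝ × List J)} (cs : List ℝ)
    (h : IsSplit (gs.map fun g => g.2.length) qs) :
    partCost cs (distribute qs gs).val = splitCost (gs.map Prod.fst) cs qs := by
  rw [splitCost, partCost]
  induction qs generalizing gs cs with
  | nil => cases cs <;> simp [distribute]
  | cons q qs ih =>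
    cases cs with
    | nil => simp
    | cons c cs =>
      rw [distribute_cons_val, List.zipWith_cons_cons, List.zipWith_cons_cons, List.sum_cons,
        List.sum_cons, sum_takeConfig h.1, ih, map_fst_takeConfig]
      rw [map_length_takeConfig (by simpa using h.1.length_eq)]
      exact h.2

lemma takeConfig_steps_le (q : List ℕ) (gs : List (ℝ × List J)) :
    (takeConfig q gs).steps ≤ 4 * (typeJobs gs).length + 4 * gs.length + 1 := by
  induction q generalizing gs with
  | nil => cases gs <;> simp [takeConfig]
  | cons k q ih =>
    cases gs with
    | nil => simp [takeConfig]
    | cons g gs =>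
      have h₁ := splitT_steps_le k g.2
      have h₂ := mapT_steps_le (f := fun j => step (j, g.1)) (l := g.2.take k) (c := 1)
        fun _ _ => le_rfl
      have h₃ := ih gs
      simp only [List.length_take] at h₂
      simp only [takeConfig, bind_steps, splitT_val, appendT_steps, step_steps, typeJobs_cons,
        List.length_append, List.length_map, List.length_cons, mapT_val, List.length_take]
      omega

lemma distribute_steps_le (qs : List (List ℕ)) (gs : List (ℝ × List J)) :
    (distribute qs gs).steps ≤
      qs.length * (4 * (typeJobs gs).length + 4 * gs.length + 2) + 1 := by
  induction qs generalizing gs with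
  | nil => simp [distribute]
  | cons q qs ih =>
    have h₁ := takeConfig_steps_le q gs
    have h₂ := ih (takeConfig q gs).val.2
    have h₃ : (takeConfig q gs).val.2.length = gs.length := by
      simpa using congrArg List.length (map_fst_takeConfig q gs)
    have h₄ : (typeJobs (takeConfig q gs).val.2).length ≤ (typeJobs gs).length := by
      have := (takeConfig_perm q gs).length_eq
      rw [List.length_append] at this
      omega
    have h₅ : qs.length * (4 * (typeJobs (takeConfig q gs).val.2).length +
        4 * (takeConfig q gs).val.2.length + 2) ≤
        qs.length * (4 * (typeJobs gs).length + 4 * gs.length + 2) := by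
      rw [h₃]; gcongr
    simp only [distribute, bind_steps, step_steps, List.length_cons]
    linarith

/-- The parts of the dynamic program after the computation of the types. -/
lemma dynProg_eq (jobs : List (J × ℝ)) {caps : List ℝ} (hcaps : caps ≠ []) :
    ∃ rs : List (List ℕ), rs.length = caps.length ∧
      IsSplit ((typesOf jobs).map fun g => g.2.length) rs ∧
      (∀ rs', rs'.length = caps.length → IsSplit ((typesOf jobs).map fun g => g.2.length) rs' →
        splitCost ((typesOf jobs).map Prod.fst) caps rs ≤
          splitCost ((typesOf jobs).map Prod.fst) caps rs') ∧
      (dynProg jobs caps).val = (distribute rs (typesOf jobs)).val ∧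
      (dynProg jobs caps).steps = (foldT insertType [] jobs).steps +
        ((mapT (fun g : ℝ × List J => step g.1) (typesOf jobs)).steps +
        ((mapT (fun g : ℝ × List J => lengthT g.2) (typesOf jobs)).steps +
        ((configs ((typesOf jobs).map fun g => g.2.length)).steps +
        ((lastRow (configs ((typesOf jobs).map fun g => g.2.length)).val
          ((typesOf jobs).map Prod.fst) caps).steps +
        ((lookupRow ((typesOf jobs).map fun g => g.2.length)
          (lastRow (configs ((typesOf jobs).map fun g => g.2.length)).val
          ((typesOf jobs).map Prod.fst) caps).val).steps +
        (distribute rs (typesOf jobs)).steps))))) := by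
  set ks := (typesOf jobs).map fun g => g.2.length with hks
  set as := (typesOf jobs).map Prod.fst with has
  obtain ⟨F, hF, hE⟩ := exists_lastRow_eq ks as caps
  have hmem : ks ∈ (configs ks).val := mem_configs.2 (List.forall₂_same.2 fun _ _ => le_rfl)
  have hentry := hE ks hmem
  have hcounts : ks = typeCounts as jobs := by
    rw [hks, ← typeCounts_typeJobs (nodup_map_fst_typesOf jobs),
      typeCounts_perm _ (typeJobs_typesOf jobs)]
  cases hw : F ks with
  | none =>
    rw [hw] at hentry
    -- The entry cannot be infinite: since there is a machine, giving it all the jobs and the others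
    -- none is a split.
    refine absurd ?_ (hentry ((jobs :: List.replicate (caps.length - 1) []).map (typeCounts as)) ?_)
    · have := isSplit_typeCounts as (jobs :: List.replicate (caps.length - 1) [])
      rw [List.flatten_cons, List.flatten_replicate_nil, List.append_nil, ← hcounts] at this
      exact this
    · have := List.length_pos_of_ne_nil hcaps
      simp
      omega
  | some w =>
    rw [hw] at hentry
    obtain ⟨⟨h₁, h₂, h₃⟩, h₄⟩ := hentry
    have hlook : (lookupRow ks (lastRow (configs ks).val as caps).val).val = some w := by
      rw [hF, lookupRow_val hmem, hw]
    have hdyn : dynProg jobs caps = (do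
        let types ← foldT insertType [] jobs
        let as ← mapT (fun g => step g.1) types
        let counts ← mapT (fun g => lengthT g.2) types
        let Q ← configs counts
        let row ← lastRow Q as caps
        let w ← lookupRow counts row
        match w with
        | none => step []
        | some w => distribute w.2 types) := rfl
    refine ⟨w.2, h₁, h₂, fun rs' h h' => h₃ ▸ h₄ rs' h h', ?_, ?_⟩
    · rw [hdyn]
      simp only [bind_val, mapT_val, lengthT_val, step_val]
      change (match (lookupRow ks (lastRow (configs ks).val as caps).val).val with
        | none => step []
        | some w => distribute w.2 (typesOf jobs)).val = _
      rw [hlook]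
    · rw [hdyn]
      simp only [bind_steps, mapT_val, lengthT_val, step_val]
      change _ + (_ + (_ + (_ + (_ + (_ +
        (match (lookupRow ks (lastRow (configs ks).val as caps).val).val with
        | none => step []
        | some w => distribute w.2 (typesOf jobs)).steps))))) = _
      rw [hlook]
      rfl

/-- The dynamic program computes an optimal partition of the jobs. -/
theorem dynProg_spec (jobs : List (J × ℝ)) {caps : List ℝ} (hcaps : caps ≠ []) :
    (dynProg jobs caps).val.length = caps.length ∧
    (dynProg jobs caps).val.flatten.Perm jobs ∧
    ∀ ls : List (List (J × ℝ)), ls.length = caps.length → ls.flatten.Perm jobs →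
      partCost caps (dynProg jobs caps).val ≤ partCost caps ls := by
  obtain ⟨rs, hlen, hsplit, hmin, hval, -⟩ := dynProg_eq jobs hcaps
  rw [hval]
  refine ⟨(length_distribute _ _).trans hlen,
    (flatten_distribute hsplit).trans (typeJobs_typesOf jobs), fun ls hls hperm => ?_⟩
  have hnd := nodup_map_fst_typesOf jobs
  rw [partCost_distribute _ hsplit, ← splitCost_typeCounts hnd caps fun l hl a ha => by
    rw [mem_map_fst_typesOf]
    exact List.mem_map_of_mem (hperm.subset (List.mem_flatten.2 ⟨l, hl, ha⟩))]
  refine hmin _ (by simpa using hls) ?_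
  rw [← typeCounts_typeJobs hnd, typeCounts_perm _ ((typeJobs_typesOf jobs).trans hperm.symm)]
  exact isSplit_typeCounts _ ls

end DynProg

/-! ### Step count of the dynamic program. -/

section DynProgSteps

variable {J : Type}

/-- Each level of the recursion costs a constant times the number of configurations it produces, and
this number only grows from level to level. -/
lemma configs_steps_le (ks : List ℕ) :
    (configs ks).steps ≤ 10 * (ks.length + 1) * (configs ks).val.length := by
  induction ks with
  | nil => simp [configs]
  | cons k ks ih =>
    have hpos : 0 < (configs ks).val.length := by
      rw [length_configs]
      exact List.prod_pos (by simp)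
    have hlen : (configs (k :: ks)).val.length = (k + 1) * (configs ks).val.length := by
      rw [length_configs, length_configs, List.map_cons, List.prod_cons]
    have hfold : (foldT (fun x acc => do
        let l ← mapT (fun q => step (x :: q)) (configs ks).val
        appendT l acc) [] (List.range (k + 1)).reverse).steps ≤
        (List.range (k + 1)).reverse.length * (3 * (configs ks).val.length + 2 + 1) + 1 := by
      refine foldT_steps_le_of_forall fun x _ acc => ?_
      have := mapT_steps_le (f := fun q => step (x :: q)) (l := (configs ks).val) (c := 1)
        fun _ _ => le_rfl
      simp only [bind_steps, mapT_val, appendT_steps, List.length_map]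
      omega
    rw [List.length_reverse, List.length_range] at hfold
    rw [hlen]
    simp only [configs, bind_steps, addN, step_val, step_steps, rangeT_val, rangeT_steps,
      List.length_cons]
    generalize (configs ks).val.length = c at *
    have h₁ : (ks.length + 1) * c ≤ (k + 1) * ((ks.length + 1) * c) :=
      Nat.le_mul_of_pos_left _ (by omega)
    have h₂ : (k + 1) * 1 ≤ (k + 1) * c := Nat.mul_le_mul_left _ hpos
    have e₁ : 10 * (ks.length + 1) * c = 10 * ((ks.length + 1) * c) := by ring
    have e₂ : (k + 1) * (3 * c + 2 + 1) = 3 * ((k + 1) * c) + 3 * (k + 1) := by ring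
    have e₃ : 10 * (ks.length + 1 + 1) * ((k + 1) * c) =
      10 * ((k + 1) * ((ks.length + 1) * c)) + 10 * ((k + 1) * c) := by ring
    rw [e₁] at ih
    rw [e₂] at hfold
    rw [e₃]
    omega

lemma firstRow_steps_le {Q : List (List ℕ)} {T : ℕ} (hQ : ∀ q ∈ Q, q.length ≤ T) :
    (firstRow Q).steps ≤ Q.length * (2 * T + 3) + 1 := by
  refine mapT_steps_le (c := 2 * T + 2) fun q hq => ?_
  have h₁ := isZeroConfig_steps_le q
  have h₂ := hQ q hq
  simp only [bind_steps, ite_steps, step_steps]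
  split_ifs <;> omega

lemma nextRow_steps_le {Q : List (List ℕ)} {T : ℕ} (hQ : ∀ q ∈ Q, q.length ≤ T) (as : List ℝ)
    (c : ℝ) (prev : Row) : (nextRow Q as c prev).steps ≤
      Q.length * (Q.length * (prev.length * (2 * T + 2) + 8 * T + 10) + 3) + 1 := by
  rw [nextRow_eq]
  refine mapT_steps_le (c := Q.length * (prev.length * (2 * T + 2) + 8 * T + 10) + 2)
    fun q hq => ?_
  have := foldT_steps_le_of_forall (f := rowStep as c prev q) (b := none) (l := Q)
    fun r hr best => rowStep_steps_le as c prev (hQ q hq) (hQ r hr) best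
  simp only [bind_steps, step_steps]
  linarith

lemma length_lastRow (Q : List (List ℕ)) (as cs : List ℝ) :
    (lastRow Q as cs).val.length = Q.length := by
  cases cs <;> simp [lastRow, firstRow, nextRow]

lemma lastRow_steps_le {Q : List (List ℕ)} {T : ℕ} (hQ : ∀ q ∈ Q, q.length ≤ T)
    (as cs : List ℝ) : (lastRow Q as cs).steps ≤
      cs.length * (Q.length * (Q.length * (Q.length * (2 * T + 2) + 8 * T + 10) + 3) + 1) +
        (Q.length * (2 * T + 3) + 1) := by
  induction cs with
  | nil => simpa [lastRow] using firstRow_steps_le hQ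
  | cons c cs ih =>
    have := nextRow_steps_le hQ as c (lastRow Q as cs).val
    rw [length_lastRow] at this
    simp only [lastRow, bind_steps, List.length_cons]
    linarith

/-- The dynamic program takes `O(m * X ^ 4)` steps if `X` bounds the numbers of jobs and of
configurations. -/
lemma dynProg_steps_le {jobs : List (J × ℝ)} {caps : List ℝ} (hcaps : caps ≠ []) {X : ℕ}
    (hX : 1 ≤ X) (hjobs : jobs.length ≤ X)
    (hQ : ((typesOf jobs).map fun g => g.2.length + 1).prod ≤ X) :
    (dynProg jobs caps).steps ≤ caps.length * (100 * X ^ 4) := by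
  obtain ⟨rs, hlen, -, -, -, hsteps⟩ := dynProg_eq jobs hcaps
  have hm : 1 ≤ caps.length := List.length_pos_of_ne_nil hcaps
  have hT : (typesOf jobs).length ≤ X := (length_typesOf_le jobs).trans hjobs
  have hJ : (typeJobs (typesOf jobs)).length ≤ X := (typeJobs_typesOf jobs).length_eq.trans_le hjobs
  set ks := (typesOf jobs).map fun g => g.2.length with hks
  have hksl : ks.length ≤ X := by simpa [hks] using hT
  have hQ' : (configs ks).val.length ≤ X := by
    rw [length_configs, hks, List.map_map]
    exact hQ
  have hQl : ∀ q ∈ (configs ks).val, q.length ≤ X := fun q hq =>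
    (length_of_mem_configs hq).trans_le hksl
  have h₁ : (foldT insertType [] jobs).steps ≤ X * (2 * X + 1 + 1) + 1 := by
    refine (foldT_steps_le (c := 2 * X + 1) fun a l' hl' => ?_).trans (by gcongr)
    have := length_typesOf_le l'
    have h' := hl'.length_le
    rw [List.length_cons] at h'
    refine (insertType_steps_le a _).trans ?_
    change 2 * (typesOf l').length + 1 ≤ _
    omega
  have h₂ : (mapT (fun g : ℝ × List J => step g.1) (typesOf jobs)).steps ≤ X * (1 + 1) + 1 :=
    (mapT_steps_le (c := 1) fun _ _ => le_rfl).trans (by gcongr)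
  have h₃ : (mapT (fun g : ℝ × List J => lengthT g.2) (typesOf jobs)).steps ≤
      X * (X + 1 + 1) + 1 := by
    refine (mapT_steps_le (c := X + 1) fun g hg => ?_).trans (by gcongr)
    rw [lengthT_steps]
    have := length_snd_le_length_typeJobs hg
    omega
  have h₄ : (configs ks).steps ≤ 10 * (X + 1) * X := (configs_steps_le ks).trans (by gcongr)
  have h₅ : (lastRow (configs ks).val ((typesOf jobs).map Prod.fst) caps).steps ≤
      caps.length * (X * (X * (X * (2 * X + 2) + 8 * X + 10) + 3) + 1) + (X * (2 * X + 3) + 1) :=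
    (lastRow_steps_le hQl _ _).trans (by gcongr)
  have h₆ : (lookupRow ks
      (lastRow (configs ks).val ((typesOf jobs).map Prod.fst) caps).val).steps ≤
      X * (2 * X + 2) + 1 := by
    refine (lookupRow_steps_le _ _).trans ?_
    rw [length_lastRow]
    gcongr
  have h₇ : (distribute rs (typesOf jobs)).steps ≤ caps.length * (4 * X + 4 * X + 2) + 1 :=
    (distribute_steps_le _ _).trans (by rw [hlen]; gcongr)
  rw [hsteps]
  -- Consecutive powers of `X` are comparable as `1 ≤ X`; this is what the linear arithmetic below
  -- needs. The costs are then split into a part paid once, absorbed by one machine, and a part paid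
  -- per machine.
  have p₁ : 1 * X ≤ X * X := Nat.mul_le_mul_right _ hX
  have p₂ : 1 * X ^ 2 ≤ X * X ^ 2 := Nat.mul_le_mul_right _ hX
  have p₃ : 1 * X ^ 3 ≤ X * X ^ 3 := Nat.mul_le_mul_right _ hX
  have hfix : X * (2 * X + 1 + 1) + 1 + (X * (1 + 1) + 1 + (X * (X + 1 + 1) + 1 +
      (10 * (X + 1) * X + ((X * (2 * X + 3) + 1) + (X * (2 * X + 2) + 1 + 1))))) ≤ 60 * X ^ 4 := by
    linarith
  have hvar : X * (X * (X * (2 * X + 2) + 8 * X + 10) + 3) + 1 + (4 * X + 4 * X + 2) ≤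
      40 * X ^ 4 := by
    linarith
  have hvar' := Nat.mul_le_mul_left caps.length hvar
  have hfix' : 60 * X ^ 4 ≤ caps.length * (60 * X ^ 4) := Nat.le_mul_of_pos_left _ hm
  rw [mul_add] at hvar'
  have : caps.length * (100 * X ^ 4) =
      caps.length * (40 * X ^ 4) + caps.length * (60 * X ^ 4) := by ring
  omega

end DynProgSteps

/-! ### The loop over the blocks. -/

section ScheduleBlocks

variable {J : Type} {m : ℕ}

lemma flatten_ofFn_single {α : Type} {m : ℕ} (q : Fin m) (l : List α) :
    (List.ofFn fun q' => if q' = q then l else []).flatten = l := by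
  induction m with
  | zero => exact q.elim0
  | succ m ih =>
    rw [List.ofFn_succ, List.flatten_cons]
    cases q using Fin.cases with
    | zero => simp [Fin.succ_ne_zero]
    | succ q =>
      have : (fun i : Fin m => if i.succ = q.succ then l else []) =
          fun i => if i = q then l else [] := by
        funext i
        simp [Fin.succ_inj]
      rw [this, ih q, if_neg (Fin.succ_ne_zero q).symm, List.nil_append]

lemma flatten_ofFn_filter_perm {α : Type} (f : α → Fin m) (l : List α) :
    (List.ofFn fun q => l.filter fun a => f a = q).flatten.Perm l := by
  induction l with
  | nil =>
    rw [List.perm_nil, List.flatten_eq_nil_iff]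
    simp
  | cons a l ih =>
    refine List.Perm.trans ?_ (ih.cons a)
    have key : ∀ {m : ℕ} (q : Fin m) (h : Fin m → List α),
        (List.ofFn fun q' => if q = q' then a :: h q' else h q').flatten.Perm
          (a :: (List.ofFn h).flatten) := by
      intro m
      induction m with
      | zero => exact fun q => q.elim0
      | succ m ih =>
        intro q h
        rw [List.ofFn_succ, List.ofFn_succ, List.flatten_cons, List.flatten_cons]
        cases q using Fin.cases with
        | zero => simp [(Fin.succ_ne_zero _).symm]
        | succ q =>
          rw [if_neg (Fin.succ_ne_zero q)]
          simp only [Fin.succ_inj]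
          exact ((ih q fun i => h i.succ).append_left _).trans List.perm_middle
    have e : (fun q => (a :: l).filter fun a => f a = q) = fun q =>
        if f a = q then a :: l.filter (fun a => f a = q) else l.filter fun a => f a = q := by
      funext q
      rw [List.filter_cons]
      simp
    rw [e]
    exact key (f a) _

/-- The jobs that `σ` puts on machine `q`. -/
def onMachine (σ : J → Fin m) (l : List (J × ℝ)) (q : Fin m) : List (J × ℝ) :=
  l.filter fun a => σ a.1 = q

/-- The total processing time that `σ` puts on machine `q`. -/
noncomputable def listLoad (σ : J → Fin m) (l : List (J × ℝ)) (q : Fin m) : ℝ :=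
  ((onMachine σ l q).map Prod.snd).sum

lemma onMachine_congr {σ τ : J → Fin m} {l : List (J × ℝ)} (h : ∀ a ∈ l, σ a.1 = τ a.1)
    (q : Fin m) : onMachine σ l q = onMachine τ l q :=
  List.filter_congr fun a ha => by rw [h a ha]

lemma listLoad_congr {σ τ : J → Fin m} {l : List (J × ℝ)} (h : ∀ a ∈ l, σ a.1 = τ a.1)
    (q : Fin m) : listLoad σ l q = listLoad τ l q := by
  rw [listLoad, listLoad, onMachine_congr h]

lemma onMachine_append (σ : J → Fin m) (l l' : List (J × ℝ)) (q : Fin m) :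
    onMachine σ (l ++ l') q = onMachine σ l q ++ onMachine σ l' q := List.filter_append ..

lemma listLoad_perm (σ : J → Fin m) {l l' : List (J × ℝ)} (h : l.Perm l') (q : Fin m) :
    listLoad σ l q = listLoad σ l' q := ((h.filter _).map _).sum_eq

/-- The working schedule `w` puts the jobs of `S` on the machines given by `σ`. -/
def Represents (c : Fin m → ℝ) (σ : J → Fin m) (S : List (J × ℝ))
    (w : WorkingSchedule J (Fin m)) : Prop :=
  ∃ g : Fin m → List (J × ℝ), w = List.ofFn (fun q => (q, c q, g q)) ∧
    ∀ q, (g q).Perm (onMachine σ S q)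

/-- `σ` is optimal for the jobs of `l`, for the capacities left by the jobs of `S`. -/
def IsBlockOptimal (c : Fin m → ℝ) (σ : J → Fin m) (l S : List (J × ℝ)) : Prop :=
  ∀ τ : J → Fin m, ∑ q, max (listLoad σ l q) (max (c q - listLoad σ S q) 0) ≤
    ∑ q, max (listLoad τ l q) (max (c q - listLoad σ S q) 0)

lemma foldT_addR_val (l : List (J × ℝ)) :
    (foldT (fun a r => addR a.2 r) 0 l).val = (l.map Prod.snd).sum := by
  induction l with
  | nil => rfl
  | cons a l ih => rw [foldT_cons_val, ih]; rfl

lemma residualCap_val (s : Fin m × ℝ × List (J × ℝ)) :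
    (residualCap s).val = max (s.2.1 - (s.2.2.map Prod.snd).sum) 0 := by
  simp only [residualCap, bind_val, foldT_addR_val, subR, step_val, maxR_val]

lemma residualCap_steps_le (s : Fin m × ℝ × List (J × ℝ)) :
    (residualCap s).steps ≤ 2 * s.2.2.length + 4 := by
  have := foldT_steps_le_of_forall (f := fun (a : J × ℝ) r => addR a.2 r) (b := 0) (l := s.2.2)
    (c := 1) fun _ _ _ => le_rfl
  simp only [residualCap, bind_steps, subR, step_steps, maxR_steps]
  omega

lemma mergeT_ofFn_val (c : Fin m → ℝ) (h g : Fin m → List (J × ℝ)) :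
    (mergeT (List.ofFn h) (List.ofFn fun q => (q, c q, g q))).val =
      List.ofFn fun q => (q, c q, h q ++ g q) := by
  -- The tail of a list indexed by `Fin m` is indexed by a smaller `Fin k` with shifted labels, so
  -- the induction needs an arbitrary labelling `f`.
  have key : ∀ {k : ℕ} (f : Fin k → Fin m) (h : Fin k → List (J × ℝ)),
      (mergeT (List.ofFn h) (List.ofFn fun q => (f q, c (f q), g (f q)))).val =
      List.ofFn fun q => (f q, c (f q), h q ++ g (f q)) := by
    intro k
    induction k with
    | zero => intro f h; simp [mergeT]
    | succ k ih =>
      intro f h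
      simp only [List.ofFn_succ, mergeT, bind_val, appendT_val, step_val]
      rw [ih (fun i => f i.succ) fun i => h i.succ]
  exact key id h

lemma mergeT_steps_le (ls : List (List (J × ℝ))) (w : WorkingSchedule J (Fin m)) :
    (mergeT ls w).steps ≤ ls.flatten.length + 2 * ls.length + 1 := by
  induction ls generalizing w with
  | nil => cases w <;> simp [mergeT]
  | cons l ls ih =>
    cases w with
    | nil => simp [mergeT]
    | cons s w =>
      have := ih w
      simp only [mergeT, bind_steps, appendT_steps, step_steps, List.flatten_cons,
        List.length_append, List.length_cons]
      omega

lemma partCost_ofFn (c : Fin m → ℝ) (h : Fin m → List (J × ℝ)) :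
    partCost (List.ofFn c) (List.ofFn h) = ∑ q, max ((h q).map Prod.snd).sum (c q) := by
  rw [partCost, ← List.sum_ofFn]
  congr 1
  exact List.ext_getElem (by simp) fun i h₁ h₂ => by simp

/-- Distinct labels put each job on one machine only, so the lists determine a map. Keeping `σ₀` on
all other jobs makes it an extension of an earlier schedule. -/
lemma exists_assignment {h : Fin m → List (J × ℝ)}
    (hnd : ((List.ofFn h).flatten.map Prod.fst).Nodup) (σ₀ : J → Fin m) :
    ∃ σ : J → Fin m, (∀ q, ∀ a ∈ h q, σ a.1 = q) ∧
      ∀ j, j ∉ (List.ofFn h).flatten.map Prod.fst → σ j = σ₀ j := by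
  classical
  have huniq : ∀ q q', ∀ a ∈ h q, ∀ a' ∈ h q', a.1 = a'.1 → q = q' := by
    rw [List.map_flatten, List.map_ofFn, List.nodup_flatten, List.pairwise_ofFn] at hnd
    intro q q' a ha a' ha' e
    by_contra hne
    rcases lt_or_gt_of_ne hne with hlt | hlt
    · exact hnd.2 hlt (List.mem_map_of_mem ha) (e ▸ List.mem_map_of_mem ha')
    · exact hnd.2 hlt (List.mem_map_of_mem ha') (e ▸ List.mem_map_of_mem ha)
  refine ⟨fun j => if hj : ∃ q, ∃ a ∈ h q, a.1 = j then hj.choose else σ₀ j, ?_, ?_⟩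
  · intro q a ha
    have hj : ∃ q, ∃ a' ∈ h q, a'.1 = a.1 := ⟨q, a, ha, rfl⟩
    simp only [dif_pos hj]
    obtain ⟨a', ha', e⟩ := hj.choose_spec
    exact huniq _ _ a' ha' a ha e
  · intro j hj
    refine dif_neg ?_
    rintro ⟨q, a, ha, rfl⟩
    exact hj (List.mem_map_of_mem (List.mem_flatten.2 ⟨h q, List.mem_ofFn.2 ⟨q, rfl⟩, ha⟩))

lemma filter_flatten_ofFn {h : Fin m → List (J × ℝ)} {σ : J → Fin m}
    (hσ : ∀ q, ∀ a ∈ h q, σ a.1 = q) (q : Fin m) :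
    onMachine σ (List.ofFn h).flatten q = h q := by
  rw [onMachine, List.filter_flatten, List.map_ofFn]
  have : (List.filter (fun a : J × ℝ => decide (σ a.1 = q)) ∘ h) =
      fun q' => if q' = q then h q else [] := by
    funext q'
    rw [Function.comp_apply]
    split_ifs with hq
    · subst hq
      exact List.filter_eq_self.2 fun a ha => by simp [hσ q' a ha]
    · exact List.filter_eq_nil_iff.2 fun a ha => by simp [hσ q' a ha, hq]
  rw [this, flatten_ofFn_single]

/-- An optimal partition of the jobs of `l` extends the schedule `σ` of `S`. -/
lemma exists_extension (hm : 0 < m) {c : Fin m → ℝ} {σ : J → Fin m} {S l : List (J × ℝ)}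
    {w : WorkingSchedule J (Fin m)} (hw : Represents c σ S w)
    (hnd : ((l ++ S).map Prod.fst).Nodup) :
    ∃ σ' : J → Fin m, (∀ a ∈ S, σ' a.1 = σ a.1) ∧
      Represents c σ' (l ++ S) (mergeT (dynProg l (mapT residualCap w).val).val w).val ∧
      IsBlockOptimal c σ' l S := by
  obtain ⟨g, rfl, hg⟩ := hw
  have hload : ∀ q, ((g q).map Prod.snd).sum = listLoad σ S q := fun q => ((hg q).map _).sum_eq
  have hcaps : (mapT residualCap (List.ofFn fun q => (q, c q, g q))).val =
      List.ofFn fun q => max (c q - listLoad σ S q) 0 := by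
    rw [mapT_val, List.map_ofFn]
    congr 1
    funext q
    rw [Function.comp_apply, residualCap_val, hload]
  rw [hcaps]
  obtain ⟨hlen, hperm, hmin⟩ := dynProg_spec l
    (caps := List.ofFn fun q => max (c q - listLoad σ S q) 0) (by
      rw [← List.length_pos_iff_ne_nil]; simpa)
  generalize (dynProg l (List.ofFn fun q => max (c q - listLoad σ S q) 0)).val = ls at *
  obtain ⟨h, rfl⟩ : ∃ h : Fin m → List (J × ℝ), ls = List.ofFn h := by
    rw [List.length_ofFn] at hlen
    subst hlen
    exact ⟨ls.get, (List.ofFn_get ls).symm⟩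
  rw [List.map_append, List.nodup_append] at hnd
  obtain ⟨hndl, -, hdisj⟩ := hnd
  obtain ⟨σ', hσ', hσ'S⟩ := exists_assignment ((hperm.map Prod.fst).nodup_iff.2 hndl) σ
  have hS : ∀ a ∈ S, σ' a.1 = σ a.1 := fun a ha => hσ'S _ fun hmem =>
    hdisj _ ((hperm.map Prod.fst).subset hmem) _ (List.mem_map_of_mem ha) rfl
  have hon : ∀ q, (h q).Perm (onMachine σ' l q) := fun q => by
    have := hperm.filter fun a => σ' a.1 = q
    rwa [← onMachine, filter_flatten_ofFn hσ'] at this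
  refine ⟨σ', hS, ⟨fun q => h q ++ g q, mergeT_ofFn_val c h g, fun q => ?_⟩, fun τ => ?_⟩
  · rw [onMachine_append]
    exact (hon q).append ((hg q).trans (by rw [onMachine_congr hS]))
  -- A competing map enters the comparison through the partition of the jobs into its fibres.
  · have := hmin (List.ofFn fun q => onMachine τ l q) (by simp)
      (flatten_ofFn_filter_perm (fun a : J × ℝ => τ a.1) l)
    rw [partCost_ofFn, partCost_ofFn] at this
    simp only [listLoad_congr hS]
    refine le_trans (le_of_eq ?_) this
    exact Finset.sum_congr rfl fun q _ => by rw [listLoad, ((hon q).map Prod.snd).sum_eq]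

lemma map_fst_roundDown (ε : ℝ) (l : List (J × ℝ)) :
    (roundDown ε l).val.map Prod.fst = l.map Prod.fst := by
  cases l <;> simp [roundDown]

/-- The rounded jobs of a list of blocks. -/
noncomputable def roundedJobs (ε : ℝ) (bs : List (ℕ × List (J × ℝ))) : List (J × ℝ) :=
  bs.flatMap fun b => (roundDown ε b.2).val

/-- Optimality of a block involves the schedule only on this block and on the jobs before it.
Distinct labels let later blocks extend the map without changing it there, so optimality survives to
the end of the loop. -/
lemma scheduleBlocks_spec (hm : 0 < m) {c : Fin m → ℝ} (ε : ℝ) {X : ℕ} (hX : 1 ≤ X)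
    (bs : List (ℕ × List (J × ℝ))) {S : List (J × ℝ)} {σ : J → Fin m}
    {w : WorkingSchedule J (Fin m)} (hw : Represents c σ S w)
    (hnd : ((roundedJobs ε bs ++ S).map Prod.fst).Nodup)
    (hlen : (roundedJobs ε bs ++ S).length ≤ X)
    (hlog : ∀ b ∈ bs, ∀ a ∈ b.2, ∀ a' ∈ b.2, ⌊Real.logb (1 + ε) (a'.2 / a.2)⌋₊ ≤ X)
    (hQ : ∀ b ∈ bs, ((typesOf (roundDown ε b.2).val).map fun g => g.2.length + 1).prod ≤ X) :
    ∃ σ' : J → Fin m, (∀ a ∈ S, σ' a.1 = σ a.1) ∧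
      Represents c σ' (roundedJobs ε bs ++ S) (scheduleBlocks ε bs w).val ∧
      (∀ bs₁ b bs₂, bs = bs₁ ++ b :: bs₂ →
        IsBlockOptimal c σ' (roundDown ε b.2).val (roundedJobs ε bs₁ ++ S)) ∧
      (scheduleBlocks ε bs w).steps ≤ bs.length * (m * (150 * X ^ 4)) + 1 := by
  induction bs generalizing S σ w with
  | nil => exact ⟨σ, fun _ _ => rfl, by simpa [scheduleBlocks, roundedJobs] using hw, by simp,
      by simp [scheduleBlocks]⟩
  | cons b bs ih =>
    have hcons : roundedJobs ε (b :: bs) = (roundDown ε b.2).val ++ roundedJobs ε bs := rfl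
    -- The program prepends each new block, whereas the specification lists the blocks in order;
    -- loads see jobs only up to permutation.
    have hperm : (roundedJobs ε (b :: bs) ++ S).Perm
        (roundedJobs ε bs ++ ((roundDown ε b.2).val ++ S)) := by
      rw [hcons, ← List.append_assoc]
      exact List.perm_append_comm.append_right _
    have hnd' := ((hperm.map Prod.fst).nodup_iff.1 hnd)
    have hlen' := hperm.length_eq ▸ hlen
    have hnd₁ : (((roundDown ε b.2).val ++ S).map Prod.fst).Nodup := by
      rw [List.map_append] at hnd'
      exact (List.nodup_append.1 hnd').2.1
    obtain ⟨σ₁, hσ₁, hw₁, hopt₁⟩ := exists_extension hm hw hnd₁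
    obtain ⟨σ', hσ', hw', hopt', hsteps⟩ := ih hw₁ hnd' hlen'
      (fun b' hb' => hlog b' (List.mem_cons_of_mem _ hb'))
      (fun b' hb' => hQ b' (List.mem_cons_of_mem _ hb'))
    have hS : ∀ a ∈ S, σ' a.1 = σ₁ a.1 := fun a ha => hσ' a (List.mem_append_right _ ha)
    refine ⟨σ', fun a ha => (hS a ha).trans (hσ₁ a ha), ?_, ?_, ?_⟩
    · obtain ⟨g, hg, hgp⟩ := hw'
      exact ⟨g, hg, fun q => (hgp q).trans (hperm.symm.filter _)⟩
    · intro bs₁ b' bs₂ e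
      cases bs₁ with
      | nil =>
        obtain ⟨rfl, rfl⟩ := List.cons.inj e
        intro τ
        have := hopt₁ τ
        have h₂ : ∀ q, listLoad σ' (roundDown ε b.2).val q = listLoad σ₁ (roundDown ε b.2).val q :=
          listLoad_congr fun a ha => hσ' a (List.mem_append_left _ ha)
        simpa only [roundedJobs, List.flatMap_nil, List.nil_append, h₂, listLoad_congr hS]
          using this
      | cons b₁ bs₁ =>
        obtain ⟨rfl, e'⟩ := List.cons.inj e
        intro τ
        have := hopt' bs₁ b' bs₂ e' τ
        have hp : (roundedJobs ε bs₁ ++ ((roundDown ε b.2).val ++ S)).Perm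
            (roundedJobs ε (b :: bs₁) ++ S) := by
          rw [← List.append_assoc]
          exact List.perm_append_comm.append_right _
        simpa only [listLoad_perm σ' hp] using this
    · have hwlen : w.length = m := by
        obtain ⟨g, rfl, -⟩ := hw
        simp
      have hws : ∀ s ∈ w, s.2.2.length ≤ X := by
        obtain ⟨g, rfl, hg⟩ := hw
        intro s hs
        obtain ⟨q, rfl⟩ := List.mem_ofFn.1 hs
        refine (hg q).length_eq.trans_le ((List.length_filter_le _ _).trans ?_)
        rw [List.length_append] at hlen
        omega
      have hcaps : (mapT residualCap w).val.length = m := by rw [mapT_val, List.length_map, hwlen]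
      have hcaps₀ : (mapT residualCap w).val ≠ [] := by
        rw [← List.length_pos_iff_ne_nil, hcaps]
        exact hm
      have hbl : (roundDown ε b.2).val.length = b.2.length := by
        simpa using congrArg List.length (map_fst_roundDown ε b.2)
      have hblX : b.2.length ≤ X := by
        rw [hcons, List.length_append, List.length_append, hbl] at hlen
        omega
      have h₁ : (mapT residualCap w).steps ≤ m * (2 * X + 4 + 1) + 1 := by
        have := mapT_steps_le (c := 2 * X + 4) fun s hs => (residualCap_steps_le s).trans
          (Nat.add_le_add_right (Nat.mul_le_mul_left 2 (hws s hs)) 4)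
        rwa [hwlen] at this
      have h₂ : (roundDown ε b.2).steps ≤ X * (X + 9) + 3 :=
        (roundDown_steps_le (hlog b List.mem_cons_self)).trans (by gcongr)
      have h₃ := dynProg_steps_le hcaps₀ hX (hbl.trans_le hblX) (hQ b List.mem_cons_self)
      rw [hcaps] at h₃
      obtain ⟨hl₁, hl₂, -⟩ := dynProg_spec (roundDown ε b.2).val hcaps₀
      have h₄ := mergeT_steps_le (dynProg (roundDown ε b.2).val (mapT residualCap w).val).val w
      rw [hl₁, hcaps, hl₂.length_eq, hbl] at h₄
      have hst : (scheduleBlocks ε (b :: bs) w).steps = (mapT residualCap w).steps +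
          (((roundDown ε b.2).steps +
            (dynProg (roundDown ε b.2).val (mapT residualCap w).val).steps) +
          ((mergeT (dynProg (roundDown ε b.2).val (mapT residualCap w).val).val w).steps +
          (scheduleBlocks ε bs
            (mergeT (dynProg (roundDown ε b.2).val (mapT residualCap w).val).val w).val).steps)) :=
        rfl
      rw [hst, List.length_cons]
      have p₁ : 1 * X ≤ X * X := Nat.mul_le_mul_right _ hX
      have p₂ : 1 * X ^ 2 ≤ X * X ^ 2 := Nat.mul_le_mul_right _ hX
      have p₃ : 1 * X ^ 3 ≤ X * X ^ 3 := Nat.mul_le_mul_right _ hX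
      -- Per block, the dynamic program takes `100`, and the remaining work `20` once and `20` per
      -- machine, in units of `X ^ 4`; this stays below `150` per machine.
      have q₁ : X * (X + 9) + 3 + X + 1 + 1 ≤ 20 * X ^ 4 := by linarith
      have q₂ : 2 * X + 4 + 1 + 2 ≤ 20 * X ^ 4 := by linarith
      have q₁' : 20 * X ^ 4 ≤ m * (20 * X ^ 4) := Nat.le_mul_of_pos_left _ hm
      have q₂' := Nat.mul_le_mul_left m q₂
      linarith

end ScheduleBlocks

/-! ### Splitting the jobs into the discarded class and the blocks. -/

section SplitJobs

variable {J : Type}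

@[simp] lemma blockIndex_val (K t l : ℕ) : (blockIndex K t l).val = blockOf K t l := by
  simp [blockIndex, blockOf]

lemma blockIndex_steps_le (K t l : ℕ) : (blockIndex K t l).steps ≤ 4 := by
  simp only [blockIndex, bind_steps, ite_steps, leN_steps, subN, divN, addN, step_steps]
  split_ifs <;> omega

/-- The jobs of block `i` in a list of blocks. -/
def jobsOf (bs : List (ℕ × List (J × ℝ))) (i : ℕ) : List (J × ℝ) :=
  bs.flatMap fun b => if b.1 = i then b.2 else []

lemma insertBlock_cons_val (i : ℕ) (a : J × ℝ) (b : ℕ × List (J × ℝ))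
    (bs : List (ℕ × List (J × ℝ))) : (insertBlock i a (b :: bs)).val =
      if i = b.1 then (b.1, a :: b.2) :: bs else
        if i ≤ b.1 then (i, [a]) :: b :: bs else b :: (insertBlock i a bs).val := by
  simp [insertBlock]

lemma insertBlock_steps_le (i : ℕ) (a : J × ℝ) (bs : List (ℕ × List (J × ℝ))) :
    (insertBlock i a bs).steps ≤ 3 * bs.length + 1 := by
  induction bs with
  | nil => simp [insertBlock]
  | cons b bs ih =>
    simp only [insertBlock, bind_steps, ite_steps, step_steps, eqN_steps, leN_steps,
      List.length_cons]
    split_ifs <;> omega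

lemma length_insertBlock_le (i : ℕ) (a : J × ℝ) (bs : List (ℕ × List (J × ℝ))) :
    (insertBlock i a bs).val.length ≤ bs.length + 1 := by
  induction bs with
  | nil => simp [insertBlock]
  | cons b bs ih =>
    rw [insertBlock_cons_val]
    split_ifs <;> simp [ih]

lemma insertBlock_perm (i : ℕ) (a : J × ℝ) (bs : List (ℕ × List (J × ℝ))) :
    ((insertBlock i a bs).val.flatMap Prod.snd).Perm (a :: bs.flatMap Prod.snd) := by
  induction bs with
  | nil => simp [insertBlock]
  | cons b bs ih =>
    rw [insertBlock_cons_val]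
    split_ifs
    · simp
    · simp
    · rw [List.flatMap_cons, List.flatMap_cons]
      exact (ih.append_left _).trans List.perm_middle

lemma fst_mem_insertBlock (i : ℕ) (a : J × ℝ) (bs : List (ℕ × List (J × ℝ))) :
    ∀ b ∈ (insertBlock i a bs).val, b.1 = i ∨ ∃ b' ∈ bs, b'.1 = b.1 := by
  induction bs with
  | nil => simp [insertBlock]
  | cons b bs ih =>
    rw [insertBlock_cons_val]
    intro b' hb'
    split_ifs at hb' with h₁ h₂
    · rcases List.mem_cons.1 hb' with rfl | hb'
      · exact .inl h₁.symm
      · exact .inr ⟨b', List.mem_cons_of_mem _ hb', rfl⟩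
    · rcases List.mem_cons.1 hb' with rfl | hb'
      · exact .inl rfl
      · exact .inr ⟨b', hb', rfl⟩
    · rcases List.mem_cons.1 hb' with rfl | hb'
      · exact .inr ⟨b', List.mem_cons_self, rfl⟩
      · exact (ih b' hb').imp id fun ⟨b'', h, e⟩ => ⟨b'', List.mem_cons_of_mem _ h, e⟩

lemma insertBlock_pairwise (i : ℕ) (a : J × ℝ) {bs : List (ℕ × List (J × ℝ))}
    (h : bs.Pairwise fun b b' => b.1 < b'.1) :
    (insertBlock i a bs).val.Pairwise fun b b' => b.1 < b'.1 := by
  induction bs with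
  | nil => simp [insertBlock]
  | cons b bs ih =>
    rw [insertBlock_cons_val]
    have h' := List.pairwise_cons.1 h
    split_ifs with h₁ h₂
    · exact List.pairwise_cons.2 h'
    · refine List.pairwise_cons.2 ⟨List.forall_mem_cons.2 ⟨by dsimp; omega, fun b' hb' => ?_⟩, h⟩
      have := h'.1 b' hb'
      dsimp
      omega
    · refine List.pairwise_cons.2 ⟨fun b' hb' => ?_, ih h'.2⟩
      rcases fst_mem_insertBlock i a bs b' hb' with e | ⟨b'', hb'', e⟩
      · omega
      · exact e ▸ h'.1 b'' hb''

lemma jobsOf_eq_nil {bs : List (ℕ × List (J × ℝ))} {i : ℕ} (h : ∀ b ∈ bs, b.1 ≠ i) :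
    jobsOf bs i = [] :=
  List.flatMap_eq_nil_iff.2 fun b hb => if_neg (h b hb)

lemma jobsOf_cons (b : ℕ × List (J × ℝ)) (bs : List (ℕ × List (J × ℝ))) (i : ℕ) :
    jobsOf (b :: bs) i = (if b.1 = i then b.2 else []) ++ jobsOf bs i := rfl

lemma jobsOf_insertBlock (i : ℕ) (a : J × ℝ) {bs : List (ℕ × List (J × ℝ))}
    (h : bs.Pairwise fun b b' => b.1 < b'.1) (i' : ℕ) :
    jobsOf (insertBlock i a bs).val i' = if i = i' then a :: jobsOf bs i' else jobsOf bs i' := by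
  induction bs with
  | nil => by_cases e : i = i' <;> simp [insertBlock, jobsOf, e]
  | cons b bs ih =>
    rw [insertBlock_cons_val]
    have h' := List.pairwise_cons.1 h
    by_cases h₁ : i = b.1
    · rw [if_pos h₁, jobsOf_cons, jobsOf_cons, ← h₁]
      split_ifs <;> rfl
    · rw [if_neg h₁]
      by_cases h₂ : i ≤ b.1
      · rw [if_pos h₂, jobsOf_cons]
        by_cases e : i = i'
        · rw [if_pos e, if_pos e]
          rfl
        · rw [if_neg e, if_neg e]
          rfl
      · rw [if_neg h₂, jobsOf_cons, jobsOf_cons, ih h'.2]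
        by_cases e : i = i'
        · rw [if_neg (fun e' => h₁ (e.trans e'.symm)), if_pos e, if_pos e]
          rfl
        · rw [if_neg e, if_neg e]

/-- Strictly increasing indices occur once each, so a single entry holds its whole block. -/
lemma jobsOf_eq_of_mem {bs : List (ℕ × List (J × ℝ))} (h : bs.Pairwise fun b b' => b.1 < b'.1)
    {b : ℕ × List (J × ℝ)} (hb : b ∈ bs) : jobsOf bs b.1 = b.2 := by
  induction bs with
  | nil => simp at hb
  | cons b' bs ih =>
    have h' := List.pairwise_cons.1 h
    rw [jobsOf_cons]
    rcases List.mem_cons.1 hb with rfl | hb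
    · rw [if_pos rfl, jobsOf_eq_nil fun b' hb' => (h'.1 b' hb').ne', List.append_nil]
    · rw [if_neg (h'.1 b hb).ne, ih h'.2 hb, List.nil_append]

/-- The body of the loop of `splitJobs`. -/
noncomputable def splitStep (K t : ℕ) (a : ℕ × J × ℝ)
    (r : List (J × ℝ) × List (ℕ × List (J × ℝ))) :
    Timed (List (J × ℝ) × List (ℕ × List (J × ℝ))) := do
  let x ← modN a.1 K
  if ← eqN x t then
    step (a.2 :: r.1, r.2)
  else
    let i ← blockIndex K t a.1
    let bs ← insertBlock i a.2 r.2
    step (r.1, bs)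

lemma splitJobs_cons_val (K t : ℕ) (a : ℕ × J × ℝ) (L : List (ℕ × J × ℝ)) :
    (splitJobs K t (a :: L)).val =
      if a.1 % K = t then (a.2 :: (splitJobs K t L).val.1, (splitJobs K t L).val.2)
      else ((splitJobs K t L).val.1,
        (insertBlock (blockOf K t a.1) a.2 (splitJobs K t L).val.2).val) := by
  change (splitStep K t a (splitJobs K t L).val).val = _
  simp [splitStep]

lemma splitJobs_discarded (K t : ℕ) (L : List (ℕ × J × ℝ)) :
    (splitJobs K t L).val.1 = (L.filter fun a => a.1 % K = t).map Prod.snd := by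
  induction L with
  | nil => rfl
  | cons a L ih =>
    rw [splitJobs_cons_val, List.filter_cons]
    split_ifs with h <;> simp_all

lemma splitJobs_pairwise (K t : ℕ) (L : List (ℕ × J × ℝ)) :
    (splitJobs K t L).val.2.Pairwise fun b b' => b.1 < b'.1 := by
  induction L with
  | nil => exact .nil
  | cons a L ih =>
    rw [splitJobs_cons_val]
    split_ifs
    · exact ih
    · exact insertBlock_pairwise _ _ ih

lemma length_splitJobs_le (K t : ℕ) (L : List (ℕ × J × ℝ)) :
    (splitJobs K t L).val.2.length ≤ L.length := by
  induction L with
  | nil => exact le_rfl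
  | cons a L ih =>
    rw [splitJobs_cons_val]
    split_ifs
    · exact ih.trans (by simp)
    · exact (length_insertBlock_le _ _ _).trans (Nat.succ_le_succ ih)

lemma splitJobs_perm (K t : ℕ) (L : List (ℕ × J × ℝ)) :
    ((splitJobs K t L).val.1 ++ (splitJobs K t L).val.2.flatMap Prod.snd).Perm
      (L.map Prod.snd) := by
  induction L with
  | nil => exact List.Perm.refl _
  | cons a L ih =>
    rw [splitJobs_cons_val]
    split_ifs
    · exact ih.cons _
    · exact ((insertBlock_perm _ _ _).append_left _).trans
        (List.perm_middle.trans (ih.cons _))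

lemma jobsOf_splitJobs (K t : ℕ) (L : List (ℕ × J × ℝ)) (i : ℕ) :
    jobsOf (splitJobs K t L).val.2 i =
      (L.filter fun a => a.1 % K ≠ t ∧ blockOf K t a.1 = i).map Prod.snd := by
  induction L with
  | nil => rfl
  | cons a L ih =>
    rw [splitJobs_cons_val, List.filter_cons]
    by_cases h : a.1 % K = t
    · simp [h, ih]
    · rw [if_neg h, jobsOf_insertBlock _ _ (splitJobs_pairwise K t L), ih]
      by_cases h' : blockOf K t a.1 = i <;> simp [h, h']

lemma splitJobs_steps_le (K t : ℕ) (L : List (ℕ × J × ℝ)) :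
    (splitJobs K t L).steps ≤ L.length * (3 * L.length + 9) + 1 := by
  refine foldT_steps_le (f := splitStep K t) (c := 3 * L.length + 8) fun a l' hl' => ?_
  have h₁ := hl'.length_le
  have h₂ := length_splitJobs_le K t l'
  have h₃ := insertBlock_steps_le (blockOf K t a.1) a.2 (splitJobs K t l').val.2
  have h₄ := blockIndex_steps_le K t a.1
  rw [List.length_cons] at h₁
  change (splitStep K t a (splitJobs K t l').val).steps ≤ _
  simp only [splitStep, bind_steps, ite_steps, modN, step_steps, eqN_steps, blockIndex_val]
  split_ifs <;> omega

end SplitJobs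

/-! ### The choice of the gap class. -/

section LightestClass

variable {J : Type}

/-- The total processing time of the jobs of class `i`. -/
noncomputable def weightOf (K : ℕ) (L : List (ℕ × J × ℝ)) (i : ℕ) : ℝ :=
  ((L.filter fun a => a.1 % K = i).map fun a => a.2.2).sum

lemma classWeight_val (K : ℕ) (L : List (ℕ × J × ℝ)) (i : ℕ) :
    (classWeight K L i).val = weightOf K L i := by
  induction L with
  | nil => rfl
  | cons a L ih =>
    rw [weightOf, List.filter_cons]
    rw [classWeight] at ih ⊢
    rw [foldT_cons_val, ih]
    by_cases h : a.1 % K = i <;> simp [h, weightOf]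

lemma classWeight_steps_le (K : ℕ) (L : List (ℕ × J × ℝ)) (i : ℕ) :
    (classWeight K L i).steps ≤ L.length * 4 + 1 := by
  refine foldT_steps_le_of_forall (c := 3) fun a _ r => ?_
  simp only [bind_steps, ite_steps, modN, addR, step_steps, eqN_steps]
  split_ifs <;> omega

/-- The body of the minimization loop of `lightestClass`. -/
noncomputable def lightestStep (K : ℕ) (L : List (ℕ × J × ℝ)) (i : ℕ) (best : Option (ℕ × ℝ)) :
    Timed (Option (ℕ × ℝ)) := do
  let w ← classWeight K L i
  match best with
  | none => step (some (i, w))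
  | some b => do
    if ← leR w b.2 then step (some (i, w)) else step (some b)

lemma lightestClass_eq (K : ℕ) (L : List (ℕ × J × ℝ)) :
    lightestClass K L = (do
      let range ← rangeT K
      let best ← foldT (lightestStep K L) none range
      match best with
      | none => step 0
      | some b => step b.1) := rfl

lemma foldT_lightestStep_val (K : ℕ) (L : List (ℕ × J × ℝ)) (R : List ℕ) :
    match (foldT (lightestStep K L) none R).val with
    | none => R = []
    | some b => b.1 ∈ R ∧ b.2 = weightOf K L b.1 ∧ ∀ i ∈ R, b.2 ≤ weightOf K L i := by
  induction R with
  | nil => rfl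
  | cons i R ih =>
    rw [foldT_cons_val]
    cases hb : (foldT (lightestStep K L) none R).val with
    | none =>
      rw [hb] at ih
      subst ih
      simp [lightestStep, classWeight_val]
    | some b =>
      rw [hb] at ih
      obtain ⟨h₁, h₂, h₃⟩ := ih
      by_cases h : weightOf K L i ≤ b.2
      · simp only [lightestStep, bind_val, leR_val, classWeight_val, h, if_true, step_val]
        exact ⟨List.mem_cons_self, trivial, List.forall_mem_cons.2
          ⟨le_rfl, fun i' hi' => h.trans (h₃ i' hi')⟩⟩
      · simp only [lightestStep, bind_val, leR_val, classWeight_val, h, if_false, step_val]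
        exact ⟨List.mem_cons_of_mem _ h₁, h₂, List.forall_mem_cons.2 ⟨(not_le.1 h).le, h₃⟩⟩

lemma lightestClass_val {K : ℕ} (hK : 0 < K) (L : List (ℕ × J × ℝ)) :
    (lightestClass K L).val < K ∧
      ∀ i < K, weightOf K L (lightestClass K L).val ≤ weightOf K L i := by
  have h := foldT_lightestStep_val K L (List.range K).reverse
  rw [lightestClass_eq, bind_val, bind_val, rangeT_val]
  cases hb : (foldT (lightestStep K L) none (List.range K).reverse).val with
  | none =>
    rw [hb] at h
    -- No candidate would mean an empty range, contrary to `0 < K`.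
    simp at h
    omega
  | some b =>
    rw [hb] at h
    obtain ⟨h₁, h₂, h₃⟩ := h
    refine ⟨by simpa using h₁, fun i hi => ?_⟩
    rw [step_val, ← h₂]
    exact h₃ i (by simpa using hi)

lemma lightestClass_steps_le (K : ℕ) (L : List (ℕ × J × ℝ)) :
    (lightestClass K L).steps ≤ K * (L.length * 4 + 5) + 3 := by
  have h : (foldT (lightestStep K L) none (List.range K).reverse).steps ≤
      (List.range K).reverse.length * (L.length * 4 + 3 + 1) + 1 := by
    refine foldT_steps_le_of_forall fun i _ best => ?_
    have := classWeight_steps_le K L i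
    cases best with
    | none => simp only [lightestStep, bind_steps, step_steps]; omega
    | some b =>
      simp only [lightestStep, bind_steps, ite_steps, step_steps, leR_steps]
      split_ifs <;> omega
  rw [List.length_reverse, List.length_range] at h
  rw [lightestClass_eq, bind_steps, bind_steps, rangeT_val, rangeT_steps]
  have e : ∀ o : Option (ℕ × ℝ), (match o with
      | none => step 0
      | some b => step b.1).steps = 1 := fun o => by cases o <;> rfl
  rw [e]
  linarith

end LightestClass

/-! ### Placing the discarded jobs and listing the schedule. -/

section Output

variable {J : Type} {m : ℕ}

lemma placeOnFirst_ofFn_val (hm : 0 < m) (G : List (J × ℝ)) (c : Fin m → ℝ)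
    (g : Fin m → List (J × ℝ)) :
    (placeOnFirst G (List.ofFn fun q => (q, c q, g q))).val =
      List.ofFn fun q => (q, c q, (if q = ⟨0, hm⟩ then G else []) ++ g q) := by
  cases m with
  | zero => omega
  | succ m =>
    simp only [List.ofFn_succ, placeOnFirst, bind_val, appendT_val, step_val]
    congr 1

lemma placeOnFirst_steps_le (G : List (J × ℝ)) (w : WorkingSchedule J (Fin m)) :
    (placeOnFirst G w).steps ≤ G.length + 2 := by
  cases w <;> simp [placeOnFirst]

lemma listPairs_ofFn_val (c : Fin m → ℝ) (h : Fin m → List (J × ℝ)) :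
    (listPairs (List.ofFn fun q => (q, c q, h q))).val =
      (List.ofFn fun q => (h q).map fun a => (a.1, q)).flatten := by
  have key : ∀ w : WorkingSchedule J (Fin m), (listPairs w).val =
      (w.map fun s => s.2.2.map fun a => (a.1, s.1)).flatten := by
    intro w
    induction w with
    | nil => rfl
    | cons s w ih =>
      rw [listPairs] at ih ⊢
      rw [foldT_cons_val, ih]
      simp
  rw [key, List.map_ofFn]
  rfl

lemma listPairs_steps_le {w : WorkingSchedule J (Fin m)} {X : ℕ}
    (hw : ∀ s ∈ w, s.2.2.length ≤ X) : (listPairs w).steps ≤ w.length * (3 * X + 3) + 1 := by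
  refine foldT_steps_le_of_forall (c := 3 * X + 2) fun s hs acc => ?_
  have h₁ := mapT_steps_le (f := fun a : J × ℝ => step (a.1, s.1)) (l := s.2.2) (c := 1)
    fun _ _ => le_rfl
  have h₂ := hw s hs
  simp only [bind_steps, mapT_val, appendT_steps, List.length_map]
  omega

end Output

/-! ### The run in terms of layers, classes and blocks. -/

section Run

lemma isGreatest_foldT_maxR {J : Type} (l : List (J × ℝ)) :
    IsGreatest (insert 0 {y | ∃ b ∈ l, b.2 = y}) (foldT (fun a r => maxR a.2 r) 0 l).val := by
  induction l with
  | nil => simp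
  | cons a l ih =>
    have e : insert (0 : ℝ) {y | ∃ b ∈ a :: l, b.2 = y} =
        insert a.2 (insert 0 {y | ∃ b ∈ l, b.2 = y}) := by
      ext y
      simp only [List.mem_cons, exists_eq_or_imp, Set.mem_insert_iff, Set.mem_ofPred_eq]
      grind
    rw [e, foldT_cons_val, maxR_val]
    exact ih.insert a.2

/-- The program is unfolded here once and for all. Linear passes are bounded at once, while the
choice of the class, the splitting, the scheduling and the output keep their own step counts. -/
lemma ptasApprox_eq {J M : Type} (ε : ℝ) (jobs : List (J × ℝ)) (machines : List (M × ℝ))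
    {L : List (ℕ × J × ℝ)} {w : WorkingSchedule J M}
    (hL : (mapT (fun a => do
      let x ← divR a.2 (foldT (fun a r => maxR a.2 r) 0 jobs).val
      let l ← floorLog ε x
      step (l, a)) jobs).val = L)
    (hw : (mapT (fun q : M × ℝ => step (q.1, q.2, ([] : List (J × ℝ)))) machines).val = w) :
    let parts := splitJobs (numClasses ε) (lightestClass (numClasses ε) L).val L
    let w₁ := scheduleBlocks ε parts.val.2 w
    let w₂ := placeOnFirst parts.val.1 w₁.val
    (ptasApprox ε jobs machines).val = (listPairs w₂.val).val ∧
    (ptasApprox ε jobs machines).steps ≤ (jobs.length * 3 + 1) + 2 + (jobs.length * 4 + 1) +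
      (lightestClass (numClasses ε) L).steps + parts.steps + (machines.length * 2 + 1) +
      w₁.steps + w₂.steps + (listPairs w₂.val).steps := by
  intro parts w₁ w₂
  have h₁ : (foldT (fun (a : J × ℝ) r => maxR a.2 r) 0 jobs).steps ≤ jobs.length * 3 + 1 :=
    foldT_steps_le_of_forall (c := 2) fun a _ r => by simp
  have h₂ : (mapT (fun a => do
      let x ← divR a.2 (foldT (fun (a : J × ℝ) r => maxR a.2 r) 0 jobs).val
      let l ← floorLog ε x
      step (l, a)) jobs).steps ≤ jobs.length * 4 + 1 :=
    mapT_steps_le (c := 3) fun _ _ => le_rfl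
  have h₃ : (mapT (fun q : M × ℝ => step (q.1, q.2, ([] : List (J × ℝ)))) machines).steps ≤
      machines.length * 2 + 1 := mapT_steps_le (c := 1) fun _ _ => le_rfl
  subst hL hw
  refine ⟨rfl, ?_⟩
  have e : (ptasApprox ε jobs machines).steps =
      (foldT (fun (a : J × ℝ) r => maxR a.2 r) 0 jobs).steps + (1 + (1 + ((mapT (fun a => do
      let x ← divR a.2 (foldT (fun (a : J × ℝ) r => maxR a.2 r) 0 jobs).val
      let l ← floorLog ε x
      step (l, a)) jobs).steps + ((lightestClass (numClasses ε) _).steps + (parts.steps +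
      ((mapT (fun q : M × ℝ => step (q.1, q.2, ([] : List (J × ℝ)))) machines).steps +
      (w₁.steps + (w₂.steps + (listPairs w₂.val).steps)))))))) := rfl
  rw [e]
  omega

variable {n m : ℕ} (Ψ : Problem (Fin n) (Fin m)) {ε : ℝ}

/-- The jobs with the indices of their layers. -/
noncomputable def layeredJobs (ε : ℝ) : List (ℕ × Fin n × ℝ) :=
  List.ofFn fun j => (layer Ψ ε j, j, Ψ.p j)

lemma layering_val : (mapT (fun a => do
    let x ← divR a.2 (foldT (fun a r => maxR a.2 r) 0 (List.ofFn fun j => (j, Ψ.p j))).val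
    let l ← floorLog ε x
    step (l, a)) (List.ofFn fun j => (j, Ψ.p j))).val = layeredJobs Ψ ε := by
  rw [mapT_val, List.map_ofFn, layeredJobs]
  congr 1
  funext j
  -- The fold starts at 0, below all processing times; as there is a job `j`, its result is the true
  -- maximum.
  have htop : (foldT (fun a r => maxR a.2 r) 0 (List.ofFn fun j => (j, Ψ.p j))).val = pmax Ψ := by
    obtain ⟨h₁, h₂⟩ := isGreatest_foldT_maxR (List.ofFn fun j => (j, Ψ.p j))
    refine le_antisymm ?_ (csSup_le ⟨_, j, rfl⟩ ?_)
    · rcases h₁ with h₁ | ⟨b, hb, h₁⟩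
      · rw [h₁]
        exact (pmax_pos Ψ j).le
      · obtain ⟨j', rfl⟩ := List.mem_ofFn.1 hb
        rw [← h₁]
        exact p_le_pmax Ψ j'
    · rintro _ ⟨j', rfl⟩
      exact h₂ (.inr ⟨_, List.mem_ofFn.2 ⟨j', rfl⟩, rfl⟩)
  simp only [Function.comp_apply, bind_val, htop]
  rfl

lemma weightOf_layeredJobs (hε₀ : 0 < ε) (hε₁ : ε < 1) {i : ℕ} (hi : i < numClasses ε) :
    weightOf (numClasses ε) (layeredJobs Ψ ε) i = ∑ j ∈ classJobs Ψ ε i, Ψ.p j := by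
  rw [weightOf, layeredJobs, List.ofFn_eq_map, List.filter_map, List.map_map]
  rw [← List.sum_toFinset _ ((List.nodup_finRange n).filter _)]
  refine Finset.sum_congr ?_ fun _ _ => rfl
  ext j
  rw [mem_classJobs Ψ hε₀ hε₁ hi]
  simp

open Classical in
/-- The jobs of a set with given processing times. -/
noncomputable def jobList (S : Finset (Fin n)) (p : Fin n → ℝ) : List (Fin n × ℝ) :=
  ((List.finRange n).filter (· ∈ S)).map fun j => (j, p j)

lemma mem_jobList {S : Finset (Fin n)} {p : Fin n → ℝ} {a : Fin n × ℝ} :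
    a ∈ jobList S p ↔ a.1 ∈ S ∧ a.2 = p a.1 := by
  simp only [jobList, List.mem_map, List.mem_filter, List.mem_finRange, true_and,
    decide_eq_true_eq]
  constructor
  · rintro ⟨j, hj, rfl⟩
    exact ⟨hj, rfl⟩
  · rintro ⟨h₁, h₂⟩
    exact ⟨a.1, h₁, by rw [← h₂]⟩

/-- The passage from sums over lists in the program to sums over sets in the problem. -/
lemma listLoad_jobList (S : Finset (Fin n)) (p : Fin n → ℝ) (σ : Fin n → Fin m) (q : Fin m) :
    listLoad σ (jobList S p) q = load S p σ q := by
  classical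
  rw [listLoad, onMachine, jobList, List.filter_map, List.map_map, List.filter_filter,
    ← List.sum_toFinset _ ((List.nodup_finRange n).filter _), load]
  refine Finset.sum_congr ?_ fun _ _ => rfl
  ext j
  simp [and_comm]

lemma roundDown_jobList (ε : ℝ) (p : Fin n → ℝ) (S : Finset (Fin n)) :
    (roundDown ε (jobList S p)).val = jobList S (rounded p ε S) := by
  rcases S.eq_empty_or_nonempty with rfl | hS
  · simp [jobList, roundDown]
  · have hm : IsLeast {y | ∃ b ∈ jobList S p, b.2 = y} (pmin p S) := by
      constructor
      · obtain ⟨j, hj, h⟩ := exists_eq_pmin (p := p) hS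
        exact ⟨(j, p j), mem_jobList.2 ⟨hj, rfl⟩, h⟩
      · rintro _ ⟨b, hb, rfl⟩
        rw [mem_jobList] at hb
        rw [hb.2]
        exact pmin_le hb.1
    rw [roundDown_val hm, jobList, jobList, List.map_map]
    rfl

lemma jobsOf_splitJobs_layeredJobs (hε₀ : 0 < ε) (hε₁ : ε < 1) {t : ℕ}
    (ht : t < numClasses ε) (i : ℕ) :
    jobsOf (splitJobs (numClasses ε) t (layeredJobs Ψ ε)).val.2 i =
      jobList (block Ψ ε t i) Ψ.p := by
  classical
  rw [jobsOf_splitJobs, layeredJobs, List.ofFn_eq_map, List.filter_map, List.map_map, jobList]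
  rw [List.filter_congr (q := fun j => decide (j ∈ block Ψ ε t i)) fun j _ => by
    simp [mem_block Ψ hε₀ hε₁ ht]]
  rfl

lemma eq_jobList_of_mem (hε₀ : 0 < ε) (hε₁ : ε < 1) {t : ℕ} (ht : t < numClasses ε)
    {b : ℕ × List (Fin n × ℝ)}
    (hb : b ∈ (splitJobs (numClasses ε) t (layeredJobs Ψ ε)).val.2) :
    b.2 = jobList (block Ψ ε t b.1) Ψ.p := by
  rw [← jobsOf_eq_of_mem (splitJobs_pairwise _ _ _) hb,
    jobsOf_splitJobs_layeredJobs Ψ hε₀ hε₁ ht]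

lemma exists_block_of_nonempty (hε₀ : 0 < ε) (hε₁ : ε < 1) {t : ℕ} (ht : t < numClasses ε)
    {i : ℕ} (hi : (block Ψ ε t i).Nonempty) :
    ∃ b ∈ (splitJobs (numClasses ε) t (layeredJobs Ψ ε)).val.2, b.1 = i := by
  by_contra! h
  have := jobsOf_eq_nil h
  rw [jobsOf_splitJobs_layeredJobs Ψ hε₀ hε₁ ht] at this
  obtain ⟨j, hj⟩ := hi
  have hmem : (j, Ψ.p j) ∈ jobList (block Ψ ε t i) Ψ.p := mem_jobList.2 ⟨hj, rfl⟩
  rw [this] at hmem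
  exact List.not_mem_nil hmem

lemma listLoad_flatMap {α : Type} (σ : Fin n → Fin m) (bs : List α)
    (f : α → List (Fin n × ℝ)) (q : Fin m) :
    listLoad σ (bs.flatMap f) q = (bs.map fun b => listLoad σ (f b) q).sum := by
  induction bs with
  | nil => simp [listLoad, onMachine]
  | cons b bs ih =>
    rw [List.flatMap_cons, List.map_cons, List.sum_cons, ← ih]
    simp [listLoad, onMachine_append]

/-- The definition sums over all indices below that of `b`, the program over the entries before `b`.
The entries are sorted and contain every nonempty block, so the indices in which the sums differ
belong to empty blocks. -/
lemma residual_eq_listLoad (hε₀ : 0 < ε) (hε₁ : ε < 1) {t : ℕ} (ht : t < numClasses ε)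
    (σ : Fin n → Fin m) {bs₁ bs₂ : List (ℕ × List (Fin n × ℝ))} {b : ℕ × List (Fin n × ℝ)}
    (h : (splitJobs (numClasses ε) t (layeredJobs Ψ ε)).val.2 = bs₁ ++ b :: bs₂) (q : Fin m) :
    residual Ψ ε t σ b.1 q = max (Ψ.c q - listLoad σ (roundedJobs ε bs₁) q) 0 := by
  have hsort := splitJobs_pairwise (numClasses ε) t (layeredJobs Ψ ε)
  have hkeys : ∀ i, (block Ψ ε t i).Nonempty → ∃ b' ∈ bs₁ ++ b :: bs₂, b'.1 = i := fun i hi =>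
    h ▸ exists_block_of_nonempty Ψ hε₀ hε₁ ht hi
  have hjobs : ∀ b' ∈ bs₁ ++ b :: bs₂, b'.2 = jobList (block Ψ ε t b'.1) Ψ.p := fun b' hb' =>
    eq_jobList_of_mem Ψ hε₀ hε₁ ht (h ▸ hb')
  rw [h, List.pairwise_append, List.pairwise_cons] at hsort
  obtain ⟨hs₁, ⟨hs₂, -⟩, hs₃⟩ := hsort
  rw [residual, roundedJobs, listLoad_flatMap]
  congr 2
  rw [List.map_congr_left (g := (fun i => load (block Ψ ε t i) (rounded Ψ.p ε (block Ψ ε t i)) σ q) ∘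
    Prod.fst) fun b' hb' => by
      rw [hjobs b' (List.mem_append_left _ hb'), roundDown_jobList, listLoad_jobList]
      rfl]
  have hnd : (bs₁.map Prod.fst).Nodup := by
    rw [List.Nodup, List.pairwise_map]
    exact hs₁.imp fun h => h.ne
  rw [← List.map_map, ← List.sum_toFinset _ hnd]
  symm
  refine Finset.sum_subset (fun i hi => ?_) fun i hi hi' => ?_
  · rw [List.mem_toFinset, List.mem_map] at hi
    obtain ⟨b', hb', rfl⟩ := hi
    exact Finset.mem_range.2 (hs₃ b' hb' b List.mem_cons_self)
  · have : block Ψ ε t i = ∅ := by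
      by_contra hne
      obtain ⟨b', hb', rfl⟩ := hkeys i (Finset.nonempty_iff_ne_empty.2 hne)
      rw [Finset.mem_range] at hi
      rcases List.mem_append.1 hb' with hb' | hb'
      · exact hi' (List.mem_toFinset.2 (List.mem_map_of_mem hb'))
      · rcases List.mem_cons.1 hb' with rfl | hb'
        · exact lt_irrefl _ hi
        · exact lt_asymm hi (hs₂ b' hb')
    simp [this, load]

lemma workingTime_block_le (hε₀ : 0 < ε) (hε₁ : ε < 1) {t : ℕ} (ht : t < numClasses ε)
    {σ : Fin n → Fin m}
    (hσ : ∀ bs₁ b bs₂,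
      (splitJobs (numClasses ε) t (layeredJobs Ψ ε)).val.2 = bs₁ ++ b :: bs₂ →
      IsBlockOptimal Ψ.c σ (roundDown ε b.2).val (roundedJobs ε bs₁)) (i : ℕ)
    (τ : Fin n → Fin m) :
    workingTime (block Ψ ε t i) (rounded Ψ.p ε (block Ψ ε t i)) (residual Ψ ε t σ i) σ ≤
      workingTime (block Ψ ε t i) (rounded Ψ.p ε (block Ψ ε t i)) (residual Ψ ε t σ i) τ := by
  -- The program skips empty blocks, while optimality is demanded for every index; on an empty block
  -- both sides are equal.
  rcases (block Ψ ε t i).eq_empty_or_nonempty with he | hne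
  · rw [he]
    simp [workingTime]
  · obtain ⟨b, hb, rfl⟩ := exists_block_of_nonempty Ψ hε₀ hε₁ ht hne
    obtain ⟨bs₁, bs₂, h⟩ := List.append_of_mem hb
    have := hσ bs₁ b bs₂ h τ
    rw [eq_jobList_of_mem Ψ hε₀ hε₁ ht hb, roundDown_jobList] at this
    simpa only [workingTime_eq, listLoad_jobList, ← residual_eq_listLoad Ψ hε₀ hε₁ ht σ h] using this

end Run

/-! ### Correctness and running time of the run. -/

section RunSpec

variable {n m : ℕ} (Ψ : Problem (Fin n) (Fin m)) {ε : ℝ}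

/-- For `ε ≤ 1 / 2` one has `1 + ε ≤ 2 ≤ 1 / ε`. Hence the exponent of the running time dominates `1
/ ε`, and with it the number of classes. -/
lemma one_le_logb_one_div (hε₀ : 0 < ε) (hε : ε ≤ 1 / 2) : 1 ≤ Real.logb (1 + ε) (1 / ε) := by
  have h₂ : 2 ≤ 1 / ε := (le_div_iff₀ hε₀).2 (by linarith)
  rw [Real.le_logb_iff_rpow_le (by linarith) (by positivity), Real.rpow_one]
  linarith

lemma one_div_le_exponent (hε₀ : 0 < ε) (hε : ε ≤ 1 / 2) :
    1 / ε ≤ 1 / ε * Real.logb (1 + ε) (1 / ε) :=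
  le_mul_of_one_le_right (by positivity) (one_le_logb_one_div hε₀ hε)

/-- Within a block the ratio is at most `(1 / ε) ^ (K - 1)`, and `K - 1 ≤ 1 / ε` because `K` is the
ceiling. -/
lemma floor_logb_le (hε₀ : 0 < ε) (hε : ε ≤ 1 / 2) {t : ℕ} (ht : t < numClasses ε) {i : ℕ}
    {j j' : Fin n} (hj : j ∈ block Ψ ε t i) (hj' : j' ∈ block Ψ ε t i) :
    ⌊Real.logb (1 + ε) (Ψ.p j' / Ψ.p j)⌋₊ ≤ ⌊1 / ε * Real.logb (1 + ε) (1 / ε)⌋₊ := by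
  have hε₁ : ε < 1 := by linarith
  refine Nat.floor_le_floor ?_
  have hK : ((numClasses ε - 1 : ℕ) : ℝ) ≤ 1 / ε := by
    have h₁ : (numClasses ε : ℝ) < 1 / ε + 1 := Nat.ceil_lt_add_one (by positivity)
    rw [Nat.cast_sub (numClasses_pos hε₀), Nat.cast_one]
    linarith
  calc Real.logb (1 + ε) (Ψ.p j' / Ψ.p j)
      ≤ Real.logb (1 + ε) ((1 / ε) ^ (numClasses ε - 1)) :=
        Real.logb_le_logb_of_le (by linarith) (div_pos (Ψ.p_pos _) (Ψ.p_pos _))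
          (p_div_le_of_block_eq Ψ hε₀ hε₁ ht hj hj')
    _ = (numClasses ε - 1 : ℕ) * Real.logb (1 + ε) (1 / ε) := by rw [Real.logb_pow]
    _ ≤ _ := mul_le_mul_of_nonneg_right hK
        (zero_le_one.trans (one_le_logb_one_div hε₀ hε))

/-- The number of configurations of a block. -/
lemma prod_typesOf_le (hε₀ : 0 < ε) (hε : ε ≤ 1 / 2) {t : ℕ} (ht : t < numClasses ε) (i : ℕ) :
    ((typesOf (jobList (block Ψ ε t i) (rounded Ψ.p ε (block Ψ ε t i)))).map
      fun g => g.2.length + 1).prod ≤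
      (n + 1) ^ (⌊1 / ε * Real.logb (1 + ε) (1 / ε)⌋₊ + 1) := by
  set P := ⌊1 / ε * Real.logb (1 + ε) (1 / ε)⌋₊
  set S := block Ψ ε t i with hS
  set l := jobList S (rounded Ψ.p ε S) with hl
  have hlen : l.length ≤ n := by
    rw [hl, jobList, List.length_map]
    exact (List.length_filter_le _ _).trans (List.length_finRange).le
  -- The distinct rounded times are terms of one geometric progression with exponents `0, …, P`.
  have hT : (typesOf l).length ≤ P + 1 := by
    have hsub : (typesOf l).map Prod.fst ⊆
        (List.range (P + 1)).map fun k => pmin Ψ.p S * (1 + ε) ^ k := by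
      intro x hx
      rw [mem_map_fst_typesOf, List.mem_map] at hx
      obtain ⟨a, ha, rfl⟩ := hx
      obtain ⟨h₁, h₂⟩ := mem_jobList.1 ha
      obtain ⟨j, hj, hjm⟩ := exists_eq_pmin (p := Ψ.p) ⟨a.1, h₁⟩
      rw [h₂, rounded]
      refine List.mem_map.2 ⟨_, List.mem_range.2 (Nat.lt_succ_of_le ?_), rfl⟩
      rw [← hjm]
      exact floor_logb_le Ψ hε₀ hε ht hj h₁
    simpa using ((nodup_map_fst_typesOf l).subperm hsub).length_le
  have hle : ∀ x ∈ (typesOf l).map fun g => g.2.length + 1, x ≤ n + 1 := by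
    intro x hx
    obtain ⟨g, hg, rfl⟩ := List.mem_map.1 hx
    have h₁ := length_snd_le_length_typeJobs hg
    rw [(typeJobs_typesOf l).length_eq] at h₁
    omega
  calc _ ≤ (n + 1) ^ ((typesOf l).map fun g => g.2.length + 1).length :=
        List.prod_le_pow_card _ _ hle
    _ ≤ _ := Nat.pow_le_pow_right (by omega) (by rwa [List.length_map])

/-- The run produces the table of a possible output of PTAS-Approx. -/
lemma runPTAS_spec_of_bound (hm : 0 < m) (hε₀ : 0 < ε) (hε : ε ≤ 1 / 2) {X : ℕ}
    (hQ : (n + 1) ^ (⌊1 / ε * Real.logb (1 + ε) (1 / ε)⌋₊ + 1) ≤ X)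
    (hP : ⌊1 / ε * Real.logb (1 + ε) (1 / ε)⌋₊ ≤ X) (hK : numClasses ε ≤ X) :
    (∃ σ : Fin n → Fin m, IsTableOf (runPTAS Ψ ε).val σ ∧ IsPTASOutput Ψ ε σ) ∧
      (runPTAS Ψ ε).steps ≤ m * (300 * X ^ 5) := by
  classical
  have hε₁ : ε < 1 := by linarith
  have hnX : n + 1 ≤ X := (Nat.le_self_pow (by omega) _).trans hQ
  have hX : 1 ≤ X := by omega
  obtain ⟨ht, hmin⟩ := lightestClass_val (numClasses_pos hε₀) (layeredJobs Ψ ε)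
  obtain ⟨hval, hsteps⟩ := ptasApprox_eq ε (List.ofFn fun j => (j, Ψ.p j))
    (List.ofFn fun q => (q, Ψ.c q)) (layering_val Ψ)
    (w := List.ofFn fun q => (q, Ψ.c q, [])) (by rw [mapT_val, List.map_ofFn]; rfl)
  have hlight := lightestClass_steps_le (numClasses ε) (layeredJobs Ψ ε)
  generalize (lightestClass (numClasses ε) (layeredJobs Ψ ε)).val = t at *
  have hsplit := splitJobs_steps_le (numClasses ε) t (layeredJobs Ψ ε)
  have hperm := splitJobs_perm (numClasses ε) t (layeredJobs Ψ ε)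
  have hdisc := splitJobs_discarded (numClasses ε) t (layeredJobs Ψ ε)
  have hbsl := length_splitJobs_le (numClasses ε) t (layeredJobs Ψ ε)
  have hlayl : (layeredJobs Ψ ε).length = n := List.length_ofFn
  set G := (splitJobs (numClasses ε) t (layeredJobs Ψ ε)).val.1 with hG
  set bs := (splitJobs (numClasses ε) t (layeredJobs Ψ ε)).val.2 with hbs
  have hb : ∀ b ∈ bs, b.2 = jobList (block Ψ ε t b.1) Ψ.p := fun b hb =>
    eq_jobList_of_mem Ψ hε₀ hε₁ ht hb
  -- Discarded and scheduled jobs together contain every job exactly once; both the distinctness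
  -- needed by the scheduler and the completeness of the output table come from this.
  have hfst : ((G ++ roundedJobs ε bs).map Prod.fst).Perm (List.finRange n) := by
    have e₁ : (roundedJobs ε bs).map Prod.fst = (bs.flatMap Prod.snd).map Prod.fst := by
      rw [roundedJobs, List.map_flatMap, List.map_flatMap]
      simp only [map_fst_roundDown]
    have e₂ : ((layeredJobs Ψ ε).map Prod.snd).map Prod.fst = List.finRange n := by
      rw [layeredJobs, List.map_ofFn, List.map_ofFn, List.ofFn_eq_map]
      exact List.map_id _
    rw [List.map_append, e₁, ← List.map_append, ← e₂]
    exact hperm.map _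
  have hnd := hfst.nodup_iff.2 (List.nodup_finRange n)
  have hlen : (G ++ roundedJobs ε bs).length = n := by
    simpa using hfst.length_eq
  have hlen' := hlen
  rw [List.length_append] at hlen'
  have hnd' : ((roundedJobs ε bs ++ []).map Prod.fst).Nodup := by
    rw [List.append_nil]
    rw [List.map_append] at hnd
    exact (List.nodup_append.1 hnd).2.1
  obtain ⟨σ, -, hrep, hopt, hsched⟩ := scheduleBlocks_spec hm (c := Ψ.c) ε hX bs (S := [])
    (σ := fun _ => ⟨0, hm⟩) (w := List.ofFn fun q => (q, Ψ.c q, []))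
    ⟨fun _ => [], rfl, fun _ => List.Perm.refl _⟩ hnd'
    (by rw [List.append_nil]; omega)
    (fun b hbb a ha a' ha' => by
      rw [hb b hbb, mem_jobList] at ha ha'
      rw [ha.2, ha'.2]
      exact (floor_logb_le Ψ hε₀ hε ht ha.1 ha'.1).trans hP)
    (fun b hbb => by
      rw [hb b hbb, roundDown_jobList]
      exact (prod_typesOf_le Ψ hε₀ hε ht b.1).trans hQ)
  simp only [List.append_nil] at hrep hopt
  obtain ⟨g, hg, hgp⟩ := hrep
  rw [hg] at hval hsteps
  have hplace := placeOnFirst_steps_le G (List.ofFn fun q => (q, Ψ.c q, g q))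
  rw [placeOnFirst_ofFn_val hm, listPairs_ofFn_val] at hval
  rw [placeOnFirst_ofFn_val hm] at hsteps
  set h : Fin m → List (Fin n × ℝ) := fun q => (if q = ⟨0, hm⟩ then G else []) ++ g q with hh
  have hGmem : ∀ a ∈ G, layer Ψ ε a.1 % numClasses ε = t := by
    intro a ha
    rw [hdisc, List.mem_map] at ha
    obtain ⟨x, hx, rfl⟩ := ha
    rw [List.mem_filter, layeredJobs, List.mem_ofFn] at hx
    obtain ⟨⟨j, rfl⟩, hx⟩ := hx
    simpa using hx
  have hRmem : ∀ a ∈ roundedJobs ε bs, layer Ψ ε a.1 % numClasses ε ≠ t := by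
    intro a ha
    obtain ⟨b, hbb, ha⟩ := List.mem_flatMap.1 ha
    rw [hb b hbb, roundDown_jobList, mem_jobList, mem_block Ψ hε₀ hε₁ ht] at ha
    exact ha.1.1
  -- The scheduler says nothing about the gap jobs, so `σ` is redefined there. On the jobs of the
  -- blocks nothing changes, and block optimality carries over.
  obtain ⟨τ, hτ⟩ : ∃ τ : Fin n → Fin m, τ = fun j =>
    if layer Ψ ε j % numClasses ε = t then ⟨0, hm⟩ else σ j := ⟨_, rfl⟩
  have hτG : ∀ a ∈ G, τ a.1 = ⟨0, hm⟩ := fun a ha => by rw [hτ]; exact if_pos (hGmem a ha)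
  have hτR : ∀ a ∈ roundedJobs ε bs, τ a.1 = σ a.1 := fun a ha => by
    rw [hτ]; exact if_neg (hRmem a ha)
  have hhp : ∀ q, (h q).Perm (onMachine τ (G ++ roundedJobs ε bs) q) := fun q => by
    rw [onMachine_append, onMachine_congr hτR]
    refine List.Perm.append (List.Perm.of_eq ?_) (hgp q)
    split_ifs with hq
    · exact (List.filter_eq_self.2 fun a ha => by simp [hτG a ha, hq]).symm
    · exact (List.filter_eq_nil_iff.2 fun a ha => by
        rw [hτG a ha, decide_eq_true_eq]
        exact fun e => hq e.symm).symm
  constructor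
  · refine ⟨τ, ?_, t, ht, fun i hi => ?_, ?_, ⟨0, hm⟩, fun j hj => ?_⟩
    · have e : (runPTAS Ψ ε).val = (List.ofFn fun q => (h q).map fun a => (a.1, q)).flatten := hval
      rw [e]
      have h₁ : (List.ofFn fun q => (h q).map fun a => (a.1, q)).flatten.Perm
          (List.ofFn fun q => (onMachine τ (G ++ roundedJobs ε bs) q).map
            fun a => (a.1, τ a.1)).flatten := by
        rw [List.ofFn_eq_map, List.ofFn_eq_map, ← List.flatMap_def, ← List.flatMap_def]
        refine List.Perm.flatMap_left _ fun q _ => ?_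
        refine ((hhp q).map _).trans (List.Perm.of_eq (List.map_congr_left fun a ha => ?_))
        rw [onMachine, List.mem_filter, decide_eq_true_eq] at ha
        rw [ha.2]
      have h₂ : (List.ofFn fun q => (onMachine τ (G ++ roundedJobs ε bs) q).map
            fun a => (a.1, τ a.1)).flatten.Perm
          ((G ++ roundedJobs ε bs).map fun a => (a.1, τ a.1)) := by
        have := (flatten_ofFn_filter_perm (fun a : Fin n × ℝ => τ a.1)
          (G ++ roundedJobs ε bs)).map fun a => (a.1, τ a.1)
        rw [List.map_flatten, List.map_ofFn] at this
        exact this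
      refine h₁.trans (h₂.trans ?_)
      have h₃ := hfst.map fun j => (j, τ j)
      rw [List.map_map] at h₃
      rw [List.ofFn_eq_map]
      exact h₃
    · rw [← weightOf_layeredJobs Ψ hε₀ hε₁ ht, ← weightOf_layeredJobs Ψ hε₀ hε₁ hi]
      exact hmin i hi
    · refine workingTime_block_le Ψ hε₀ hε₁ ht fun bs₁ b bs₂ hdec τ' => ?_
      have := hopt bs₁ b bs₂ hdec τ'
      have e₁ : ∀ q, listLoad τ (roundDown ε b.2).val q = listLoad σ (roundDown ε b.2).val q :=
        listLoad_congr fun a ha => hτR a (List.mem_flatMap.2 ⟨b, by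
          rw [hbs, hdec]; exact List.mem_append_right _ List.mem_cons_self, ha⟩)
      have e₂ : ∀ q, listLoad τ (roundedJobs ε bs₁) q = listLoad σ (roundedJobs ε bs₁) q :=
        listLoad_congr fun a ha => hτR a (by
          obtain ⟨b', hb', ha⟩ := List.mem_flatMap.1 ha
          exact List.mem_flatMap.2 ⟨b', by
            rw [hbs, hdec]; exact List.mem_append_left _ hb', ha⟩)
      simpa only [e₁, e₂] using this
    · rw [hτ]
      exact if_pos ((mem_classJobs Ψ hε₀ hε₁ ht j).1 hj)
  · have hlist : (listPairs (List.ofFn fun q => (q, Ψ.c q, h q))).steps ≤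
        m * (3 * X + 3) + 1 := by
      refine (listPairs_steps_le (X := X) fun s hs => ?_).trans (by rw [List.length_ofFn])
      obtain ⟨q, rfl⟩ := List.mem_ofFn.1 hs
      refine (hhp q).length_eq.trans_le ((List.length_filter_le _ _).trans ?_)
      omega
    change _ ≤ _ + (listPairs (List.ofFn fun q => (q, Ψ.c q, h q))).steps at hsteps
    rw [hlayl] at hlight hsplit hbsl
    rw [List.length_ofFn, List.length_ofFn] at hsteps
    have b₁ : numClasses ε * (n * 4 + 5) + 3 ≤ X * (X * 4 + 5) + 3 := by gcongr; omega
    have b₂ : n * (3 * n + 9) + 1 ≤ X * (3 * X + 9) + 1 := by gcongr <;> omega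
    have b₃ : bs.length * (m * (150 * X ^ 4)) + 1 ≤ X * (m * (150 * X ^ 4)) + 1 := by
      gcongr; omega
    have p₁ : 1 * X ≤ X * X := Nat.mul_le_mul_right _ hX
    have p₂ : 1 * X ^ 2 ≤ X * X ^ 2 := Nat.mul_le_mul_right _ hX
    have p₃ : 1 * X ^ 3 ≤ X * X ^ 3 := Nat.mul_le_mul_right _ hX
    have p₄ : 1 * X ^ 4 ≤ X * X ^ 4 := Nat.mul_le_mul_right _ hX
    -- In units of `m * X ^ 5`: `80` for work done once, `10` for work per machine outside the loop,
    -- and `150` for the loop over at most `X` blocks.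
    have q₁ : X * 3 + 1 + 2 + (X * 4 + 1) + (X * (X * 4 + 5) + 3) + (X * (3 * X + 9) + 1) + 1 + 1 +
        (X + 2) + 1 ≤ 80 * X ^ 5 := by linarith
    have q₁' : 80 * X ^ 5 ≤ m * (80 * X ^ 5) := Nat.le_mul_of_pos_left _ hm
    have q₂ : 2 + (3 * X + 3) ≤ 10 * X ^ 5 := by linarith
    have q₂' := Nat.mul_le_mul_left m q₂
    have q₃ : X * (m * (150 * X ^ 4)) = m * (150 * X ^ 5) := by ring
    have q₄ : m * (300 * X ^ 5) = m * (80 * X ^ 5) + m * (10 * X ^ 5) + m * (150 * X ^ 5) +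
      m * (60 * X ^ 5) := by ring
    have e : (runPTAS Ψ ε).steps = (ptasApprox ε (List.ofFn fun j => (j, Ψ.p j))
      (List.ofFn fun q => (q, Ψ.c q))).steps := rfl
    rw [e, q₄]
    rw [mul_add] at q₂'
    have hGX : G.length ≤ X := by omega
    omega

/-- The run is correct and takes at most `m * max n 2 ^ O(1/ε * log_{1+ε} (1/ε))` steps. -/
theorem runPTAS_spec (hm : 0 < m) (hε₀ : 0 < ε) (hε : ε ≤ 1 / 2) :
    (∃ σ : Fin n → Fin m, IsTableOf (runPTAS Ψ ε).val σ ∧ IsPTASOutput Ψ ε σ) ∧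
      (runPTAS Ψ ε).steps ≤
        m * max n 2 ^ (19 + 10 * ⌊1 / ε * Real.logb (1 + ε) (1 / ε)⌋₊) := by
  set P := ⌊1 / ε * Real.logb (1 + ε) (1 / ε)⌋₊ with hPdef
  set N := max n 2
  have hN : 2 ≤ N := le_max_right _ _
  have hn : n ≤ N := le_max_left _ _
  -- The common bound is `X = N ^ (2 * (P + 1))`. It covers the exponents and the number of classes
  -- by `k < 2 ^ k`, and the configurations by `n + 1 ≤ N ^ 2`.
  have hP : P + 1 ≤ N ^ (2 * (P + 1)) :=
    Nat.lt_two_pow_self.le.trans ((Nat.pow_le_pow_left hN _).trans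
      (Nat.pow_le_pow_right (by omega) (by omega)))
  have hK : numClasses ε ≤ P + 1 :=
    (Nat.ceil_mono (one_div_le_exponent hε₀ hε)).trans (Nat.ceil_le_floor_add_one _)
  have hQ : (n + 1) ^ (P + 1) ≤ N ^ (2 * (P + 1)) := by
    rw [pow_mul]
    refine Nat.pow_le_pow_left ?_ _
    nlinarith
  obtain ⟨h₁, h₂⟩ := runPTAS_spec_of_bound Ψ hm hε₀ hε hQ ((Nat.le_succ P).trans hP)
    (hK.trans hP)
  refine ⟨h₁, h₂.trans (Nat.mul_le_mul_left m ?_)⟩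
  -- Here `300 ≤ 2 ^ 9`; the final exponent is `9 + 5 * 2 * (P + 1)`.
  have h300 : 300 ≤ N ^ 9 := le_trans (by norm_num) (Nat.pow_le_pow_left hN 9)
  calc 300 * (N ^ (2 * (P + 1))) ^ 5 ≤ N ^ 9 * (N ^ (2 * (P + 1))) ^ 5 := by gcongr
    _ = N ^ (19 + 10 * P) := by ring

end RunSpec

end BAF

/-! ### The main theorem. -/

theorem mainTheorem1 :
    (∃ C : ℝ, 0 < C ∧ ∀ ε : ℝ, 0 < ε → ε ≤ 1 / 2 →
      ∀ (n m : ℕ) (Ψ : BAF.Problem (Fin n) (Fin m)), 0 < m →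
        (∀ σ : Fin n → Fin m, BAF.IsPTASOutput Ψ ε σ → Ψ.IsApprox (1 + 5 * ε) σ) ∧
        (∃ σ : Fin n → Fin m, BAF.IsTableOf (BAF.runPTAS Ψ ε).val σ ∧
          BAF.IsPTASOutput Ψ ε σ ∧ Ψ.IsApprox (1 + 5 * ε) σ) ∧
        ((BAF.runPTAS Ψ ε).steps : ℝ) ≤
          m * (max n 2 : ℝ) ^ (C * (1 / ε * Real.logb (1 + ε) (1 / ε)))) ∧
    (∀ δ : ℝ, 0 < δ → ∃ ε : ℝ, 0 < ε ∧ ε ≤ 1 / 2 ∧ ∃ d : ℕ,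
      ∀ (n m : ℕ) (Ψ : BAF.Problem (Fin n) (Fin m)), 0 < m →
        (∃ σ : Fin n → Fin m, BAF.IsTableOf (BAF.runPTAS Ψ ε).val σ ∧ Ψ.IsApprox (1 + δ) σ) ∧
        (BAF.runPTAS Ψ ε).steps ≤ m * max n 2 ^ d) := by
  constructor
  -- With `E` the stated exponent without `C`, one has `1 ≤ E` and therefore `19 + 10 * ⌊E⌋ ≤ 29 *
  -- E`.
  · refine ⟨29, by norm_num, fun ε hε₀ hε n m Ψ hm => ?_⟩
    obtain ⟨⟨σ, hσ, hσ'⟩, hsteps⟩ := BAF.runPTAS_spec Ψ hm hε₀ hε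
    refine ⟨fun σ hσ => hσ.isApprox hε₀ hε, ⟨σ, hσ, hσ', hσ'.isApprox hε₀ hε⟩, ?_⟩
    set E := 1 / ε * Real.logb (1 + ε) (1 / ε) with hE
    have hE₁ : 1 ≤ E := by
      refine le_trans ?_ (BAF.one_div_le_exponent hε₀ hε)
      exact (le_div_iff₀ hε₀).2 (by linarith)
    have hfloor : (⌊E⌋₊ : ℝ) ≤ E := Nat.floor_le (by linarith)
    have h₁ : ((BAF.runPTAS Ψ ε).steps : ℝ) ≤ m * (max n 2 : ℝ) ^ (19 + 10 * ⌊E⌋₊) := by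
      exact_mod_cast hsteps
    refine h₁.trans (mul_le_mul_of_nonneg_left ?_ (Nat.cast_nonneg m))
    rw [← Real.rpow_natCast]
    refine Real.rpow_le_rpow_of_exponent_le (one_le_two.trans (le_max_right _ _)) ?_
    push_cast
    linarith
  · intro δ hδ
    -- This `ε` satisfies `5 * ε ≤ δ`, and the degree depends on it alone.
    have hε₀ : 0 < min (1 / 2) (δ / 5) := lt_min (by norm_num) (by linarith)
    refine ⟨min (1 / 2) (δ / 5), hε₀, min_le_left _ _,
      19 + 10 * ⌊1 / min (1 / 2) (δ / 5) * Real.logb (1 + min (1 / 2) (δ / 5))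
        (1 / min (1 / 2) (δ / 5))⌋₊, fun n m Ψ hm => ?_⟩
    obtain ⟨⟨σ, hσ, hσ'⟩, hsteps⟩ := BAF.runPTAS_spec Ψ hm hε₀ (min_le_left _ _)
    refine ⟨⟨σ, hσ, fun τ => (hσ'.isApprox hε₀ (min_le_left _ _) τ).trans ?_⟩, hsteps⟩
    have h₁ : 0 ≤ Ψ.cost τ :=
      (Finset.sum_nonneg fun j _ => (Ψ.p_pos j).le).trans (BAF.sum_p_le_cost Ψ τ)
    have h₂ := min_le_right (1 / 2 : ℝ) (δ / 5)
    exact mul_le_mul_of_nonneg_right (by linarith) h₁
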